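/- All vector spaces and manifolds are convenient ($c^\infty$-complete) in the sense of Frölicher, Kriegl and Michor; $TM$ and $T'M$ denote the kinematic tangent and cotangent bundles (the fibres of $T'M$ are the bounded linear functionals on those of $TM$), and vector fields, forms and sections are smooth and local, i.e. defined over open sets. **Definitions.** A *weak subbundle* $T^\flat M$ of $T'M$ is a convenient vector bundle whose fibres are subspaces of the fibres of $T'M$ and whose inclusion in $T'M$ is a smooth bundle morphism. For $U\subset M$ open, $\mathfrak A(U)$ is the set of $f\in C^\infty(U)$ such that $df$ is a smooth section of $T^\flat M$ (so that, in charts where $T^\flat M\subset T'M$ is a constant inclusion $U\times\mathbb M^\flat\subset U\times\mathbb M'$, all derivatives $d^kf(x)(\cdot,u_2,\dots,u_k)$, $k\ge1$, lie in $T^\flat_xM$ and depend smoothly on $(x,u_2,\dots,u_k)$). A *partial Poisson anchor* is a smooth bundle morphism $P:T^\flat M\to TM$ with $\langle\xi,P\eta\rangle=-\langle\eta,P\xi\rangle$ such that, for every open $U$, the bracket $\{f,g\}_P=-\langle df,P(dg)\rangle$ maps $\mathfrak A(U)\times\mathfrak A(U)$ into $\mathfrak A(U)$ and satisfies the Jacobi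 identity. A *partial PN structure* on $(M,T^\flat M)$ consists of a partial Poisson anchor $P$ and a smooth tensor $N:TM\to TM$ of type $(1,1)$ such that * $N$ is a Nijenhuis tensor: $[NX,NY]-N([NX,Y]+[X,NY]-N[X,Y])=0$ for all vector fields $X,Y$; * the transpose $N^*$ of $N$ induces a smooth endomorphism of $T^\flat M$, and $N\circ P=P\circ N^*$ on $T^\flat M$; * for all sections $\alpha,\sigma$ of $T^\flat M$, with $X=P(\sigma)$, the form $L_X(N^*\alpha)-L_{NX}\alpha$ is a section of $T^\flat M$ and $$R(P,N)(\alpha,X)=L_{P\alpha}(N)X-P\bigl(L_X(N^*\alpha)-L_{NX}\alpha\bigr)=0 .$$ **Theorem.** Let $(P,N)$ be a partial PN structure on $(M,T^\flat M)$. Let $\mathcal D$ be an integrable distribution on $M$ with connected leaves, whose leaf space is a quotient manifold $\check M$: there is a surjective submersion $\jmath:M\to\check M$ (locally, in charts, the projection of a product of convenient spaces) whose fibres are the leaves of $\mathcal D$; so the fibres of $\jmath$ are connected and $\mathcal D_x=\ker d\jmath(x)$ for all $x$. Write $\delta\jmath(x)\xi=\xi\circ d\jmath(x)$. Suppose that the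 covectors $\xi\in T'_y\check M$ such that $\delta\jmath(x)\xi\in T^\flat_xM$ for all $x\in\jmath^{-1}(y)$ are the fibres of a weak subbundle $T^\flat\check M$ of $T'\check M$ that carries the structure induced by $T^\flat M$: a curve $\xi(t)$ in $T^\flat\check M$ over $\jmath\circ c$, where $c$ is a smooth curve in $M$, is smooth in $T^\flat\check M$ if and only if $\delta\jmath(c(t))\,\xi(t)$ is smooth in $T^\flat M$. For $V\subset\check M$ open, a vector field $X$ on $\jmath^{-1}(V)$ is called projectable if $d\jmath(x_1)X(x_1)=d\jmath(x_2)X(x_2)$ whenever $\jmath(x_1)=\jmath(x_2)$, and a $1$-form $\alpha$ on $\jmath^{-1}(V)$ is called projectable if there is a $1$-form $\check\alpha$ on $V$ with $\alpha(x)=\delta\jmath(x)\,\check\alpha(\jmath(x))$ for all $x$. Suppose that for every open $V\subset\check M$ * **(PpP)** $P(\alpha)$ is projectable for every projectable $1$-form $\alpha$ on $\jmath^{-1}(V)$ that is a section of $T^\flat M$; * **(PpN)** $N^*\alpha$ is projectable for every projectable $1$-form $\alpha$ on $\jmath^{-1}(V)$. Then there is a partial PN structure $(\check P,\check N)$ on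 $(\check M,T^\flat\check M)$ such that $\check P=d\jmath\circ P\circ\delta\jmath$ and $\check N^*=\delta\jmath^{-1}\circ N^*\circ\delta\jmath$, i.e. for all $x\in M$ $$\check P_{\jmath(x)}(\xi)=d\jmath(x)\,P_x\bigl(\delta\jmath(x)\xi\bigr)\quad(\xi\in T^\flat_{\jmath(x)}\check M),\qquad \delta\jmath(x)\bigl(\check N^*\xi\bigr)=N_x^*\bigl(\delta\jmath(x)\xi\bigr)\quad(\xi\in T'_{\jmath(x)}\check M).$$ -/

import Mathlib

open Filter Topology Set

noncomputable section

namespace Convenient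

/-! ### Convenient vector spaces and convenient calculus -/

section Calculus

variable {E : Type*} [AddCommGroup E] [Module ℝ E] [TopologicalSpace E]

/-- A convenient (or `c^∞`-complete) vector space: a Hausdorff locally convex real topological
vector space in which every Mackey-Cauchy sequence converges. -/
class ConvenientSpace (E : Type*) [AddCommGroup E] [Module ℝ E] [TopologicalSpace E] : Prop
    extends IsTopologicalAddGroup E, ContinuousSMul ℝ E, LocallyConvexSpace ℝ E, T2Space E where
  mackey_complete : ∀ x : ℕ → E,
    (∃ B : Set E, Bornology.IsVonNBounded ℝ B ∧ AbsConvex ℝ B ∧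
      ∀ ε : ℝ, 0 < ε → ∃ k : ℕ, ∀ m n : ℕ, k < m → m < n → ∃ b ∈ B, x m - x n = ε • b) →
    ∃ a : E, Tendsto x atTop (𝓝 a)

variable [ConvenientSpace E]
variable {F : Type*} [AddCommGroup F] [Module ℝ F] [TopologicalSpace F] [ConvenientSpace F]

instance : ConvenientSpace ℝ where
  mackey_complete := by
    rintro x ⟨B, hB, -, h⟩
    apply cauchySeq_tendsto_of_complete
    obtain ⟨C, hC⟩ := (NormedSpace.isVonNBounded_iff ℝ).1 hB |>.exists_norm_le
    rw [Metric.cauchySeq_iff']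
    intro ε hε
    have hC' : 0 < |C| + 1 := by positivity
    obtain ⟨k, hk⟩ := h (ε / (|C| + 1)) (by positivity)
    refine ⟨k + 1, fun n hn => ?_⟩
    rcases hn.eq_or_lt with rfl | hn
    · simpa using hε
    · obtain ⟨b, hb, hbx⟩ := hk (k + 1) n (by omega) hn
      have h1 : ‖b‖ < |C| + 1 := by
        have := hC b hb
        have := le_abs_self C
        linarith
      have h2 : x (k + 1) - x n = ε / (|C| + 1) * b := hbx
      rw [dist_comm, Real.dist_eq, h2, abs_mul, abs_of_pos (by positivity)]
      calc ε / (|C| + 1) * |b| < ε / (|C| + 1) * (|C| + 1) :=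
            mul_lt_mul_of_pos_left h1 (by positivity)
        _ = ε := by field_simp

/-- The curve `c` is smooth (infinitely differentiable) near the time `t`: on a neighbourhood of
`t` it has derivatives `d 0 = c`, `d 1`, `d 2`, … of all orders. -/
def SmoothCurveAt (c : ℝ → E) (t : ℝ) : Prop :=
  ∃ d : ℕ → ℝ → E, d 0 = c ∧ ∀ᶠ s in 𝓝 t, ∀ n, HasDerivAt (d n) (d (n + 1) s) s

/-- Smooth maps in the sense of convenient calculus, on a `c^∞`-open set `U`: smooth curves are
mapped to smooth curves. (Everything is stated for germs of curves; reparametrising a germ by a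
smooth map that is the identity near the given time gives the formulation with curves defined on
the whole real line.) -/
def SmoothOn (f : E → F) (U : Set E) : Prop :=
  ∀ (c : ℝ → E) (t : ℝ), SmoothCurveAt c t → c t ∈ U → SmoothCurveAt (fun s => f (c s)) t

/-- The derivative `df(u)v = lim (f(u + t v) - f(u)) / t`. -/
def dirDeriv (f : E → F) (u v : E) : F := deriv (fun t : ℝ => f (u + t • v)) 0

/-- Bounded (bornological) linear maps: bounded sets are mapped to bounded sets. -/
def MapsBounded (f : E → F) : Prop :=
  ∀ B : Set E, Bornology.IsVonNBounded ℝ B → Bornology.IsVonNBounded ℝ (f '' B)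

/-- The space `E` with its `c^∞`-topology. -/
def CInf (E : Type*) : Type _ := E

/-- The `c^∞`-topology: the final topology for all smooth curves `ℝ → E`. -/
instance : TopologicalSpace (CInf E) :=
  ⨆ c : {c : ℝ → E // ∀ t, SmoothCurveAt c t},
    TopologicalSpace.coinduced (Y := CInf E) c.1 inferInstance

end Calculus

/-! ### Convenient manifolds

A manifold modelled on `E` is a space with charts that are homeomorphisms onto open sets of `E` with
its `c^∞`-topology and whose changes of charts are smooth. -/

section Manifold

variable {E : Type*} [AddCommGroup E] [Module ℝ E] [TopologicalSpace E] [ConvenientSpace E]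
variable {M : Type*} [TopologicalSpace M]

/-- The change of charts `e' ∘ e⁻¹`. -/
def transition (e e' : OpenPartialHomeomorph M (CInf E)) : E → E := fun u => e' (e.symm u)

/-- Two charts are compatible if both changes of charts are smooth. -/
def CompatibleCharts (e e' : OpenPartialHomeomorph M (CInf E)) : Prop :=
  SmoothOn (transition e e') (e.symm.trans e').source ∧
    SmoothOn (transition e' e) (e'.symm.trans e).source

/-- `M` is a smooth convenient manifold modelled on `E`. -/
class ConvenientManifold (E : Type*) [AddCommGroup E] [Module ℝ E] [TopologicalSpace E]
    [ConvenientSpace E] (M : Type*) [TopologicalSpace M] [ChartedSpace (CInf E) M] : Prop where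
  compatible : ∀ e ∈ atlas (CInf E) M, ∀ e' ∈ atlas (CInf E) M, CompatibleCharts e e'

/-- The kinematic tangent space `T_x M`, identified with the model space through the preferred
chart at `x` (as in Mathlib's `TangentSpace`). -/
def Tangent (E : Type*) {M : Type*} (_x : M) : Type _ := E

instance (x : M) : AddCommGroup (Tangent E x) := inferInstanceAs (AddCommGroup E)
instance (x : M) : Module ℝ (Tangent E x) := inferInstanceAs (Module ℝ E)

/-- Vector fields (not necessarily smooth). -/
abbrev VField (E M : Type*) := ∀ x : M, Tangent E x

/-- Fields of real functions on the tangent spaces; `1`-forms are those that are linear, bounded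
and smooth. -/
abbrev PreForm (E M : Type*) := ∀ x : M, Tangent E x → ℝ

/-- The kinematic cotangent space `T'_x M`: the bounded linear functionals on `T_x M`. -/
def cotangent (E : Type*) [AddCommGroup E] [Module ℝ E] [TopologicalSpace E] [ConvenientSpace E]
    {M : Type*} (x : M) : Submodule ℝ (Tangent E x → ℝ) where
  carrier := {ξ | IsLinearMap ℝ ξ ∧ MapsBounded (E := E) (F := ℝ) ξ}
  zero_mem' := ⟨(0 : Tangent E x →ₗ[ℝ] ℝ).isLinear, fun B _ =>
    (Bornology.isVonNBounded_singleton (𝕜 := ℝ) (0 : ℝ)).subset (by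
      rintro _ ⟨b, _, rfl⟩
      exact mem_singleton_iff.2 rfl)⟩
  add_mem' := by
    rintro ξ η ⟨h1, h2⟩ ⟨h3, h4⟩
    refine ⟨(h1.mk' ξ + h3.mk' η).isLinear, fun B hB => ((h2 B hB).add (h4 B hB)).subset ?_⟩
    rintro _ ⟨b, hb, rfl⟩
    exact Set.add_mem_add ⟨b, hb, rfl⟩ ⟨b, hb, rfl⟩
  smul_mem' := by
    rintro a ξ ⟨h1, h2⟩
    refine ⟨(a • h1.mk' ξ).isLinear, fun B hB => ?_⟩
    have := (h2 B hB).image (a • ContinuousLinearMap.id ℝ ℝ)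
    refine this.subset ?_
    rintro _ ⟨b, hb, rfl⟩
    exact ⟨ξ b, ⟨b, hb, rfl⟩, rfl⟩

variable [ChartedSpace (CInf E) M]

/-- The coordinates in the chart `e` of a tangent vector at `x`. -/
def tcoord (e : OpenPartialHomeomorph M (CInf E)) (x : M) (v : Tangent E x) : E :=
  dirDeriv (E := E) (F := E) (transition (chartAt (CInf E) x) e) (chartAt (CInf E) x x) v

/-- The tangent vector at `x` with given coordinates in the chart `e`. -/
def tvec (e : OpenPartialHomeomorph M (CInf E)) (x : M) (v : E) : Tangent E x :=
  dirDeriv (E := E) (F := E) (transition e (chartAt (CInf E) x)) (e x) v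

/-- The curve `c` in the manifold `M` is smooth near the time `t`. -/
def MSmoothCurveAt (E : Type*) [AddCommGroup E] [Module ℝ E] [TopologicalSpace E]
    [ConvenientSpace E] {M : Type*} [TopologicalSpace M] [ChartedSpace (CInf E) M]
    (c : ℝ → M) (t : ℝ) : Prop :=
  ContinuousAt c t ∧ SmoothCurveAt (E := E) (fun s => chartAt (CInf E) (c t) (c s)) t

/-- The curve `s ↦ (c s, v s)` in the tangent bundle `TM` is smooth near the time `t`. -/
def TSmoothCurveAt (c : ℝ → M) (v : ∀ s, Tangent E (c s)) (t : ℝ) : Prop :=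
  MSmoothCurveAt E c t ∧
    SmoothCurveAt (fun s => tcoord (chartAt (CInf E) (c t)) (c s) (v s)) t

/-- `f` is a smooth real function on the open set `U`. -/
def SmoothFunOn (E : Type*) [AddCommGroup E] [Module ℝ E] [TopologicalSpace E]
    [ConvenientSpace E] {M : Type*} [TopologicalSpace M] [ChartedSpace (CInf E) M]
    (U : Set M) (f : M → ℝ) : Prop :=
  ∀ (c : ℝ → M) (t : ℝ), MSmoothCurveAt E c t → c t ∈ U → SmoothCurveAt (fun s => f (c s)) t

/-- `X` is a smooth vector field on the open set `U`. -/
def SmoothFieldOn (U : Set M) (X : VField E M) : Prop :=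
  ∀ (c : ℝ → M) (t : ℝ), MSmoothCurveAt E c t → c t ∈ U →
    TSmoothCurveAt c (fun s => X (c s)) t

/-- `α` is a smooth (kinematic) `1`-form on the open set `U`: a fibrewise linear and bounded
function on `TU` that is smooth. -/
def SmoothFormOn (U : Set M) (α : PreForm E M) : Prop :=
  (∀ x ∈ U, α x ∈ cotangent E x) ∧
    ∀ (c : ℝ → M) (v : ∀ s, Tangent E (c s)) (t : ℝ), TSmoothCurveAt c v t → c t ∈ U →
      SmoothCurveAt (fun s => α (c s) (v s)) t

/-- The differential of a real function. -/
def dFun (E : Type*) [AddCommGroup E] [Module ℝ E] [TopologicalSpace E]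
    [ConvenientSpace E] {M : Type*} [TopologicalSpace M] [ChartedSpace (CInf E) M]
    (f : M → ℝ) : PreForm E M := fun x v =>
  dirDeriv (E := E) (fun u => f ((chartAt (CInf E) x).symm u)) (chartAt (CInf E) x x) v

/-- The local representative of a vector field in a chart. -/
def fieldRep (e : OpenPartialHomeomorph M (CInf E)) (X : VField E M) : E → E :=
  fun u => tcoord e (e.symm u) (X (e.symm u))

/-- The Lie bracket of vector fields, in the chart at `x`: `dY(X) - dX(Y)`. -/
def lieBracket (X Y : VField E M) : VField E M := fun x =>
  let e := chartAt (CInf E) x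
  (dirDeriv (fieldRep e Y) (e x) (fieldRep e X (e x)) -
    dirDeriv (fieldRep e X) (e x) (fieldRep e Y (e x)) : E)

/-- The Lie derivative `L_X α` of a `1`-form, in the chart at `x`: for a constant `v`,
`(L_X α)(v) = d(α(v))(X) + α(dX(v))`. -/
def lieDerivForm (X : VField E M) (α : PreForm E M) : PreForm E M := fun x v =>
  let e := chartAt (CInf E) x
  dirDeriv (E := E) (fun u => α (e.symm u) (tvec e (e.symm u) v)) (e x) (fieldRep e X (e x)) +
    α x (dirDeriv (E := E) (F := E) (fieldRep e X) (e x) v)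

/-- Fields of endomorphisms of the tangent spaces. -/
abbrev TEnd (E M : Type*) [AddCommGroup E] [Module ℝ E] [TopologicalSpace E]
    [ConvenientSpace E] := ∀ x : M, Tangent E x →ₗ[ℝ] Tangent E x

/-- `N X` for a vector field `X`. -/
def TEnd.onField (N : TEnd E M) (X : VField E M) : VField E M := fun x => N x (X x)

/-- `N^t α` for a `1`-form `α` (also written `N^* α`). -/
def TEnd.transpose (N : TEnd E M) (α : PreForm E M) : PreForm E M := fun x v => α x (N x v)

/-- The tensor `N` of type `(1,1)` is smooth. -/
def TEnd.Smooth (N : TEnd E M) : Prop :=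
  ∀ (c : ℝ → M) (v : ∀ s, Tangent E (c s)) (t : ℝ), TSmoothCurveAt c v t →
    TSmoothCurveAt c (fun s => N (c s) (v s)) t

/-- The torsion `T(N)(X,Y) = [NX,NY] - N([NX,Y] + [X,NY] - N[X,Y])`. -/
def TEnd.torsion (N : TEnd E M) (X Y : VField E M) : VField E M :=
  lieBracket (N.onField X) (N.onField Y) -
    N.onField (lieBracket (N.onField X) Y + lieBracket X (N.onField Y) -
      N.onField (lieBracket X Y))

/-- The Lie derivative of `N`: `(L_Z N)X = [Z,NX] - N[Z,X]`. -/
def TEnd.lieDeriv (Z : VField E M) (N : TEnd E M) (X : VField E M) : VField E M :=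
  lieBracket Z (N.onField X) - N.onField (lieBracket Z X)

/-- A Nijenhuis tensor: smooth with zero torsion. -/
structure IsNijenhuis (N : TEnd E M) : Prop where
  smooth : N.Smooth
  torsion_eq_zero : ∀ U : Set M, IsOpen U → ∀ X Y : VField E M,
    SmoothFieldOn U X → SmoothFieldOn U Y → ∀ x ∈ U, N.torsion X Y x = 0

end Manifold

/-! ### Weak subbundles of the cotangent bundle and partial Poisson structures -/

section Poisson

variable {E : Type*} [AddCommGroup E] [Module ℝ E] [TopologicalSpace E] [ConvenientSpace E]
variable {B : Type*} [AddCommGroup B] [Module ℝ B] [TopologicalSpace B] [ConvenientSpace B]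
variable {M : Type*} [TopologicalSpace M] [ChartedSpace (CInf E) M]

/-- A weak subbundle `T^♭M` of the cotangent bundle `T'M`: a convenient vector bundle with
typical fibre the convenient space `B`, whose fibres are subspaces of the `T'_x M` and whose
inclusion in `T'M` is a smooth bundle morphism. It is given by a local trivialisation
`frame x₀ : dom x₀ × B → T'M` around every point `x₀`. -/
structure WeakSubbundle (E : Type*) [AddCommGroup E] [Module ℝ E] [TopologicalSpace E]
    [ConvenientSpace E] (B : Type*) [AddCommGroup B] [Module ℝ B] [TopologicalSpace B]
    [ConvenientSpace B] (M : Type*) [TopologicalSpace M] [ChartedSpace (CInf E) M] where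
  /-- The fibre `T^♭_x M`. -/
  fib : ∀ x : M, Submodule ℝ (Tangent E x → ℝ)
  fib_le : ∀ x, fib x ≤ cotangent E x
  dom : M → Set M
  isOpen_dom : ∀ x₀, IsOpen (dom x₀)
  mem_dom : ∀ x₀, x₀ ∈ dom x₀
  frame : ∀ _x₀ x : M, B →ₗ[ℝ] (Tangent E x → ℝ)
  frame_injective : ∀ x₀, ∀ x ∈ dom x₀, Function.Injective (frame x₀ x)
  range_frame : ∀ x₀, ∀ x ∈ dom x₀, LinearMap.range (frame x₀ x) = fib x
  /-- The inclusion of `T^♭M` in `T'M` is smooth. -/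
  smooth_inclusion : ∀ (x₀ : M) (c : ℝ → M) (v : ∀ s, Tangent E (c s)) (b : ℝ → B) (t : ℝ),
    TSmoothCurveAt c v t → c t ∈ dom x₀ → SmoothCurveAt b t →
      SmoothCurveAt (fun s => frame x₀ (c s) (b s) (v s)) t
  /-- The changes of trivialisation are smooth. -/
  smooth_transition : ∀ (x₀ x₁ : M) (c : ℝ → M) (b b' : ℝ → B) (t : ℝ),
    MSmoothCurveAt E c t → c t ∈ dom x₀ → c t ∈ dom x₁ → SmoothCurveAt b t →
      (∀ᶠ s in 𝓝 t, frame x₁ (c s) (b' s) = frame x₀ (c s) (b s)) → SmoothCurveAt b' t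

namespace WeakSubbundle

variable (W : WeakSubbundle E B M)

/-- The curve `s ↦ (c s, ξ s)` in `T^♭M` is smooth near the time `t`. -/
def SmoothCurveAt (c : ℝ → M) (ξ : ∀ s, Tangent E (c s) → ℝ) (t : ℝ) : Prop :=
  MSmoothCurveAt E c t ∧ ∃ b : ℝ → B, Convenient.SmoothCurveAt b t ∧
    ∀ᶠ s in 𝓝 t, W.frame (c t) (c s) (b s) = ξ s

/-- `α` is a smooth section of `T^♭M` over the open set `U`. -/
def SectionOn (U : Set M) (α : PreForm E M) : Prop :=
  ∀ (c : ℝ → M) (t : ℝ), MSmoothCurveAt E c t → c t ∈ U →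
    W.SmoothCurveAt c (fun s => α (c s)) t

/-- The algebra `𝔄(U)`: the smooth functions `f` on `U` whose differential `df` is a smooth section
of `T^♭M` over `U`. In a chart over which the inclusion of `T^♭M` in `T'M` is that of
`U × B` in `U × E'`, the derivatives of the smooth map `df : U → B` are the forms
`d^k f(x)(·, u₂, …, u_k)`; so then all of these belong to `T^♭_x M`, for every `k ≥ 1`, and
depend smoothly on `(x, u₂, …, u_k)`, as elements of `T^♭_x M`. -/
def Admissible (U : Set M) : Set (M → ℝ) :=
  {f | SmoothFunOn E U f ∧ W.SectionOn U (dFun E f)}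

/-- Fields of linear maps `P_x : T^♭_x M → T_x M`. -/
abbrev Anchor (W : WeakSubbundle E B M) := ∀ x : M, W.fib x →ₗ[ℝ] Tangent E x

variable {W}

open Classical in
/-- The vector field `P(α)` of a section `α` of `T^♭M` (with value `0` at the points `x` where
`α(x)` is not in `T^♭_x M`). -/
def Anchor.onForm (P : W.Anchor) (α : PreForm E M) : VField E M := fun x =>
  if h : α x ∈ W.fib x then P x ⟨α x, h⟩ else 0

/-- The bundle morphism `P : T^♭M → TM` is smooth. -/
def Anchor.Smooth (P : W.Anchor) : Prop :=
  ∀ (c : ℝ → M) (ξ : ∀ s, W.fib (c s)) (t : ℝ),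
    W.SmoothCurveAt c (fun s => (ξ s : Tangent E (c s) → ℝ)) t →
      TSmoothCurveAt c (fun s => P (c s) (ξ s)) t

/-- The bracket `{f,g}_P = -<df, P(dg)>`. -/
def Anchor.bracket (P : W.Anchor) (f g : M → ℝ) : M → ℝ := fun x =>
  -(dFun E f x (P.onForm (dFun E g) x))

end WeakSubbundle

/-- `P : T^♭M → TM` is a partial Poisson anchor: a smooth skew-symmetric bundle morphism whose
bracket takes its values in `𝔄(U)` on `𝔄(U)` and satisfies the Jacobi identity. -/
structure IsPartialPoisson {W : WeakSubbundle E B M} (P : W.Anchor) : Prop where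
  smooth : P.Smooth
  skew : ∀ (x : M) (ξ η : W.fib x), ξ.1 (P x η) = -(η.1 (P x ξ))
  bracket_mem : ∀ U : Set M, IsOpen U → ∀ f ∈ W.Admissible U, ∀ g ∈ W.Admissible U,
    P.bracket f g ∈ W.Admissible U
  jacobi : ∀ U : Set M, IsOpen U → ∀ f ∈ W.Admissible U, ∀ g ∈ W.Admissible U,
    ∀ h ∈ W.Admissible U, ∀ x ∈ U,
      P.bracket f (P.bracket g h) x + P.bracket g (P.bracket h f) x +
        P.bracket h (P.bracket f g) x = 0

/-- The form `L_X(N^t α) - L_{NX} α`. -/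
def concomitantForm (N : TEnd E M) (α : PreForm E M) (X : VField E M) : PreForm E M :=
  lieDerivForm X (N.transpose α) - lieDerivForm (N.onField X) α

/-- The concomitant `R(P,N)(α,X) = L_{P(α)}(N)X - P(L_X(N^t α)) + P(L_{NX} α)`; the arguments of
`P` are put together since, when `T^♭M ≠ T'M`, in general only the difference of the two forms is a
section of `T^♭M`. -/
def concomitant {W : WeakSubbundle E B M} (P : W.Anchor) (N : TEnd E M) (α : PreForm E M)
    (X : VField E M) : VField E M :=
  TEnd.lieDeriv (P.onForm α) N X - P.onForm (concomitantForm N α X)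

/-- `(P, N)` is a partial PN structure on `M`: `P` is a partial Poisson anchor, `N` is a Nijenhuis
tensor, `N^t` induces a smooth endomorphism of `T^♭M`, `N ∘ P = P ∘ N^t`, and `R(P,N) = 0` for
all local sections `α` of `T^♭M` and all vector fields `X = P(σ)` in the image of `P`. -/
structure IsPartialPN {W : WeakSubbundle E B M} (P : W.Anchor) (N : TEnd E M) : Prop where
  poisson : IsPartialPoisson P
  nijenhuis : IsNijenhuis N
  transpose_mem : ∀ (x : M), ∀ ξ ∈ W.fib x, ξ ∘ N x ∈ W.fib x
  transpose_smooth : ∀ (c : ℝ → M) (ξ : ∀ s, Tangent E (c s) → ℝ) (t : ℝ),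
    W.SmoothCurveAt c ξ t → W.SmoothCurveAt c (fun s => ξ s ∘ N (c s)) t
  comm : ∀ (x : M) (ξ : W.fib x), N x (P x ξ) = P x ⟨ξ.1 ∘ N x, transpose_mem x ξ.1 ξ.2⟩
  concomitant_form : ∀ U : Set M, IsOpen U → ∀ α σ : PreForm E M,
    W.SectionOn U α → W.SectionOn U σ → W.SectionOn U (concomitantForm N α (P.onForm σ))
  concomitant_eq_zero : ∀ U : Set M, IsOpen U → ∀ α σ : PreForm E M,
    W.SectionOn U α → W.SectionOn U σ → ∀ x ∈ U, concomitant P N α (P.onForm σ) x = 0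

end Poisson

/-! ### Quotient manifolds and projection -/

section Projection

variable (E : Type*) [AddCommGroup E] [Module ℝ E] [TopologicalSpace E] [ConvenientSpace E]
variable (F : Type*) [AddCommGroup F] [Module ℝ F] [TopologicalSpace F] [ConvenientSpace F]
variable {M : Type*} [TopologicalSpace M] [ChartedSpace (CInf E) M]
variable {Q : Type*} [TopologicalSpace Q] [ChartedSpace (CInf F) Q]

/-- The tangent map `dj(x) : T_x M → T_{j(x)} Q`. -/
def tMap (j : M → Q) (x : M) : Tangent E x → Tangent F (j x) :=
  dirDeriv (E := E) (F := F)
    (fun u => chartAt (CInf F) (j x) (j ((chartAt (CInf E) x).symm u))) (chartAt (CInf E) x x)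

/-- The transposed map `δj(x)` on covectors, `ξ ↦ ξ ∘ dj(x)`. -/
def coMap (j : M → Q) (x : M) (ξ : Tangent F (j x) → ℝ) : Tangent E x → ℝ :=
  fun v => ξ (tMap E F j x v)

/-- `j` is a submersion: in suitable charts it is a bounded linear map that admits a bounded
linear right inverse, that is, the projection of a product. -/
def IsSubmersion (j : M → Q) : Prop :=
  ∀ x : M, ∃ (e : OpenPartialHomeomorph M (CInf E)) (e' : OpenPartialHomeomorph Q (CInf F))
    (p : E →ₗ[ℝ] F) (s : F →ₗ[ℝ] E),
    (∀ e₁ ∈ atlas (CInf E) M, CompatibleCharts e e₁) ∧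
    (∀ e₁ ∈ atlas (CInf F) Q, CompatibleCharts e' e₁) ∧
    MapsBounded p ∧ MapsBounded s ∧ (∀ w, p (s w) = w) ∧ x ∈ e.source ∧
    ∀ x' ∈ e.source, j x' ∈ e'.source ∧ (e' (j x') : F) = p (e x' : E)

/-- `Q` is the quotient manifold `M/𝒟` of `M` by the integrable distribution `𝒟` with connected
leaves, and `j` is the canonical projection: `j` is a surjective submersion whose fibres are the
leaves of `𝒟`. So the fibres of `j` are connected, and `𝒟_x` is the tangent space
`ker dj(x)` at `x` of the fibre through `x`. -/
structure IsLeafSpace (𝒟 : ∀ x : M, Submodule ℝ (Tangent E x)) (j : M → Q) : Prop where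
  submersion : IsSubmersion E F j
  surjective : Function.Surjective j
  connected : ∀ y : Q, IsConnected (j ⁻¹' {y})
  ker_eq : ∀ (x : M) (v : Tangent E x), v ∈ 𝒟 x ↔ tMap E F j x v = 0

/-- The projectable vector fields over the open set `V` of `Q`: the smooth vector fields `X` on
`j⁻¹(V)` such that `dj(x₁)X(x₁) = dj(x₂)X(x₂)` whenever `x₁`, `x₂` are in the same leaf. -/
def projectableFields (j : M → Q) (V : Set Q) : Set (VField E M) :=
  {X | SmoothFieldOn (j ⁻¹' V) X ∧ ∀ x₁ ∈ j ⁻¹' V, ∀ x₂ ∈ j ⁻¹' V, j x₁ = j x₂ →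
    (⟨j x₁, tMap E F j x₁ (X x₁)⟩ : Σ y : Q, Tangent F y) =
      ⟨j x₂, tMap E F j x₂ (X x₂)⟩}

/-- The projectable `1`-forms over the open set `V` of `Q`: the forms on `j⁻¹(V)` that are the
pull-back `α(x) = δj(x) α'(j(x))` of a `1`-form `α'` on `V`. -/
def projectableForms (j : M → Q) (V : Set Q) : Set (PreForm E M) :=
  {α | ∃ α' : PreForm F Q, SmoothFormOn V α' ∧ ∀ x ∈ j ⁻¹' V, α x = coMap E F j x (α' (j x))}

variable {E F}
variable {B : Type*} [AddCommGroup B] [Module ℝ B] [TopologicalSpace B] [ConvenientSpace B]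
variable {C : Type*} [AddCommGroup C] [Module ℝ C] [TopologicalSpace C] [ConvenientSpace C]

/-- `T^♭Q` is the weak subbundle of `T'Q` that `j` induces from `T^♭M`: it consists of the
covectors whose pull-backs to the points of the fibre are all in `T^♭M`, and it carries the smooth
structure induced by that of `T^♭M` (a curve of covectors over `j ∘ c` is smooth in `T^♭Q` if and
only if its pull-back along `c` is smooth in `T^♭M`). -/
structure IsInducedSubbundle (j : M → Q) (W : WeakSubbundle E B M) (W' : WeakSubbundle F C Q) :
    Prop where
  mem_fib : ∀ (y : Q) (ξ : PreForm F Q),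
    ξ y ∈ W'.fib y ↔ ξ y ∈ cotangent F y ∧ ∀ x : M, j x = y → coMap E F j x (ξ (j x)) ∈ W.fib x
  smooth_iff : ∀ (c : ℝ → M) (ξ : ∀ s, Tangent F (j (c s)) → ℝ) (t : ℝ),
    MSmoothCurveAt E c t → (∀ᶠ s in 𝓝 t, ξ s ∈ W'.fib (j (c s))) →
      (W'.SmoothCurveAt (fun s => j (c s)) ξ t ↔
        W.SmoothCurveAt c (fun s => coMap E F j (c s) (ξ s)) t)

end Projection

end Convenient

end

open Convenient

open scoped ContDiff

/-! ### Boundedness and smooth curves -/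

namespace Convenient

section WeakBoundedness

/-! Conditions (PpP) and (PpN) make `dj ∘ P ∘ δj` and `dj ∘ N` independent of the point chosen in a
fibre of `j` and, for `N`, of the lift of the tangent vector. They only speak of local forms, so
enough local forms are needed: every covector of `T^♭Q` is the value of a local section with
constant coordinates in a trivialisation, and the forms that are constant in a chart separate
tangent vectors by Hahn-Banach. This produces fibrewise linear maps `P'` and `N'` related to `P` and
`N` (`exists_relatedAnchor`, `exists_relatedEnd`).

Each axiom for `(P', N')` is then the axiom for `(P, N)` read through `j`
(`IsPartialPN.of_related`). Curves, vectors along them and vector fields lift locally along a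
submersion, so smoothness on `Q` can be tested on `M`. A form on `V` is a section of `T^♭Q` exactly
when its pull-back is a section of `T^♭M`; hence a function is in `𝔄(V)` exactly when its pull-back
is in `𝔄(j⁻¹V)`, and pull-back intertwines the two Poisson brackets. Brackets of `j`-related fields
are `j`-related, and Lie derivatives of forms commute with pull-back. So the torsion of `N'` and the
concomitant of `(P', N')` are images under `dj` of objects that vanish on `M`.

The calculus behind these statements rests on two facts. A curve in a convenient space is smooth as
soon as its compositions with continuous functionals are (`smoothCurveAt_iff_scalar`): weakly
bounded sets are bounded, so scalar estimates make the difference quotients Mackey-Cauchy. A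
function on the plane that is smooth along smooth curves is `C^∞` (Boman, `CurveSmooth.contDiff`).
Together they reduce the additivity of the differential, the chain rule, the product rule and the
symmetry of second derivatives to functions of two real variables. The symmetry is what makes
brackets natural. -/

/-- A set on which every linear form dominated by `p` is bounded is bounded for `p`. -/
theorem _root_.Seminorm.bddAbove_of_forall_linear {V : Type*} [AddCommGroup V] [Module ℝ V]
    (p : Seminorm ℝ V) {S : Set V}
    (h : ∀ l : V →ₗ[ℝ] ℝ, (∃ C : ℝ, ∀ x, |l x| ≤ C * p x) → ∃ C : ℝ, ∀ x ∈ S, |l x| ≤ C) :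
    ∃ C : ℝ, ∀ x ∈ S, p x ≤ C := by
  let _ := AddGroupSeminorm.toSeminormedAddCommGroup p.toAddGroupSeminorm
  let _ : NormedSpace ℝ V := ⟨fun a x => (map_smul_eq_mul p a x).le⟩
  -- The points of `S` act on the dual space, which is complete even if `V` is not; they are
  -- pointwise bounded there, hence uniformly bounded. The embedding in the bidual is isometric, so
  -- this bounds `p` itself.
  obtain ⟨C, hC⟩ := banach_steinhaus
    (g := fun x : S => NormedSpace.inclusionInDoubleDual ℝ V (x : V)) (fun f => by
      obtain ⟨C, hC⟩ := h f.toLinearMap ⟨‖f‖, fun x => f.le_opNorm x⟩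
      exact ⟨C, fun x => hC x x.2⟩)
  refine ⟨C, fun x hx => ?_⟩
  have := hC ⟨x, hx⟩
  change ‖x‖ ≤ C
  rw [← LinearIsometry.norm_map (NormedSpace.inclusionInDoubleDualLi ℝ (E := V)) x]
  exact this

variable {E : Type*} [AddCommGroup E] [Module ℝ E] [TopologicalSpace E] [IsTopologicalAddGroup E]
  [ContinuousSMul ℝ E] [LocallyConvexSpace ℝ E]

/-- Mackey's theorem: weakly bounded sets are bounded. -/
theorem isVonNBounded_of_forall_dual {S : Set E}
    (h : ∀ l : E →L[ℝ] ℝ, ∃ C : ℝ, ∀ x ∈ S, |l x| ≤ C) : Bornology.IsVonNBounded ℝ S := by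
  have hw := with_gaugeSeminormFamily (𝕜 := ℝ) (E := E)
  rw [hw.isVonNBounded_iff_seminorm_bddAbove]
  intro i
  -- A linear form dominated by one of the defining seminorms is continuous, so the hypothesis
  -- applies to it.
  obtain ⟨C, hC⟩ := (gaugeSeminormFamily ℝ E i).bddAbove_of_forall_linear (S := S) (by
    rintro l ⟨C, hC⟩
    have hl : Continuous l := by
      refine WithSeminorms.continuous_normedSpace_rng (F := ℝ) hw l ?_
      refine ⟨{i}, C.toNNReal, fun x => ?_⟩
      have h1 := hC x
      have h2 : C * gaugeSeminormFamily ℝ E i x ≤ C.toNNReal * gaugeSeminormFamily ℝ E i x :=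
        mul_le_mul_of_nonneg_right (Real.le_coe_toNNReal C) (apply_nonneg _ _)
      simpa [NNReal.smul_def] using h1.trans h2
    exact h ⟨l, hl⟩)
  exact ⟨C, by rintro _ ⟨x, hx, rfl⟩; exact hC x hx⟩

omit [IsTopologicalAddGroup E] [ContinuousSMul ℝ E] [LocallyConvexSpace ℝ E] in
theorem exists_abs_le_of_isVonNBounded {S : Set E} (hS : Bornology.IsVonNBounded ℝ S)
    (l : E →L[ℝ] ℝ) : ∃ C : ℝ, ∀ x ∈ S, |l x| ≤ C := by
  have := (hS.image l)
  obtain ⟨C, hC⟩ := (NormedSpace.isVonNBounded_iff ℝ).1 this |>.exists_norm_le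
  exact ⟨C, fun x hx => hC _ ⟨x, hx, rfl⟩⟩

end WeakBoundedness

/-! ### Real functions: derivative sequences and the rate of convergence of slopes -/

section Scalar

theorem contDiffAt_of_hasDerivAt_seq {d : ℕ → ℝ → ℝ} {t : ℝ}
    (h : ∀ᶠ s in 𝓝 t, ∀ n, HasDerivAt (d n) (d (n + 1) s) s) : ContDiffAt ℝ ∞ (d 0) t := by
  obtain ⟨O, hO, hOo, htO⟩ := eventually_nhds_iff.1 h
  suffices H : ∀ n : ℕ, ∀ k, ContDiffOn ℝ n (d k) O by
    rw [contDiffAt_infty]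
    exact fun n => (H n 0).contDiffAt (hOo.mem_nhds htO)
  intro n
  induction n with
  | zero =>
    intro k
    exact contDiffOn_zero.2 fun s hs => (hO s hs k).continuousAt.continuousWithinAt
  | succ n ih =>
    intro k
    have := (contDiffOn_succ_iff_deriv_of_isOpen (𝕜 := ℝ) (n := (n : ℕ∞ω)) (f := d k) hOo).2
      ⟨fun s hs => (hO s hs k).differentiableAt.differentiableWithinAt, by simp,
        (ih (k + 1)).congr fun s hs => (hO s hs k).deriv⟩
    exact_mod_cast this

/-- Mean value inequality for `x ↦ f x - f'(s) x`, whose derivative is `O(x - s)`. The linear rate,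
and not mere convergence, is what later gives Mackey convergence of vector-valued slopes. -/
theorem isBigO_slope_sub_deriv {f : ℝ → ℝ} {s : ℝ} (hf : ContDiffAt ℝ ∞ f s) :
    (fun r : ℝ => r⁻¹ * (f (s + r) - f s) - deriv f s) =O[𝓝[≠] 0] fun r => r := by
  have h2 : ContDiffAt ℝ 2 f s := contDiffAt_infty.1 hf 2
  have hf1 : ∀ᶠ x in 𝓝 s, DifferentiableAt ℝ f x :=
    (h2.eventually (by simp)).mono fun x hx => hx.differentiableAt (by simp)
  have hd : DifferentiableAt ℝ (deriv f) s :=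
    (h2.derivWithin (m := 1) (by norm_num)).differentiableAt (by simp)
  obtain ⟨C, hC⟩ := hd.hasDerivAt.isBigO_sub.bound
  obtain ⟨ε, hε, H⟩ := Metric.eventually_nhds_iff.1 (hC.and hf1)
  refine Asymptotics.IsBigO.of_bound |C| ?_
  rw [eventually_nhdsWithin_iff, Metric.eventually_nhds_iff]
  refine ⟨ε, hε, fun r hr hr0 => ?_⟩
  have hr0 : r ≠ 0 := hr0
  rw [dist_zero_right] at hr
  have key := (convex_uIcc s (s + r)).norm_image_sub_le_of_norm_hasDerivWithin_le
    (f := fun x => f x - deriv f s * x) (f' := fun x => deriv f x - deriv f s) (C := |C| * |r|)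
    (x := s) (y := s + r) (fun x hx => ?_) (fun x hx => ?_) left_mem_uIcc right_mem_uIcc
  · have : r⁻¹ * (f (s + r) - f s) - deriv f s
        = r⁻¹ * ((f (s + r) - deriv f s * (s + r)) - (f s - deriv f s * s)) := by
      field_simp
      ring
    rw [this, norm_mul, norm_inv, inv_mul_le_iff₀ (norm_pos_iff.2 hr0)]
    calc _ ≤ _ := key
      _ = _ := by simp only [add_sub_cancel_left, Real.norm_eq_abs]; ring
  all_goals
    have hx' : |x - s| ≤ |r| := by
      have := abs_sub_left_of_mem_uIcc hx
      simpa using this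
    have hxε : dist x s < ε := by rw [Real.dist_eq]; exact hx'.trans_lt hr
  · have h1 := (H hxε).2.hasDerivAt.fun_sub ((hasDerivAt_id' x).const_mul (deriv f s))
    simpa using h1.hasDerivWithinAt
  · have h1 := (H hxε).1
    simp only [Real.norm_eq_abs] at h1 ⊢
    calc _ ≤ C * |x - s| := h1
      _ ≤ |C| * |r| := mul_le_mul (le_abs_self C) hx' (abs_nonneg _) (abs_nonneg _)

end Scalar

/-! ### Curves in convenient spaces and the scalar criterion for smoothness -/

variable {E : Type*} [AddCommGroup E] [Module ℝ E] [TopologicalSpace E] [ConvenientSpace E]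
variable {F : Type*} [AddCommGroup F] [Module ℝ F] [TopologicalSpace F] [ConvenientSpace F]

-- The quotients `y n / r n` are weakly bounded, hence bounded by Mackey's theorem, and so are their
-- images under `L`. Multiplying a bounded sequence by `r n → 0` gives a null sequence; continuity
-- of `L` plays no role.
omit [ConvenientSpace F] in
theorem tendsto_zero_of_weak_isBigO {L : E →ₗ[ℝ] F} (hL : MapsBounded L) {y : ℕ → E} {r : ℕ → ℝ}
    (hr : Tendsto r atTop (𝓝 0)) (hr0 : ∀ n, r n ≠ 0)
    (h : ∀ l : E →L[ℝ] ℝ, (fun n => l (y n)) =O[atTop] r) :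
    Tendsto (fun n => L (y n)) atTop (𝓝 0) := by
  have hb : Bornology.IsVonNBounded ℝ (range fun n => (r n)⁻¹ • y n) := by
    refine isVonNBounded_of_forall_dual fun l => ?_
    obtain ⟨C, hC, h⟩ := Asymptotics.bound_of_isBigO_nat_atTop (h l)
    refine ⟨C, ?_⟩
    rintro _ ⟨n, rfl⟩
    have := h (hr0 n)
    rw [map_smul, smul_eq_mul, abs_mul, abs_inv, inv_mul_le_iff₀ (abs_pos.2 (hr0 n)), mul_comm]
    exact this
  have := (hL _ hb).smul_tendsto_zero (x := fun n => L ((r n)⁻¹ • y n)) (ε := r) (l := atTop)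
    (Eventually.of_forall fun n => ⟨_, ⟨n, rfl⟩, rfl⟩) hr
  refine this.congr fun n => ?_
  simp [smul_smul, hr0 n]

omit [ConvenientSpace E] in
theorem mapsBounded_id : MapsBounded (E := E) (F := E) (LinearMap.id : E →ₗ[ℝ] E) := fun B hB => by
  simpa using hB


theorem hasDerivAt_iff_tendsto {c : ℝ → E} {v : E} {s : ℝ} :
    HasDerivAt c v s ↔ Tendsto (fun r : ℝ => r⁻¹ • (c (s + r) - c s)) (𝓝[≠] 0) (𝓝 v) := by
  have h0 : Tendsto (fun r : ℝ => s + r) (𝓝 0) (𝓝 s) := by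
    simpa using (continuous_const_add s).tendsto (0 : ℝ)
  have h0' : Tendsto (fun r : ℝ => r - s) (𝓝 s) (𝓝 0) := by
    simpa using (continuous_sub_right s).tendsto s
  have h1 : HasDerivAt c v s ↔
      Tendsto (fun x : ℝ => (x - s)⁻¹ • (c x - c s - (x - s) • v)) (𝓝 s) (𝓝 0) := by
    unfold HasDerivAt HasDerivAtFilter
    rw [← HasFDerivAt, hasFDerivAt_iff_isLittleOTVS,
      Asymptotics.isLittleOTVS_iff_tendsto_inv_smul]
    · simp
    · refine Eventually.of_forall fun x hx => ?_
      rw [sub_eq_zero] at hx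
      simp [hx]
  rw [h1, ← tendsto_sub_nhds_zero_iff (x := v)]
  have key : ∀ r : ℝ, r ≠ 0 → r⁻¹ • (c (s + r) - c s) - v
      = (s + r - s)⁻¹ • (c (s + r) - c s - (s + r - s) • v) := by
    intro r hr
    rw [add_sub_cancel_left, smul_sub (r⁻¹) (c (s + r) - c s), smul_smul, inv_mul_cancel₀ hr,
      one_smul]
  constructor
  · intro h
    refine ((h.comp h0).mono_left nhdsWithin_le_nhds).congr' ?_
    filter_upwards [self_mem_nhdsWithin] with r hr
    exact (key r hr).symm
  · intro h
    have h2 : Tendsto (fun x : ℝ => (x - s)⁻¹ • (c x - c s - (x - s) • v)) (𝓝[≠] s) (𝓝 0) := by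
      have h3 : Tendsto (fun r : ℝ => r - s) (𝓝[≠] s) (𝓝[≠] 0) :=
        tendsto_nhdsWithin_iff.2 ⟨h0'.mono_left nhdsWithin_le_nhds, by
          filter_upwards [self_mem_nhdsWithin] with x hx using sub_ne_zero.2 hx⟩
      refine (h.comp h3).congr' ?_
      filter_upwards [self_mem_nhdsWithin] with x hx
      have := key (x - s) (sub_ne_zero.2 hx)
      simpa using this
    rw [← nhdsNE_sup_pure s]
    refine h2.sup ?_
    rw [tendsto_pure_left]
    intro U hU
    simpa using mem_of_mem_nhds hU

theorem hasDerivAt_unique {c : ℝ → E} {v w : E} {s : ℝ} (h : HasDerivAt c v s)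
    (h' : HasDerivAt c w s) : v = w :=
  tendsto_nhds_unique (hasDerivAt_iff_tendsto.1 h) (hasDerivAt_iff_tendsto.1 h')

/-- `deriv` is read off `fderiv`, which is some derivative (`0` whenever `0` is one). It is again a
derivative in either case, and derivatives are unique in a Hausdorff space. -/
theorem deriv_eq_of_hasDerivAt {c : ℝ → E} {v : E} {s : ℝ} (h : HasDerivAt c v s) :
    deriv c s = v := by
  refine hasDerivAt_unique (s := s) (c := c) ?_ h
  have h' : HasFDerivAt c (fderiv ℝ c s) s := by
    have hd : DifferentiableWithinAt ℝ c univ s := ⟨_, HasFDerivAt.hasFDerivWithinAt h⟩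
    rw [fderiv, fderivWithin]
    split_ifs with h0
    · exact hasFDerivWithinAt_univ.1 h0
    · exact hasFDerivWithinAt_univ.1 (Classical.choose_spec hd)
  unfold HasDerivAt HasDerivAtFilter
  rw [← HasFDerivAt]
  have e : ContinuousLinearMap.toSpanSingleton ℝ (deriv c s) = fderiv ℝ c s := by
    ext
    simp only [ContinuousLinearMap.toSpanSingleton_apply, one_smul]
    rfl
  exact e ▸ h'

theorem hasDerivAt_clm_comp (l : E →L[ℝ] F) {c : ℝ → E} {v : E} {s : ℝ} (h : HasDerivAt c v s) :
    HasDerivAt (fun r => l (c r)) (l v) s := by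
  rw [hasDerivAt_iff_tendsto] at h ⊢
  refine ((l.continuous.tendsto _).comp h).congr fun r => ?_
  simp

/-- The scalar errors of the slopes are `O(r)`, so the slopes converge in the sense of Mackey, which
bounded linear maps respect. `L = id` gives derivatives from scalar data; a general `L` gives the
chain rule for bounded maps that need not be continuous. -/
theorem hasDerivAt_of_scalar {L : E →ₗ[ℝ] F} (hL : MapsBounded L) {c : ℝ → E} {v : E} {s : ℝ}
    (h : ∀ l : E →L[ℝ] ℝ, ContDiffAt ℝ ∞ (fun r => l (c r)) s)
    (hv : ∀ l : E →L[ℝ] ℝ, deriv (fun r => l (c r)) s = l v) :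
    HasDerivAt (fun r => L (c r)) (L v) s := by
  rw [hasDerivAt_iff_tendsto]
  refine tendsto_of_seq_tendsto fun r hr => ?_
  obtain ⟨hr, hr0⟩ := tendsto_nhdsWithin_iff.1 hr
  obtain ⟨n₀, hn₀⟩ := eventually_atTop.1 hr0
  -- The sequence is nonzero only eventually; the shift by `n₀` makes all its terms nonzero.
  rw [← tendsto_add_atTop_iff_nat n₀, ← tendsto_sub_nhds_zero_iff]
  have hr' := (tendsto_add_atTop_iff_nat n₀).2 hr
  have := tendsto_zero_of_weak_isBigO hL hr' (fun n => hn₀ (n + n₀) (by omega))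
    (y := fun n => (r (n + n₀))⁻¹ • (c (s + r (n + n₀)) - c s) - v) (fun l => by
      have := (isBigO_slope_sub_deriv (h l)).comp_tendsto
        (tendsto_nhdsWithin_iff.2 ⟨hr', Eventually.of_forall fun n => hn₀ (n + n₀) (by omega)⟩)
      simpa [Function.comp_def, hv] using this)
  simpa using this

/-- This is where completeness enters: the slopes along `1/(n+1)` form a Mackey-Cauchy sequence, and
their limit is the derivative. -/
theorem exists_hasDerivAt_of_scalar {c : ℝ → E} {s : ℝ}
    (h : ∀ l : E →L[ℝ] ℝ, ContDiffAt ℝ ∞ (fun r => l (c r)) s) :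
    ∃ v : E, ∀ l : E →L[ℝ] ℝ, deriv (fun r => l (c r)) s = l v := by
  let r : ℕ → ℝ := fun n => 1 / ((n : ℝ) + 1)
  have hr0 : ∀ n, 0 < r n := fun n => by positivity
  have hr : Tendsto r atTop (𝓝 0) := tendsto_one_div_add_atTop_nhds_zero_nat
  have hr' : Tendsto r atTop (𝓝[≠] 0) :=
    tendsto_nhdsWithin_iff.2 ⟨hr, Eventually.of_forall fun n => (hr0 n).ne'⟩
  have hb : ∀ l : E →L[ℝ] ℝ, ∃ C : ℝ, 0 < C ∧ ∀ n,
      |l ((r n)⁻¹ • (c (s + r n) - c s)) - deriv (fun r => l (c r)) s| ≤ C * r n := fun l => by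
    obtain ⟨C, hC, H⟩ := Asymptotics.bound_of_isBigO_nat_atTop
      ((isBigO_slope_sub_deriv (h l)).comp_tendsto hr')
    refine ⟨C, hC, fun n => ?_⟩
    have := H (hr0 n).ne'
    simpa [abs_of_pos (hr0 n)] using this
  choose C hC0 hC using hb
  have hM : ∃ a, Tendsto (fun n => (r n)⁻¹ • (c (s + r n) - c s)) atTop (𝓝 a) := by
    -- The set of all `x` with `|l x| ≤ 2 C l` for every `l` is weakly bounded, hence bounded, and
    -- absolutely convex. The factor `2` accounts for the errors of the two slopes that are
    -- compared.
    refine ConvenientSpace.mackey_complete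
      (fun n => (r n)⁻¹ • (c (s + r n) - c s)) ⟨{x : E | ∀ l : E →L[ℝ] ℝ, |l x| ≤ 2 * C l},
        isVonNBounded_of_forall_dual fun l => ⟨2 * C l, fun x hx => hx l⟩,
        ⟨fun a ha => ?_, fun x hx y hy p q hp hq hpq l => ?_⟩, fun ε hε => ?_⟩
    · rintro _ ⟨x, hx, rfl⟩ l
      have h1 : ‖a‖ * |l x| ≤ 1 * |l x| := mul_le_mul_of_nonneg_right ha (abs_nonneg _)
      have h2 := hx l
      have h3 : |l (a • x)| = ‖a‖ * |l x| := by simp [abs_mul]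
      change |l (a • x)| ≤ _
      linarith
    · have h1 : |p * l x + q * l y| ≤ |p * l x| + |q * l y| := abs_add_le _ _
      rw [abs_mul, abs_mul, abs_of_nonneg hp, abs_of_nonneg hq] at h1
      have h2 := mul_le_mul_of_nonneg_left (hx l) hp
      have h3 := mul_le_mul_of_nonneg_left (hy l) hq
      have h4 : p * (2 * C l) + q * (2 * C l) = 2 * C l := by rw [← add_mul, hpq, one_mul]
      simp only [map_add, map_smul, smul_eq_mul]
      linarith
    · obtain ⟨k, hk⟩ := exists_nat_one_div_lt hε
      refine ⟨k, fun m n hkm hmn => ⟨ε⁻¹ • ((r m)⁻¹ • (c (s + r m) - c s) -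
        (r n)⁻¹ • (c (s + r n) - c s)), fun l => ?_, by rw [smul_smul, mul_inv_cancel₀ hε.ne',
          one_smul]⟩⟩
      have hm : r m ≤ ε := (one_div_le_one_div_of_le (by positivity)
        (by have : (k : ℝ) < m := by exact_mod_cast hkm
            linarith)).trans hk.le
      have hn : r n ≤ ε := (one_div_le_one_div_of_le (by positivity)
        (by have : (k : ℝ) < n := by exact_mod_cast hkm.trans hmn
            linarith)).trans hk.le
      rw [map_smul, map_sub, smul_eq_mul, abs_mul, abs_inv, abs_of_pos hε, inv_mul_le_iff₀ hε]
      have h1 := hC l m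
      have h2 := hC l n
      have h3 := mul_le_mul_of_nonneg_left hm (hC0 l).le
      have h4 := mul_le_mul_of_nonneg_left hn (hC0 l).le
      calc _ ≤ _ := abs_sub_le _ (deriv (fun r => l (c r)) s) _
        _ ≤ C l * r m + C l * r n := by
          rw [abs_sub_comm (deriv (fun r => l (c r)) s)]
          exact add_le_add h1 h2
        _ ≤ _ := by linarith
  obtain ⟨a, ha⟩ := hM
  refine ⟨a, fun l => tendsto_nhds_unique (f := fun n => l ((r n)⁻¹ • (c (s + r n) - c s)))
    (l := atTop) ?_ ((l.continuous.tendsto a).comp ha)⟩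
  rw [← tendsto_sub_nhds_zero_iff]
  refine squeeze_zero_norm (hC l) ?_
  simpa using hr.const_mul (C l)

/-- A curve in a convenient space is smooth if and only if it is scalarly smooth. -/
theorem smoothCurveAt_iff_scalar {c : ℝ → E} {t : ℝ} : SmoothCurveAt c t ↔
    ∀ᶠ s in 𝓝 t, ∀ l : E →L[ℝ] ℝ, ContDiffAt ℝ ∞ (fun r => l (c r)) s := by
  constructor
  · rintro ⟨d, rfl, hd⟩
    refine hd.eventually_nhds.mono fun s hs l => ?_
    exact contDiffAt_of_hasDerivAt_seq (d := fun n r => l (d n r))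
      (hs.mono fun x hx n => hasDerivAt_clm_comp l (hx n))
  · intro h
    obtain ⟨O, hO, hOo, htO⟩ := eventually_nhds_iff.1 h
    -- The derivative of a scalarly smooth curve is scalarly smooth again, its scalar components
    -- being the derivatives of those of the curve. Iterating this choice produces all higher
    -- derivatives.
    have step : ∀ c : {c : ℝ → E // ∀ s ∈ O, ∀ l : E →L[ℝ] ℝ, ContDiffAt ℝ ∞ (fun r => l (c r)) s},
        ∃ c' : {c : ℝ → E // ∀ s ∈ O, ∀ l : E →L[ℝ] ℝ, ContDiffAt ℝ ∞ (fun r => l (c r)) s},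
          ∀ s ∈ O, HasDerivAt c.1 (c'.1 s) s := by
      rintro ⟨c, hc⟩
      have : ∀ s, ∃ v : E, s ∈ O → ∀ l : E →L[ℝ] ℝ, deriv (fun r => l (c r)) s = l v := fun s => by
        by_cases hs : s ∈ O
        · exact (exists_hasDerivAt_of_scalar (hc s hs)).imp fun v hv _ => hv
        · exact ⟨0, fun h => absurd h hs⟩
      choose c' hc' using this
      refine ⟨⟨c', fun s hs l => ?_⟩, fun s hs => hasDerivAt_of_scalar mapsBounded_id (hc s hs)
        (hc' s hs)⟩
      have h1 : ContDiffAt ℝ ∞ (deriv fun r => l (c r)) s := (hc s hs l).derivWithin (by simp)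
      exact h1.congr_of_eventuallyEq
        (eventually_of_mem (hOo.mem_nhds hs) fun x hx => (hc' x hx l).symm)
    choose D hD using step
    refine ⟨fun n => ((D^[n]) ⟨c, hO⟩).1, rfl,
      eventually_of_mem (hOo.mem_nhds htO) fun s hs n => ?_⟩
    simp only [Function.iterate_succ_apply']
    exact hD _ s hs

theorem SmoothCurveAt.congr {c c' : ℝ → E} {t : ℝ} (h : SmoothCurveAt c t) (hc : c' =ᶠ[𝓝 t] c) :
    SmoothCurveAt c' t := by
  rw [smoothCurveAt_iff_scalar] at h ⊢
  filter_upwards [h, hc.eventually_nhds] with s hs hs' l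
  exact (hs l).congr_of_eventuallyEq (hs'.mono fun r hr => by simp [hr])

theorem SmoothCurveAt.eventually {c : ℝ → E} {t : ℝ} (h : SmoothCurveAt c t) :
    ∀ᶠ s in 𝓝 t, SmoothCurveAt c s := by
  simp only [smoothCurveAt_iff_scalar] at h ⊢
  exact h.eventually_nhds

theorem SmoothCurveAt.scalar {c : ℝ → E} {t : ℝ} (h : SmoothCurveAt c t) (l : E →L[ℝ] ℝ) :
    ContDiffAt ℝ ∞ (fun r => l (c r)) t :=
  (smoothCurveAt_iff_scalar.1 h).self_of_nhds l

theorem SmoothCurveAt.hasDerivAt {c : ℝ → E} {t : ℝ} (h : SmoothCurveAt c t) :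
    HasDerivAt c (deriv c t) t := by
  obtain ⟨d, rfl, hd⟩ := h
  have := hd.self_of_nhds 0
  rwa [deriv_eq_of_hasDerivAt this]

theorem SmoothCurveAt.clm_deriv {c : ℝ → E} {t : ℝ} (h : SmoothCurveAt c t) (l : E →L[ℝ] ℝ) :
    _root_.deriv (fun r => l (c r)) t = l (_root_.deriv c t) :=
  (hasDerivAt_clm_comp l h.hasDerivAt).deriv

theorem SmoothCurveAt.linear_comp {c : ℝ → E} {t : ℝ} (h : SmoothCurveAt c t) {L : E →ₗ[ℝ] F}
    (hL : MapsBounded L) : SmoothCurveAt (fun s => L (c s)) t ∧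
      HasDerivAt (fun s => L (c s)) (L (_root_.deriv c t)) t := by
  obtain ⟨d, rfl, hd⟩ := h
  have key : ∀ᶠ s in 𝓝 t, ∀ n, HasDerivAt (fun s => L (d n s)) (L (d (n + 1) s)) s := by
    filter_upwards [hd.eventually_nhds] with s hs n
    have hn : SmoothCurveAt (d n) s :=
      ⟨fun k => d (n + k), rfl, hs.mono fun r hr k => hr (n + k)⟩
    exact hasDerivAt_of_scalar hL hn.scalar fun l =>
      (hasDerivAt_clm_comp l (hs.self_of_nhds n)).deriv
  refine ⟨⟨fun n s => L (d n s), rfl, key⟩, ?_⟩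
  rw [deriv_eq_of_hasDerivAt (hd.self_of_nhds 0)]
  exact key.self_of_nhds 0

theorem smoothCurveAt_real_iff {c : ℝ → ℝ} {t : ℝ} :
    SmoothCurveAt c t ↔ ∀ᶠ s in 𝓝 t, ContDiffAt ℝ ∞ c s := by
  rw [smoothCurveAt_iff_scalar]
  refine eventually_congr (Eventually.of_forall fun s => ⟨fun h => h (.id ℝ ℝ), fun h l => ?_⟩)
  exact l.contDiff.contDiffAt.comp s h

theorem SmoothCurveAt.contDiffAt {c : ℝ → ℝ} {t : ℝ} (h : SmoothCurveAt c t) :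
    ContDiffAt ℝ ∞ c t := (smoothCurveAt_real_iff.1 h).self_of_nhds

theorem smoothCurveAt_of_contDiff {c : ℝ → ℝ} (h : ContDiff ℝ ∞ c) (t : ℝ) : SmoothCurveAt c t :=
  smoothCurveAt_real_iff.2 (Eventually.of_forall fun _ => h.contDiffAt)

theorem smoothCurveAt_const (x : E) (t : ℝ) : SmoothCurveAt (fun _ => x) t :=
  smoothCurveAt_iff_scalar.2 (Eventually.of_forall fun _ _ => contDiffAt_const)

theorem SmoothCurveAt.add {c c' : ℝ → E} {t : ℝ} (h : SmoothCurveAt c t)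
    (h' : SmoothCurveAt c' t) : SmoothCurveAt (fun s => c s + c' s) t := by
  rw [smoothCurveAt_iff_scalar] at h h' ⊢
  filter_upwards [h, h'] with s hs hs' l
  simpa using (hs l).add (hs' l)

theorem SmoothCurveAt.smul {a : ℝ → ℝ} {c : ℝ → E} {t : ℝ} (ha : SmoothCurveAt a t)
    (h : SmoothCurveAt c t) : SmoothCurveAt (fun s => a s • c s) t := by
  rw [smoothCurveAt_real_iff] at ha
  rw [smoothCurveAt_iff_scalar] at h ⊢
  filter_upwards [ha, h] with s hs hs' l
  simpa using hs.mul (hs' l)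

theorem SmoothCurveAt.sub {c c' : ℝ → E} {t : ℝ} (h : SmoothCurveAt c t)
    (h' : SmoothCurveAt c' t) : SmoothCurveAt (fun s => c s - c' s) t := by
  rw [smoothCurveAt_iff_scalar] at h h' ⊢
  filter_upwards [h, h'] with s hs hs' l
  simpa using (hs l).sub (hs' l)

theorem SmoothCurveAt.comp_real {c : ℝ → E} {a : ℝ → ℝ} {t : ℝ} (h : SmoothCurveAt c (a t))
    (ha : SmoothCurveAt a t) : SmoothCurveAt (fun s => c (a s)) t := by
  have hc : ContinuousAt a t := ha.contDiffAt.continuousAt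
  rw [smoothCurveAt_real_iff] at ha
  rw [smoothCurveAt_iff_scalar] at h ⊢
  filter_upwards [ha, hc.eventually h] with s hs hs' l
  exact (hs' l).comp s hs

theorem smoothCurveAt_id (t : ℝ) : SmoothCurveAt (fun s : ℝ => s) t :=
  smoothCurveAt_of_contDiff contDiff_id t

theorem smoothCurveAt_line (x v : E) (t : ℝ) : SmoothCurveAt (fun s : ℝ => x + s • v) t :=
  (smoothCurveAt_const x t).add ((smoothCurveAt_id t).smul (smoothCurveAt_const v t))

theorem deriv_line (x v : E) (t : ℝ) : deriv (fun s : ℝ => x + s • v) t = v := by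
  refine deriv_eq_of_hasDerivAt (hasDerivAt_iff_tendsto.2 ?_)
  refine tendsto_const_nhds.congr' ?_
  filter_upwards [self_mem_nhdsWithin] with r hr
  have hr : r ≠ 0 := hr
  simp [add_smul, smul_smul, hr]

/-- A germ of a smooth curve is the germ of a smooth curve defined on `ℝ`. -/
theorem SmoothCurveAt.exists_global {c : ℝ → E} {t : ℝ} (h : SmoothCurveAt c t) :
    ∃ c' : ℝ → E, (∀ s, SmoothCurveAt c' s) ∧ c' =ᶠ[𝓝 t] c := by
  obtain ⟨ε, hε, H⟩ := Metric.eventually_nhds_iff.1 h.eventually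
  let φ : ContDiffBump t := ⟨ε / 3, ε / 2, by positivity, by linarith⟩
  have hφ : ContDiff ℝ ∞ φ := φ.contDiff
  -- A reparametrisation that is the identity near `t` and whose values stay within `ε` of `t`,
  -- where the curve is smooth.
  let a : ℝ → ℝ := fun s => t + φ s * (s - t)
  have ha : ContDiff ℝ ∞ a := by fun_prop
  refine ⟨fun s => c (a s), fun s => ?_, ?_⟩
  · refine SmoothCurveAt.comp_real (H ?_) (smoothCurveAt_of_contDiff ha s)
    have hd : dist (a s) t = φ s * |s - t| := by
      simp [a, abs_of_nonneg φ.nonneg]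
    rw [hd]
    by_cases hs : dist s t < ε / 2
    · rw [Real.dist_eq] at hs
      have := mul_le_mul_of_nonneg_right (φ.le_one (x := s)) (abs_nonneg (s - t))
      linarith
    · rw [φ.zero_of_le_dist (not_lt.1 hs)]
      simpa using hε
  · filter_upwards [φ.eventuallyEq_one] with s hs
    simp only [a]
    rw [hs]
    simp

end Convenient

/-! ### Special curves -/

namespace Convenient

section SpecialCurve

/-- Bump functions with disjoint supports, centred at the points `2⁻ⁿ`. -/
noncomputable def specialBump (n : ℕ) : ContDiffBump ((1 / 2 : ℝ) ^ n) :=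
  ⟨(1 / 2) ^ n / 8, (1 / 2) ^ n / 4, by positivity, by
    have : (0 : ℝ) < (1 / 2) ^ n := by positivity
    linarith⟩

variable {E : Type*} [AddCommGroup E] [Module ℝ E]

/-- The special curve that is `t ↦ aₙ + (t - 2⁻ⁿ) bₙ` near `2⁻ⁿ`. -/
noncomputable def specialCurve (a b : ℕ → E) (t : ℝ) : E :=
  ∑ᶠ n, specialBump n t • (a n + (t - (1 / 2) ^ n) • b n)

/-- The `n`-th support lies in the ball of radius `2⁻ⁿ/4` about `2⁻ⁿ`. For `m < n` its points are
below `(5/8) 2⁻ᵐ`, those of the `m`-th one above `(3/4) 2⁻ᵐ`. -/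
theorem specialBump_ne_zero_unique {m n : ℕ} {t : ℝ} (hm : specialBump m t ≠ 0)
    (hn : specialBump n t ≠ 0) : m = n := by
  have key : ∀ m n : ℕ, specialBump m t ≠ 0 → specialBump n t ≠ 0 → ¬ m < n := by
    intro m n hm hn hmn
    have h1 : t ∈ Metric.ball ((1 / 2 : ℝ) ^ m) ((1 / 2) ^ m / 4) := by
      have : t ∈ Function.support (specialBump m) := hm
      rwa [(specialBump m).support_eq] at this
    have h2 : t ∈ Metric.ball ((1 / 2 : ℝ) ^ n) ((1 / 2) ^ n / 4) := by
      have : t ∈ Function.support (specialBump n) := hn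
      rwa [(specialBump n).support_eq] at this
    rw [Metric.mem_ball, Real.dist_eq, abs_lt] at h1 h2
    have h3 : (1 / 2 : ℝ) ^ n ≤ (1 / 2) ^ (m + 1) :=
      pow_le_pow_of_le_one (by norm_num) (by norm_num) hmn
    rw [pow_succ] at h3
    have : (0 : ℝ) < (1 / 2) ^ m := by positivity
    linarith [h1.1, h2.2]
  rcases lt_trichotomy m n with h | h | h
  · exact absurd h (key m n hm hn)
  · exact h
  · exact absurd h (key n m hn hm)

theorem specialCurve_eq {n : ℕ} {t : ℝ} (hn : specialBump n t ≠ 0) (a b : ℕ → E) :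
    specialCurve a b t = specialBump n t • (a n + (t - (1 / 2) ^ n) • b n) := by
  refine finsum_eq_single _ n fun m hm => ?_
  by_cases h : specialBump m t = 0
  · simp [h]
  · exact absurd (specialBump_ne_zero_unique h hn) hm

theorem specialCurve_eq_zero {t : ℝ} (h : ∀ n, specialBump n t = 0) (a b : ℕ → E) :
    specialCurve a b t = 0 := by
  simp [specialCurve, h]

theorem specialCurve_zero (a b : ℕ → E) : specialCurve a b 0 = 0 := by
  refine specialCurve_eq_zero (fun n => ?_) a b
  refine (specialBump n).zero_of_le_dist ?_
  have : (0 : ℝ) < (1 / 2) ^ n := by positivity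
  rw [dist_zero_left, Real.norm_eq_abs, abs_of_pos this]
  change (1 / 2 : ℝ) ^ n / 4 ≤ _
  linarith

theorem specialCurve_eventuallyEq (a b : ℕ → E) (n : ℕ) :
    specialCurve a b =ᶠ[𝓝 ((1 / 2 : ℝ) ^ n)] fun t => a n + (t - (1 / 2) ^ n) • b n := by
  filter_upwards [(specialBump n).eventuallyEq_one] with t ht
  have ht : specialBump n t = 1 := ht
  rw [specialCurve_eq (by rw [ht]; exact one_ne_zero), ht, one_smul]

/-- At most one term is nonzero at each time, so linearity passes through the sum. Vector-valued
special curves are thereby reduced to scalar ones. -/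
theorem map_specialCurve {F : Type*} [AddCommGroup F] [Module ℝ F] (L : E →ₗ[ℝ] F) (a b : ℕ → E)
    (t : ℝ) : L (specialCurve a b t) = specialCurve (fun n => L (a n)) (fun n => L (b n)) t := by
  by_cases h : ∀ n, specialBump n t = 0
  · rw [specialCurve_eq_zero h, specialCurve_eq_zero h, map_zero]
  · push Not at h
    obtain ⟨n, hn⟩ := h
    rw [specialCurve_eq hn, specialCurve_eq hn]
    simp

theorem exists_bound_iteratedFDeriv {f : ℝ → ℝ} (hf : ContDiff ℝ ∞ f) (hs : HasCompactSupport f)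
    (k : ℕ) : ∃ K : ℝ, 0 ≤ K ∧ ∀ t, ‖iteratedFDeriv ℝ k f t‖ ≤ K := by
  obtain ⟨K, hK⟩ := (hs.iteratedFDeriv (𝕜 := ℝ) k).exists_bound_of_continuous
    (hf.continuous_iteratedFDeriv (by exact_mod_cast le_top))
  exact ⟨K, (norm_nonneg _).trans (hK 0), hK⟩

/-- Special curves are smooth if the data converge to `0` sufficiently fast. -/
theorem exists_contDiff_specialCurve : ∃ ε : ℕ → ℝ, (∀ n, 0 < ε n) ∧ Tendsto ε atTop (𝓝 0) ∧
    ∀ a b : ℕ → ℝ, (∃ C : ℝ, ∀ n, |a n| ≤ C * ε n ∧ |b n| ≤ C * ε n) →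
      ContDiff ℝ ∞ (specialCurve a b) := by
  have h1 : ∀ n, ContDiff ℝ ∞ (specialBump n) := fun n => (specialBump n).contDiff
  have h2 : ∀ n, ContDiff ℝ ∞ fun t => specialBump n t * (t - (1 / 2) ^ n) := fun n => by
    have := h1 n
    fun_prop
  choose K hK0 hK using fun n k => exists_bound_iteratedFDeriv (h1 n)
    (specialBump n).hasCompactSupport k
  choose K' hK0' hK' using fun n k => exists_bound_iteratedFDeriv (h2 n)
    ((specialBump n).hasCompactSupport.mul_right) k
  -- `S n` dominates the derivatives of order at most `n` of the two building blocks of the `n`-th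
  -- term. With `ε n = 2⁻ⁿ / S n`, the `k`-th derivative of the `n`-th term is at most `C 2⁻ⁿ` for
  -- all `n ≥ k`; the finitely many other terms do not matter.
  let S : ℕ → ℝ := fun n => 1 + ∑ k ∈ Finset.range (n + 1), (K n k + K' n k)
  have hS : ∀ n, 1 ≤ S n := fun n => by
    have : 0 ≤ ∑ k ∈ Finset.range (n + 1), (K n k + K' n k) :=
      Finset.sum_nonneg fun k _ => add_nonneg (hK0 n k) (hK0' n k)
    simp only [S]; linarith
  have hε : ∀ n, (1 / 2 : ℝ) ^ n / S n ≤ (1 / 2) ^ n := fun n =>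
    div_le_self (by positivity) (hS n)
  have hg : Tendsto (fun n : ℕ => (1 / 2 : ℝ) ^ n) atTop (𝓝 0) :=
    tendsto_pow_atTop_nhds_zero_of_lt_one (by norm_num) (by norm_num)
  have hpos : ∀ n, 0 < (1 / 2 : ℝ) ^ n / S n := fun n =>
    div_pos (by positivity) (zero_lt_one.trans_le (hS n))
  refine ⟨fun n => (1 / 2) ^ n / S n, hpos, squeeze_zero (fun n => (hpos n).le) hε hg, ?_⟩
  rintro a b ⟨C, hC⟩
  have hC0 : 0 ≤ C := by
    have := (abs_nonneg _).trans (hC 0).1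
    exact nonneg_of_mul_nonneg_left this (hpos 0)
  have heq : specialCurve a b = fun t => ∑' n, (a n * specialBump n t +
      b n * (specialBump n t * (t - (1 / 2) ^ n))) := by
    ext t
    rw [specialCurve, tsum_eq_finsum]
    · refine finsum_congr fun n => ?_
      simp only [smul_eq_mul]
      ring
    · refine Set.Subsingleton.finite fun m hm n hn => specialBump_ne_zero_unique (t := t) ?_ ?_
      · intro h; apply hm; simp [h]
      · intro h; apply hn; simp [h]
  rw [heq]
  have hT : ∀ n, ContDiff ℝ ∞ fun t => a n * specialBump n t +
      b n * (specialBump n t * (t - (1 / 2) ^ n)) := fun n =>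
    (contDiff_const.mul (h1 n)).add (contDiff_const.mul (h2 n))
  refine contDiff_tsum_of_eventually (v := fun _ n => C * (1 / 2) ^ n) (N := ⊤) hT
    (fun k _ => (summable_geometric_two).mul_left C) fun k _ => ?_
  rw [Nat.cofinite_eq_atTop]
  filter_upwards [eventually_ge_atTop k] with n hn t
  have e1 : iteratedFDeriv ℝ k (fun t => a n * specialBump n t +
      b n * (specialBump n t * (t - (1 / 2) ^ n))) t = a n • iteratedFDeriv ℝ k (specialBump n) t +
      b n • iteratedFDeriv ℝ k (fun t => specialBump n t * (t - (1 / 2) ^ n)) t := by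
    have hk : ∀ {f : ℝ → ℝ}, ContDiff ℝ ∞ f → ContDiffAt ℝ k f t := fun hf =>
      (hf.of_le (by exact_mod_cast le_top)).contDiffAt
    have e2 := iteratedFDeriv_const_smul_apply (a := a n) (hk (h1 n))
    have e3 := iteratedFDeriv_const_smul_apply (a := b n) (hk (h2 n))
    rw [← e2, ← e3]
    exact iteratedFDeriv_add_apply (f := a n • ⇑(specialBump n))
      (g := b n • fun t => specialBump n t * (t - (1 / 2) ^ n))
      (hk (contDiff_const.smul (h1 n))) (hk (contDiff_const.smul (h2 n)))
  rw [e1]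
  have hkS : K n k + K' n k ≤ S n := by
    have := Finset.single_le_sum (f := fun k => K n k + K' n k)
      (fun k _ => add_nonneg (hK0 n k) (hK0' n k)) (Finset.mem_range.2 (Nat.lt_succ_of_le hn))
    simp only [S]; linarith
  calc _ ≤ |a n| * K n k + |b n| * K' n k := by
        refine (norm_add_le _ _).trans ?_
        rw [norm_smul, norm_smul]
        exact add_le_add (mul_le_mul_of_nonneg_left (hK n k t) (abs_nonneg _))
          (mul_le_mul_of_nonneg_left (hK' n k t) (abs_nonneg _))
    _ ≤ C * ((1 / 2) ^ n / S n) * K n k + C * ((1 / 2) ^ n / S n) * K' n k :=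
        add_le_add (mul_le_mul_of_nonneg_right (hC n).1 (hK0 n k))
          (mul_le_mul_of_nonneg_right (hC n).2 (hK0' n k))
    _ = C * ((1 / 2) ^ n / S n) * (K n k + K' n k) := by ring
    _ ≤ C * ((1 / 2) ^ n / S n) * S n :=
        mul_le_mul_of_nonneg_left hkS (mul_nonneg hC0 (hpos n).le)
    _ = C * (1 / 2) ^ n := by
        have := (zero_lt_one.trans_le (hS n)).ne'
        field_simp

/-- Special curves in the plane. -/
theorem exists_contDiff_specialCurve_prod : ∃ ε : ℕ → ℝ, (∀ n, 0 < ε n) ∧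
    ∀ (x : ℝ × ℝ) (a b : ℕ → ℝ × ℝ), (∀ n, ‖a n‖ ≤ ε n) → (∀ n, ‖b n‖ ≤ ε n) →
      ∃ γ : ℝ → ℝ × ℝ, ContDiff ℝ ∞ γ ∧ γ 0 = x ∧ ∀ n,
        γ =ᶠ[𝓝 ((1 / 2 : ℝ) ^ n)] fun t => x + a n + (t - (1 / 2) ^ n) • b n := by
  obtain ⟨ε, hε, -, H⟩ := exists_contDiff_specialCurve
  refine ⟨ε, hε, fun x a b ha hb => ⟨fun t => x + specialCurve a b t, ?_, ?_, fun n => ?_⟩⟩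
  · refine contDiff_const.add ((contDiff_prod_iff _).2 ⟨?_, ?_⟩)
    · have : (fun t => (specialCurve a b t).1) = _ :=
        funext fun t => map_specialCurve (LinearMap.fst ℝ ℝ ℝ) a b t
      rw [Function.comp_def, this]
      exact H _ _ ⟨1, fun n => by
        rw [one_mul]; exact ⟨(norm_fst_le _).trans (ha n), (norm_fst_le _).trans (hb n)⟩⟩
    · have : (fun t => (specialCurve a b t).2) = _ :=
        funext fun t => map_specialCurve (LinearMap.snd ℝ ℝ ℝ) a b t
      rw [Function.comp_def, this]
      exact H _ _ ⟨1, fun n => by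
        rw [one_mul]; exact ⟨(norm_snd_le _).trans (ha n), (norm_snd_le _).trans (hb n)⟩⟩
  · simp [specialCurve_zero]
  · filter_upwards [specialCurve_eventuallyEq a b n] with t ht
    rw [ht, add_assoc]

end SpecialCurve

end Convenient

/-! ### Boman's theorem -/

namespace Convenient

/-! ### Mean values of iterated differences, and an identity between differences -/

section FiniteDifferences

/-- Induction on the order, applied to the first difference of `g`: its `n`-th derivative is an
increment of the `n`-th derivative of `g`, to which Lagrange's mean value theorem applies. -/
theorem fwdDiff_iter_eq_iteratedDeriv (n : ℕ) {δ : ℝ} (hδ : 0 < δ) : ∀ {g : ℝ → ℝ},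
    ContDiff ℝ ∞ g → ∀ x : ℝ, ∃ ξ ∈ Icc x (x + n * δ),
      (fwdDiff δ)^[n] g x = δ ^ n * iteratedDeriv n g ξ := by
  induction n with
  | zero => intro g _ x; exact ⟨x, by simp, by simp⟩
  | succ n ih =>
    intro g hg x
    have hg' : ContDiff ℝ ∞ fun x => g (x + δ) := hg.comp (contDiff_id.add contDiff_const)
    obtain ⟨ξ, hξ, h⟩ := ih (g := fwdDiff δ g) (hg'.sub hg) x
    have hn : ∀ {f : ℝ → ℝ}, ContDiff ℝ ∞ f → ContDiff ℝ n f := fun hf =>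
      hf.of_le (by exact_mod_cast le_top)
    have h1 : iteratedDeriv n (fwdDiff δ g) ξ = iteratedDeriv n g (ξ + δ) - iteratedDeriv n g ξ := by
      have := iteratedDeriv_sub (n := n) (x := ξ) (hn hg').contDiffAt (hn hg).contDiffAt
      rw [iteratedDeriv_comp_add_const] at this
      exact this
    have hd : Differentiable ℝ (iteratedDeriv n g) :=
      hg.differentiable_iteratedDeriv n (by exact_mod_cast ENat.natCast_lt_top n)
    obtain ⟨η, hη, h2⟩ := exists_deriv_eq_slope (iteratedDeriv n g) (a := ξ) (b := ξ + δ)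
      (by linarith) hd.continuous.continuousOn hd.differentiableOn
    refine ⟨η, ?_, ?_⟩
    · push_cast
      constructor <;> nlinarith [hη.1, hη.2, hξ.1, hξ.2]
    · rw [Function.iterate_succ_apply, h, h1, iteratedDeriv_succ, h2, add_sub_cancel_left]
      field_simp
      ring

/-- A parallelepipedal difference is a combination of iterated differences in one direction. -/
theorem sum_powerset_iterated_difference {V : Type*} [AddCommGroup V] [Module ℝ V] (f : V → ℝ)
    (u : ℕ → V) (n : ℕ) (x : V) :
    ∑ S ∈ (Finset.range n).powerset, (-1 : ℝ) ^ S.card * ∑ j ∈ Finset.range (n + 1),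
      ((-1 : ℝ) ^ (n - j) * n.choose j) *
        f (x + ∑ i ∈ S, u i + (j : ℝ) • ∑ i ∈ S, (-(1 / ((i : ℝ) + 1))) • u i) =
      (-1) ^ n * ∑ S ∈ (Finset.range n).powerset, (-1 : ℝ) ^ S.card * f (x + ∑ i ∈ S, u i) := by
  simp_rw [Finset.mul_sum]
  -- The term `j = 0` is the right-hand side. In the term `j`, the vector `u k` has coefficient `1 -
  -- j/(k+1)`, which vanishes for `k = j - 1`; so subsets with and without `j - 1` give equal values
  -- with opposite signs and cancel.
  rw [Finset.sum_comm, Finset.sum_eq_single_of_mem 0 (by simp)]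
  · refine Finset.sum_congr rfl fun S _ => ?_
    simp
    ring
  · intro j hj hj0
    obtain ⟨i, rfl⟩ := Nat.exists_eq_succ_of_ne_zero hj0
    have hi : i ∈ Finset.range n := by simpa using hj
    have key : ∀ S : Finset ℕ, x + ∑ i ∈ S, u i +
        ((i + 1 : ℕ) : ℝ) • ∑ i ∈ S, (-(1 / ((i : ℝ) + 1))) • u i =
          x + ∑ k ∈ S, (1 - ((i : ℝ) + 1) / (k + 1)) • u k := fun S => by
      rw [Finset.smul_sum, add_assoc, ← Finset.sum_add_distrib]
      congr 1
      refine Finset.sum_congr rfl fun k _ => ?_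
      nth_rw 1 [← one_smul ℝ (u k)]
      rw [smul_smul, ← add_smul]
      congr 1
      push_cast
      ring
    simp only [Nat.succ_eq_add_one, key]
    rw [← Finset.insert_erase hi, Finset.sum_powerset_insert (Finset.notMem_erase _ _),
      ← Finset.sum_add_distrib]
    refine Finset.sum_eq_zero fun S hS => ?_
    have hiS : i ∉ S := fun h => Finset.notMem_erase i _ (Finset.mem_powerset.1 hS h)
    rw [Finset.sum_insert hiS, Finset.card_insert_of_notMem hiS, pow_succ,
      div_self (by positivity), sub_self, zero_smul, zero_add]
    ring

end FiniteDifferences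

/-- A pointwise limit of functions with uniformly bounded derivatives of all orders is smooth. -/
theorem contDiff_of_tendsto_of_bounded {f : ℕ → ℝ → ℝ} {g : ℝ → ℝ} (hf : ∀ m, ContDiff ℝ ∞ (f m))
    (hb : ∀ k : ℕ, ∃ C : ℝ, ∀ m s, |iteratedDeriv k (f m) s| ≤ C)
    (hg : ∀ s, Tendsto (fun m => f m s) atTop (𝓝 (g s))) : ContDiff ℝ ∞ g := by
  have hd : ∀ k m s, HasDerivAt (iteratedDeriv k (f m)) (iteratedDeriv (k + 1) (f m) s) s :=
    fun k m s => by
      rw [iteratedDeriv_succ]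
      exact ((hf m).differentiable_iteratedDeriv k
        (by exact_mod_cast ENat.natCast_lt_top k)).differentiableAt.hasDerivAt
  -- A Taylor estimate uniform in `m`: it allows the limit `m → ∞` to be exchanged with difference
  -- quotients.
  choose C hC using hb
  have taylor : ∀ k m s r, |iteratedDeriv k (f m) (s + r) - iteratedDeriv k (f m) s -
      r * iteratedDeriv (k + 1) (f m) s| ≤ C (k + 2) * |r| * |r| := by
    intro k m s r
    have h1 : ∀ x ∈ uIcc s (s + r), |iteratedDeriv (k + 1) (f m) x - iteratedDeriv (k + 1) (f m) s|
        ≤ C (k + 2) * |r| := fun x hx => by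
      have h2 := convex_univ.norm_image_sub_le_of_norm_hasDerivWithin_le
        (f := iteratedDeriv (k + 1) (f m)) (fun x _ => (hd (k + 1) m x).hasDerivWithinAt)
        (fun x _ => hC (k + 2) m x) (mem_univ s) (mem_univ x)
      have h3 : |x - s| ≤ |r| := by simpa using abs_sub_left_of_mem_uIcc hx
      exact h2.trans (mul_le_mul_of_nonneg_left h3 ((abs_nonneg _).trans (hC (k + 2) m s)))
    have h4 := (convex_uIcc s (s + r)).norm_image_sub_le_of_norm_hasDerivWithin_le
      (f := fun x => iteratedDeriv k (f m) x - x * iteratedDeriv (k + 1) (f m) s)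
      (fun x _ => ((hd k m x).fun_sub ((hasDerivAt_id' x).mul_const _)).hasDerivWithinAt)
      (fun x hx => by simpa using h1 x hx) left_mem_uIcc right_mem_uIcc
    rw [add_sub_cancel_left] at h4
    calc _ = _ := by congr 1; ring
      _ ≤ _ := h4
  have step : ∀ k (g : ℝ → ℝ), (∀ s, Tendsto (fun m => iteratedDeriv k (f m) s) atTop (𝓝 (g s))) →
      ∃ g' : ℝ → ℝ, (∀ s, Tendsto (fun m => iteratedDeriv (k + 1) (f m) s) atTop (𝓝 (g' s))) ∧
        ∀ s, HasDerivAt g (g' s) s := by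
    intro k g hg
    have hC0 : 0 ≤ C (k + 2) := (abs_nonneg _).trans (hC (k + 2) 0 0)
    have hcau : ∀ s, ∃ v, Tendsto (fun m => iteratedDeriv (k + 1) (f m) s) atTop (𝓝 v) := by
      intro s
      refine cauchySeq_tendsto_of_complete (Metric.cauchySeq_iff'.2 fun ε hε => ?_)
      -- For this fixed step the two Taylor errors contribute at most `ε/4` each to the difference
      -- of derivatives, and the slopes differ by less than `ε/4` for large indices because the
      -- functions converge at `s` and `s + r`.
      set r : ℝ := ε / (4 * (C (k + 2) + 1)) with hr
      have hr0 : 0 < r := by positivity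
      have hrC : C (k + 2) * r ≤ ε / 4 := by
        rw [hr, mul_div_assoc', div_le_iff₀ (by positivity)]
        nlinarith
      have h1 : CauchySeq fun m => iteratedDeriv k (f m) (s + r) - iteratedDeriv k (f m) s :=
        ((hg (s + r)).sub (hg s)).cauchySeq
      obtain ⟨N, hN⟩ := Metric.cauchySeq_iff'.1 h1 (ε / 4 * r) (by positivity)
      refine ⟨N, fun n hn => ?_⟩
      have h2 := hN n hn
      have h3 := taylor k n s r
      have h4 := taylor k N s r
      rw [abs_of_pos hr0] at h3 h4
      rw [Real.dist_eq, abs_lt] at h2 ⊢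
      rw [abs_le] at h3 h4
      have h5 : C (k + 2) * r * r ≤ ε / 4 * r := mul_le_mul_of_nonneg_right hrC hr0.le
      constructor <;> refine lt_of_mul_lt_mul_left ?_ hr0.le <;> nlinarith
    choose g' hg' using hcau
    refine ⟨g', hg', fun s => ?_⟩
    have h1 : ∀ r, |g (s + r) - g s - r * g' s| ≤ C (k + 2) * |r| * |r| := fun r =>
      le_of_tendsto' (((hg (s + r)).sub (hg s)).sub ((hg' s).const_mul r)).abs
        fun m => taylor k m s r
    rw [hasDerivAt_iff_tendsto_slope_zero, ← tendsto_sub_nhds_zero_iff]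
    refine squeeze_zero_norm' (a := fun r => C (k + 2) * |r|) ?_ ?_
    · filter_upwards [self_mem_nhdsWithin] with r hr
      have hr : r ≠ 0 := hr
      have e : r⁻¹ • (g (s + r) - g s) - g' s = r⁻¹ * (g (s + r) - g s - r * g' s) := by
        simp only [smul_eq_mul]
        field_simp
      rw [e, norm_mul, norm_inv, inv_mul_le_iff₀ (norm_pos_iff.2 hr)]
      have := h1 r
      simp only [Real.norm_eq_abs]
      linarith
    · have : Tendsto (fun r : ℝ => C (k + 2) * |r|) (𝓝 0) (𝓝 (C (k + 2) * |0|)) :=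
        ((continuous_abs.tendsto (0 : ℝ)).const_mul _)
      simpa using this.mono_left nhdsWithin_le_nhds
  have hex : ∀ k, ∃ G : ℝ → ℝ, ∀ s, Tendsto (fun m => iteratedDeriv k (f m) s) atTop (𝓝 (G s)) := by
    intro k
    induction k with
    | zero => exact ⟨g, by simpa using hg⟩
    | succ k ih =>
      obtain ⟨G, hG⟩ := ih
      obtain ⟨G', hG', -⟩ := step k G hG
      exact ⟨G', hG'⟩
  choose G hG using hex
  have hGd : ∀ k s, HasDerivAt (G k) (G (k + 1) s) s := fun k s => by
    obtain ⟨G', hG', hd'⟩ := step k (G k) (hG k)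
    have : G (k + 1) s = G' s := tendsto_nhds_unique (hG (k + 1) s) (hG' s)
    rw [this]
    exact hd' s
  have h0 : g = G 0 := funext fun s => tendsto_nhds_unique (hg s) (by simpa using hG 0 s)
  rw [h0, contDiff_iff_contDiffAt]
  exact fun t => contDiffAt_of_hasDerivAt_seq (Eventually.of_forall fun s n => hGd n s)

/-! ### Derivative bounds from special curves, and the induction in Boman's theorem -/

section Boman

/-- Functions on the plane that are smooth along all smooth curves. -/
def CurveSmooth (h : ℝ × ℝ → ℝ) : Prop :=
  ∀ γ : ℝ → ℝ × ℝ, ContDiff ℝ ∞ γ → ContDiff ℝ ∞ fun t => h (γ t)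

/-- A discontinuity would be visible along points converging to `x` as fast as desired, and such
points lie on one smooth curve. -/
theorem CurveSmooth.continuous {h : ℝ × ℝ → ℝ} (hh : CurveSmooth h) : Continuous h := by
  obtain ⟨ε, hε, H⟩ := exists_contDiff_specialCurve_prod
  rw [Metric.continuous_iff]
  intro x e he
  by_contra! hcon
  choose y hy hye using fun n => hcon (ε n) (hε n)
  obtain ⟨γ, hγ, h0, hn⟩ := H x (fun n => y n - x) 0 (fun n => by
    rw [← dist_eq_norm]; exact (hy n).le) (fun n => by simpa using (hε n).le)
  have h1 : Tendsto (fun n : ℕ => h (γ ((1 / 2) ^ n))) atTop (𝓝 (h (γ 0))) :=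
    ((hh γ hγ).continuous.tendsto 0).comp
      (tendsto_pow_atTop_nhds_zero_of_lt_one (by norm_num) (by norm_num))
  obtain ⟨n, hn'⟩ := ((Metric.tendsto_nhds.1 h1) e he).exists
  have := (hn n).self_of_nhds
  simp only [Pi.zero_apply, smul_zero, add_zero, add_sub_cancel] at this
  rw [this, h0] at hn'
  exact absurd hn' (not_lt.2 (hye n))

/-- Otherwise a special curve can run through points `y n → x` in the direction `v`, with small
speed `δ n`, so that the `p`-th derivative of `h` along it exceeds `n` at time `2⁻ⁿ`. -/
theorem CurveSmooth.exists_local_bound {h : ℝ × ℝ → ℝ} (hh : CurveSmooth h) (p : ℕ) (v x : ℝ × ℝ) :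
    ∃ r > 0, ∃ C : ℝ, ∀ y ∈ Metric.ball x r, |iteratedDeriv p (fun t : ℝ => h (y + t • v)) 0| ≤ C := by
  obtain ⟨ε, hε, H⟩ := exists_contDiff_specialCurve_prod
  by_contra! hcon
  let δ : ℕ → ℝ := fun n => ε n / (1 + ‖v‖)
  have hδ : ∀ n, 0 < δ n := fun n => div_pos (hε n) (by positivity)
  -- Speed `δ n` multiplies the `p`-th derivative by `δ n ^ p`; the threshold `n / δ n ^ p`
  -- compensates for this.
  choose y hy hye using fun n : ℕ => hcon (ε n) (hε n) (n / δ n ^ p)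
  obtain ⟨γ, hγ, h0, hn⟩ := H x (fun n => y n - x) (fun n => δ n • v) (fun n => by
    have := hy n
    rw [Metric.mem_ball, dist_eq_norm] at this
    exact this.le) (fun n => by
    rw [norm_smul, Real.norm_eq_abs, abs_of_pos (hδ n), div_mul_eq_mul_div,
      div_le_iff₀ (by positivity)]
    nlinarith [norm_nonneg v, (hε n).le])
  have hc : Continuous (iteratedDeriv p fun t => h (γ t)) :=
    (hh γ hγ).continuous_iteratedDeriv p (by exact_mod_cast le_top)
  have h1 : Tendsto (fun n : ℕ => |iteratedDeriv p (fun t => h (γ t)) ((1 / 2) ^ n)|) atTop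
      (𝓝 |iteratedDeriv p (fun t => h (γ t)) 0|) :=
    ((hc.abs.tendsto 0).comp (tendsto_pow_atTop_nhds_zero_of_lt_one (by norm_num) (by norm_num)))
  have h2 : ∀ n : ℕ, (n : ℝ) < |iteratedDeriv p (fun t => h (γ t)) ((1 / 2) ^ n)| := by
    intro n
    have e1 : (fun t => h (γ t)) =ᶠ[𝓝 ((1 / 2 : ℝ) ^ n)] fun t =>
        h (y n + (δ n * (t - (1 / 2) ^ n)) • v) := by
      filter_upwards [hn n] with t ht
      rw [ht]
      simp only [add_sub_cancel, smul_smul]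
      rw [mul_comm]
    have hline : ContDiff ℝ ∞ fun t : ℝ => h (y n + t • v) := hh _ (by fun_prop)
    have e2 := iteratedDeriv_comp_const_mul (n := p) (f := fun t : ℝ => h (y n + t • v))
      (hline.of_le (by exact_mod_cast le_top)) (δ n)
    have e3 := congrFun (iteratedDeriv_comp_sub_const p (fun τ : ℝ => h (y n + (δ n * τ) • v))
      ((1 / 2) ^ n)) ((1 / 2) ^ n)
    rw [congrFun e2, sub_self, mul_zero] at e3
    have := hye n
    rw [e1.iteratedDeriv_eq, e3, abs_mul, abs_pow, abs_of_pos (hδ n)]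
    rwa [div_lt_iff₀ (pow_pos (hδ n) p), mul_comm] at this
  have h3 := tendsto_atTop_mono (fun n => (h2 n).le) tendsto_natCast_atTop_atTop
  exact not_tendsto_nhds_of_tendsto_atTop h3 _ h1

/-- Compactness of the support turns the local bounds into a global one. -/
theorem CurveSmooth.exists_bound {h : ℝ × ℝ → ℝ} (hh : CurveSmooth h) (hs : HasCompactSupport h)
    (p : ℕ) (v : ℝ × ℝ) :
    ∃ C : ℝ, 0 ≤ C ∧ ∀ y, |iteratedDeriv p (fun t : ℝ => h (y + t • v)) 0| ≤ C := by
  have h1 : ∃ C : ℝ, ∀ y ∈ tsupport h, |iteratedDeriv p (fun t : ℝ => h (y + t • v)) 0| ≤ C := by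
    refine hs.isCompact.induction_on (p := fun s => ∃ C : ℝ, ∀ y ∈ s,
      |iteratedDeriv p (fun t : ℝ => h (y + t • v)) 0| ≤ C) ⟨0, by simp⟩ ?_ ?_ ?_
    · rintro s t hst ⟨C, hC⟩
      exact ⟨C, fun y hy => hC y (hst hy)⟩
    · rintro s t ⟨C, hC⟩ ⟨C', hC'⟩
      exact ⟨max C C', fun y hy => hy.elim (fun h => (hC y h).trans (le_max_left _ _))
        fun h => (hC' y h).trans (le_max_right _ _)⟩
    · intro x _
      obtain ⟨r, hr, C, hC⟩ := hh.exists_local_bound p v x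
      exact ⟨Metric.ball x r, mem_nhdsWithin_of_mem_nhds (Metric.ball_mem_nhds x hr), C, hC⟩
  obtain ⟨C, hC⟩ := h1
  refine ⟨max C 0, le_max_right _ _, fun y => ?_⟩
  by_cases hy : y ∈ tsupport h
  · exact (hC y hy).trans (le_max_left _ _)
  · have h2 : (fun t : ℝ => h (y + t • v)) =ᶠ[𝓝 0] fun _ => 0 := by
      have hc : ContinuousAt (fun t : ℝ => y + t • v) 0 := by fun_prop
      have h3 : (tsupport h)ᶜ ∈ 𝓝 (y + (0 : ℝ) • v) := by
        simpa using (isClosed_tsupport h).isOpen_compl.mem_nhds hy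
      filter_upwards [hc h3] with t ht
      exact image_eq_zero_of_notMem_tsupport ht
    rw [h2.iteratedDeriv_eq]
    simp

theorem CurveSmooth.exists_bound_fwdDiff {h : ℝ × ℝ → ℝ} (hh : CurveSmooth h)
    (hs : HasCompactSupport h) (n : ℕ) (v : ℝ × ℝ) :
    ∃ C : ℝ, 0 ≤ C ∧ ∀ (y : ℝ × ℝ) (δ : ℝ), 0 < δ → |∑ j ∈ Finset.range (n + 1),
      ((-1 : ℝ) ^ (n - j) * n.choose j) * h (y + (j : ℝ) • (δ • v))| ≤ C * δ ^ n := by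
  obtain ⟨C, hC0, hC⟩ := hh.exists_bound hs n v
  refine ⟨C, hC0, fun y δ hδ => ?_⟩
  obtain ⟨ξ, -, e⟩ := fwdDiff_iter_eq_iteratedDeriv n hδ (g := fun t : ℝ => h (y + t • v))
    (hh _ (by fun_prop)) 0
  rw [fwdDiff_iter_eq_sum_shift] at e
  have e1 : ∑ j ∈ Finset.range (n + 1),
      ((-1 : ℝ) ^ (n - j) * n.choose j) * h (y + (j : ℝ) • (δ • v)) =
        δ ^ n * iteratedDeriv n (fun t : ℝ => h (y + t • v)) ξ := by
    rw [← e]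
    refine Finset.sum_congr rfl fun j _ => ?_
    simp [smul_smul]
  rw [e1, abs_mul, abs_pow, abs_of_pos hδ, mul_comm]
  refine mul_le_mul_of_nonneg_right ?_ (pow_nonneg hδ.le n)
  -- The derivative at `ξ` along the line through `y` is the derivative at `0` along the line
  -- through `y + ξ v`, where the bound applies.
  have e2 := iteratedDeriv_comp_add_const n (fun t : ℝ => h (y + t • v)) ξ 
  have e3 := congrFun e2 0
  simp only [zero_add] at e3
  rw [← e3]
  have := hC (y + ξ • v)
  simpa [add_smul, add_assoc, add_comm, add_left_comm] using this

/-- A `k`-fold difference in the first variable and a single one in the second form a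
parallelepipedal difference of order `k + 1`. The identity `sum_powerset_iterated_difference`
expresses it by differences in fixed directions, each of which is `O(δ ^ (k + 1))`. -/
theorem CurveSmooth.exists_bound_mixed_difference {h : ℝ × ℝ → ℝ} (hh : CurveSmooth h)
    (hs : HasCompactSupport h) (k : ℕ) :
    ∃ C : ℝ, 0 ≤ C ∧ ∀ (s r δ : ℝ), 0 < δ →
      |(fwdDiff δ)^[k] (fun s => h (s, r + δ) - h (s, r)) s| ≤ C * δ ^ (k + 1) := by
  let e : ℕ → ℝ × ℝ := fun i => if i < k then (1, 0) else (0, 1)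
  choose C hC0 hC using fun S : Finset ℕ => hh.exists_bound_fwdDiff hs (k + 1)
    (∑ i ∈ S, (-(1 / ((i : ℝ) + 1))) • e i)
  refine ⟨∑ S ∈ (Finset.range (k + 1)).powerset, C S, Finset.sum_nonneg fun S _ => hC0 S,
    fun s r δ hδ => ?_⟩
  have key := sum_powerset_iterated_difference h (fun i => δ • e i) (k + 1) (s, r)
  have hk : ∀ S ∈ (Finset.range k).powerset, ∑ i ∈ S, δ • e i = ((S.card : ℝ) * δ, 0) := by
    intro S hS
    have : ∀ i ∈ S, δ • e i = (δ, 0) := fun i hi => by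
      have : i < k := Finset.mem_range.1 (Finset.mem_powerset.1 hS hi)
      simp [e, this]
    rw [Finset.sum_congr rfl this]
    simp
  have e1 : ∑ S ∈ (Finset.range (k + 1)).powerset, (-1 : ℝ) ^ S.card *
      h ((s, r) + ∑ i ∈ S, δ • e i) =
        -∑ S ∈ (Finset.range k).powerset, (-1 : ℝ) ^ S.card *
          (h (s + S.card * δ, r + δ) - h (s + S.card * δ, r)) := by
    rw [Finset.range_add_one, Finset.sum_powerset_insert Finset.notMem_range_self,
      ← Finset.sum_add_distrib, ← Finset.sum_neg_distrib]
    refine Finset.sum_congr rfl fun S hS => ?_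
    have hkS : k ∉ S := fun h => Finset.notMem_range_self (Finset.mem_powerset.1 hS h)
    rw [Finset.sum_insert hkS, Finset.card_insert_of_notMem hkS, hk S hS]
    have : δ • e k = (0, δ) := by simp [e]
    rw [this, pow_succ]
    simp only [Prod.mk_add_mk, zero_add, add_zero]
    ring
  have e2 : (fwdDiff δ)^[k] (fun s => h (s, r + δ) - h (s, r)) s = (-1) ^ k *
      ∑ S ∈ (Finset.range k).powerset, (-1 : ℝ) ^ S.card *
          (h (s + S.card * δ, r + δ) - h (s + S.card * δ, r)) := by
    rw [fwdDiff_iter_eq_sum_shift, Finset.sum_powerset_apply_card (fun n => (-1 : ℝ) ^ n *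
          (h (s + n * δ, r + δ) - h (s + n * δ, r))), Finset.mul_sum, Finset.card_range]
    refine Finset.sum_congr rfl fun j hj => ?_
    have hj : j ≤ k := Nat.lt_succ_iff.1 (Finset.mem_range.1 hj)
    have : (-1 : ℝ) ^ k = (-1) ^ (k - j) * (-1) ^ j := by rw [← pow_add, Nat.sub_add_cancel hj]
    rw [this]
    have h2 : (-1 : ℝ) ^ j * (-1) ^ j = 1 := by rw [← mul_pow]; simp
    simp only [nsmul_eq_mul, zsmul_eq_mul]
    push_cast
    linear_combination -((-1 : ℝ) ^ (k - j) * (k.choose j) *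
      (h (s + j * δ, r + δ) - h (s + j * δ, r))) * h2
  have e3 : |(fwdDiff δ)^[k] (fun s => h (s, r + δ) - h (s, r)) s| =
      |(-1) ^ (k + 1) * ∑ S ∈ (Finset.range (k + 1)).powerset, (-1 : ℝ) ^ S.card *
      h ((s, r) + ∑ i ∈ S, δ • e i)| := by
    rw [e1, e2]
    simp [abs_mul]
  rw [e3, ← key, Finset.sum_mul]
  refine (Finset.abs_sum_le_sum_abs _ _).trans (Finset.sum_le_sum fun S _ => ?_)
  rw [abs_mul, abs_pow, abs_neg, abs_one, one_pow, one_mul]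
  have := hC S ((s, r) + ∑ i ∈ S, δ • e i) δ hδ
  rw [Finset.smul_sum] at this
  simp only [smul_comm δ] at this
  exact this

/-- Cut the step `η` into `m + 1` steps `δ`. By telescoping, the `k`-th difference of the increment
is at most `(m + 1) C δ^(k+1) = C η δ^k`. Dividing by `δ^k` and letting `m → ∞` bounds the `k`-th
derivative. -/
theorem CurveSmooth.exists_bound_increment {h : ℝ × ℝ → ℝ} (hh : CurveSmooth h)
    (hs : HasCompactSupport h) (k : ℕ) :
    ∃ C : ℝ, ∀ (s r η : ℝ), 0 < η →
      |iteratedDeriv k (fun s => h (s, r + η) - h (s, r)) s| ≤ C * η := by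
  obtain ⟨C, hC0, hC⟩ := hh.exists_bound_mixed_difference hs k
  refine ⟨C, fun s r η hη => ?_⟩
  set G : ℝ → ℝ := fun s => h (s, r + η) - h (s, r) with hG
  have hGs : ContDiff ℝ ∞ G := (hh _ (by fun_prop)).sub (hh _ (by fun_prop))
  let δ : ℕ → ℝ := fun m => η / ((m : ℝ) + 1)
  have hδ : ∀ m, 0 < δ m := fun m => by positivity
  have hm : ∀ m : ℕ, ((m : ℝ) + 1) * δ m = η := fun m => by simp only [δ]; field_simp
  choose ξ hξ hξe using fun m => fwdDiff_iter_eq_iteratedDeriv k (hδ m) hGs s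
  have h1 : ∀ m, |(fwdDiff (δ m))^[k] G s| ≤ C * η * δ m ^ k := by
    intro m
    have e : G = ∑ l ∈ Finset.range (m + 1),
        fun s => h (s, (r + l * δ m) + δ m) - h (s, r + l * δ m) := by
      ext x
      have := Finset.sum_range_sub (fun l : ℕ => h (x, r + l * δ m)) (m + 1)
      push_cast at this
      rw [hm m, zero_mul, add_zero] at this
      rw [Finset.sum_apply]
      change h (x, r + η) - h (x, r) = _
      rw [← this]
      refine Finset.sum_congr rfl fun l _ => ?_
      rw [add_mul, one_mul, add_assoc]
    rw [e, fwdDiff_iter_finsetSum, Finset.sum_apply]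
    refine (Finset.abs_sum_le_sum_abs _ _).trans ?_
    refine (Finset.sum_le_sum (g := fun _ => C * δ m ^ (k + 1))
      fun (l : ℕ) _ => hC s (r + l * δ m) (δ m) (hδ m)).trans ?_
    rw [Finset.sum_const, Finset.card_range, nsmul_eq_mul]
    push_cast
    rw [← hm m]
    apply le_of_eq
    ring
  have h2 : ∀ m, |iteratedDeriv k G (ξ m)| ≤ C * η := by
    intro m
    have := h1 m
    rw [hξe m, abs_mul, abs_pow, abs_of_pos (hδ m), mul_comm] at this
    exact le_of_mul_le_mul_right this (pow_pos (hδ m) k)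
  have hδt : Tendsto (fun m => s + k * δ m) atTop (𝓝 s) := by
    have := (tendsto_one_div_add_atTop_nhds_zero_nat (𝕜 := ℝ)).const_mul (k * η)
    simpa [δ, div_eq_mul_inv, mul_assoc] using this.const_add s
  have h3 : Tendsto ξ atTop (𝓝 s) :=
    tendsto_of_tendsto_of_tendsto_of_le_of_le tendsto_const_nhds hδt (fun m => (hξ m).1)
      fun m => (hξ m).2
  have hc : Continuous (iteratedDeriv k G) :=
    hGs.continuous_iteratedDeriv k (by exact_mod_cast le_top)
  exact le_of_tendsto' ((hc.tendsto s).comp h3).abs h2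

theorem CurveSmooth.differentiable_line {h : ℝ × ℝ → ℝ} (hh : CurveSmooth h) (x v : ℝ × ℝ) :
    Differentiable ℝ fun t : ℝ => h (x + t • v) :=
  (hh _ (by fun_prop)).differentiable (by simp)

/-- The difference quotients in the second variable have, by `exists_bound_increment`, derivatives
of every order bounded uniformly in the step; their pointwise limit is therefore smooth. -/
theorem CurveSmooth.contDiff_deriv_of_hasCompactSupport {h : ℝ × ℝ → ℝ} (hh : CurveSmooth h)
    (hs : HasCompactSupport h) : ContDiff ℝ ∞ fun s => deriv (fun r => h (s, r)) 0 := by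
  let η : ℕ → ℝ := fun m => 1 / ((m : ℝ) + 1)
  have hη : ∀ m, 0 < η m := fun m => by positivity
  have hηt : Tendsto η atTop (𝓝[≠] 0) := tendsto_nhdsWithin_iff.2
    ⟨tendsto_one_div_add_atTop_nhds_zero_nat, Eventually.of_forall fun m => (hη m).ne'⟩
  have hG : ∀ m, ContDiff ℝ ∞ fun s => h (s, 0 + η m) - h (s, 0) := fun m =>
    (hh _ (by fun_prop)).sub (hh _ (by fun_prop))
  refine contDiff_of_tendsto_of_bounded (f := fun m s => (η m)⁻¹ * (h (s, 0 + η m) - h (s, 0)))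
    (fun m => contDiff_const.mul (hG m)) (fun k => ?_) fun s => ?_
  · obtain ⟨C, hC⟩ := hh.exists_bound_increment hs k
    refine ⟨C, fun m s => ?_⟩
    have e := iteratedDeriv_const_mul_field (n := k) (x := s) (η m)⁻¹ (fun s => h (s, 0 + η m) - h (s, 0))
    rw [e, abs_mul, abs_inv, abs_of_pos (hη m), inv_mul_le_iff₀ (hη m), mul_comm]
    exact hC s 0 (η m) (hη m)
  · have hd : DifferentiableAt ℝ (fun r => h (s, r)) 0 :=
      (hh _ (by fun_prop)).differentiable (by simp) |>.differentiableAt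
    have := (hasDerivAt_iff_tendsto_slope_zero.1 hd.hasDerivAt).comp hηt
    simpa [Function.comp_def] using this

theorem curveSmooth_mul_bump {h : ℝ × ℝ → ℝ} {Ω : Set (ℝ × ℝ)}
    (hh : ∀ γ : ℝ → ℝ × ℝ, ContDiff ℝ ∞ γ → ∀ t, γ t ∈ Ω → ContDiffAt ℝ ∞ (fun t => h (γ t)) t)
    {x : ℝ × ℝ} (φ : ContDiffBump x) (hφ : Metric.closedBall x φ.rOut ⊆ Ω) :
    CurveSmooth fun y => φ y * h y := by
  intro γ hγ
  rw [contDiff_iff_contDiffAt]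
  intro t
  by_cases ht : γ t ∈ Ω
  · exact (φ.contDiff.comp hγ).contDiffAt.mul (hh γ hγ t ht)
  · have h1 : γ t ∈ (tsupport φ)ᶜ := by
      rw [φ.tsupport_eq]
      exact fun h => ht (hφ h)
    refine contDiffAt_const (c := (0 : ℝ)) |>.congr_of_eventuallyEq ?_
    filter_upwards [hγ.continuous.continuousAt ((isClosed_tsupport φ).isOpen_compl.mem_nhds h1)]
      with s hs
    have : φ (γ s) = 0 := image_eq_zero_of_notMem_tsupport hs
    simp [this]

theorem CurveSmooth.contDiff_deriv {h : ℝ × ℝ → ℝ} (hh : CurveSmooth h) :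
    ContDiff ℝ ∞ fun s => deriv (fun r => h (s, r)) 0 := by
  rw [contDiff_iff_contDiffAt]
  intro s
  let φ : ContDiffBump ((s, 0) : ℝ × ℝ) := ⟨1, 2, one_pos, one_lt_two⟩
  have h1 : CurveSmooth fun y => φ y * h y :=
    curveSmooth_mul_bump (Ω := univ) (fun γ hγ t _ => (hh γ hγ).contDiffAt) φ (subset_univ _)
  have h2 := h1.contDiff_deriv_of_hasCompactSupport φ.hasCompactSupport.mul_right
  refine h2.contDiffAt.congr_of_eventuallyEq ?_
  have hc : ContinuousAt (fun x : ℝ => ((x, 0) : ℝ × ℝ)) s := by fun_prop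
  filter_upwards [hc.eventually φ.eventuallyEq_one.eventually_nhds] with x hx
  refine Filter.EventuallyEq.deriv_eq ?_
  have hc' : ContinuousAt (fun r : ℝ => ((x, r) : ℝ × ℝ)) 0 := by fun_prop
  filter_upwards [hc'.eventually hx] with r hr
  have hr : φ (x, r) = 1 := hr
  simp [hr]

/-- Along a curve `γ` this is the partial derivative at `r = 0` of `(s, r) ↦ h (γ s + r v)`, which
is itself smooth along curves. The class is thus stable under directional derivatives, as the
induction in Boman's theorem requires. -/
theorem CurveSmooth.deriv_line {h : ℝ × ℝ → ℝ} (hh : CurveSmooth h) (v : ℝ × ℝ) :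
    CurveSmooth fun x => deriv (fun t : ℝ => h (x + t • v)) 0 := by
  intro γ hγ
  refine CurveSmooth.contDiff_deriv (h := fun p => h (γ p.1 + p.2 • v)) fun β hβ => hh _ ?_
  have h1 : ContDiff ℝ ∞ fun t => (β t).1 := contDiff_fst.comp hβ
  have h2 : ContDiff ℝ ∞ fun t => (β t).2 := contDiff_snd.comp hβ
  exact (hγ.comp h1).add (h2.smul contDiff_const)

/-- Boman's theorem in the plane. -/
theorem CurveSmooth.contDiff {h : ℝ × ℝ → ℝ} (hh : CurveSmooth h) : ContDiff ℝ ∞ h := by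
  rw [contDiff_infty]
  intro n
  induction n generalizing h with
  | zero => exact contDiff_zero.2 hh.continuous
  | succ n ih =>
    let d₁ : ℝ × ℝ → ℝ := fun x => deriv (fun t : ℝ => h (x + t • ((1, 0) : ℝ × ℝ))) 0
    let d₂ : ℝ × ℝ → ℝ := fun x => deriv (fun t : ℝ => h (x + t • ((0, 1) : ℝ × ℝ))) 0
    have h₁ : CurveSmooth d₁ := hh.deriv_line (1, 0)
    have h₂ : CurveSmooth d₂ := hh.deriv_line (0, 1)
    let D : ℝ × ℝ → (ℝ × ℝ →L[ℝ] ℝ) := fun x =>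
      d₁ x • ContinuousLinearMap.fst ℝ ℝ ℝ + d₂ x • ContinuousLinearMap.snd ℝ ℝ ℝ
    have hD : ContDiff ℝ n D := ((ih h₁).smul contDiff_const).add ((ih h₂).smul contDiff_const)
    rw [show ((n + 1 : ℕ) : ℕ∞ω) = (n : ℕ∞ω) + 1 by push_cast; rfl]
    refine contDiff_succ_iff_hasFDerivAt.2 ⟨D, hD, fun x => ?_⟩
    have e₁ : ∀ v : ℝ × ℝ, HasFDerivAt (fun s => h (s, v.2))
        (ContinuousLinearMap.toSpanSingleton ℝ (d₁ v)) v.1 := fun v => by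
      have := (hh.differentiable_line v (1, 0)).differentiableAt (x := 0) |>.hasDerivAt
      have h0 : HasDerivAt (fun s : ℝ => s - v.1) 1 v.1 := (hasDerivAt_id' v.1).sub_const _
      have h1 := HasDerivAt.comp (h₂ := fun t : ℝ => h (v + t • ((1, 0) : ℝ × ℝ)))
        (h₂' := d₁ v) v.1 (by rw [sub_self]; exact this) h0
      rw [mul_one] at h1
      have e : (fun s => h (s, v.2)) =
          (fun t : ℝ => h (v + t • ((1, 0) : ℝ × ℝ))) ∘ fun s => s - v.1 := by
        ext s
        simp only [Function.comp]
        congr 1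
        ext <;> simp
      rw [e]
      exact h1.hasFDerivAt
    have e₂ : ∀ v : ℝ × ℝ, HasFDerivAt (fun s => h (v.1, s))
        (ContinuousLinearMap.toSpanSingleton ℝ (d₂ v)) v.2 := fun v => by
      have := (hh.differentiable_line v (0, 1)).differentiableAt (x := 0) |>.hasDerivAt
      have h0 : HasDerivAt (fun s : ℝ => s - v.2) 1 v.2 := (hasDerivAt_id' v.2).sub_const _
      have h1 := HasDerivAt.comp (h₂ := fun t : ℝ => h (v + t • ((0, 1) : ℝ × ℝ)))
        (h₂' := d₂ v) v.2 (by rw [sub_self]; exact this) h0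
      rw [mul_one] at h1
      have e : (fun s => h (v.1, s)) =
          (fun t : ℝ => h (v + t • ((0, 1) : ℝ × ℝ))) ∘ fun s => s - v.2 := by
        ext s
        simp only [Function.comp]
        congr 1
        ext <;> simp
      rw [e]
      exact h1.hasFDerivAt
    have hc : Continuous fun a : ℝ => ContinuousLinearMap.toSpanSingleton ℝ a := by
      have : (fun a : ℝ => ContinuousLinearMap.toSpanSingleton ℝ a) =
          fun a => a • ContinuousLinearMap.id ℝ ℝ := by
        ext a
        simp
      rw [this]
      fun_prop
    -- Continuous partial derivatives give the total derivative `D`, which is `C^n` by the induction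
    -- hypothesis.
    have key := hasStrictFDerivAt_uncurry_coprod (𝕜 := ℝ) (u := x) (f := fun a b => h (a, b))
      (f₁ := fun a b => ContinuousLinearMap.toSpanSingleton ℝ (d₁ (a, b)))
      (f₂ := fun a b => ContinuousLinearMap.toSpanSingleton ℝ (d₂ (a, b)))
      (Eventually.of_forall e₁) (Eventually.of_forall e₂)
      (hc.comp h₁.continuous).continuousAt (hc.comp h₂.continuous).continuousAt
    have e : D x = (ContinuousLinearMap.toSpanSingleton ℝ (d₁ x)).coprod
        (ContinuousLinearMap.toSpanSingleton ℝ (d₂ x)) := by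
      ext <;> simp [D]
    rw [e]
    exact key.hasFDerivAt

/-- Boman's theorem on an open set of the plane. -/
theorem contDiffAt_of_curves {h : ℝ × ℝ → ℝ} {Ω : Set (ℝ × ℝ)} (hΩ : IsOpen Ω)
    (hh : ∀ γ : ℝ → ℝ × ℝ, ContDiff ℝ ∞ γ → ∀ t, γ t ∈ Ω → ContDiffAt ℝ ∞ (fun t => h (γ t)) t)
    {x : ℝ × ℝ} (hx : x ∈ Ω) : ContDiffAt ℝ ∞ h x := by
  obtain ⟨r, hr, hrΩ⟩ := Metric.isOpen_iff.1 hΩ x hx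
  let φ : ContDiffBump x := ⟨r / 3, r / 2, by positivity, by linarith⟩
  have h1 := (curveSmooth_mul_bump hh φ ((Metric.closedBall_subset_ball
    (show r / 2 < r by linarith)).trans hrΩ)).contDiff
  refine h1.contDiffAt.congr_of_eventuallyEq ?_
  filter_upwards [φ.eventuallyEq_one] with y hy
  have hy : φ y = 1 := hy
  simp [hy]

/-- Points outside `Ω` that converge fast to a point of `Ω` lie on a smooth curve. So the
`c^∞`-topology of the plane is the usual one, and preimages of `c^∞`-open sets under maps smooth
along curves are open. -/
theorem isOpen_of_curves {Ω : Set (ℝ × ℝ)}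
    (h : ∀ γ : ℝ → ℝ × ℝ, ContDiff ℝ ∞ γ → IsOpen (γ ⁻¹' Ω)) : IsOpen Ω := by
  obtain ⟨ε, hε, H⟩ := exists_contDiff_specialCurve_prod
  rw [Metric.isOpen_iff]
  intro x hx
  by_contra! hcon
  have h1 : ∀ n, ∃ y ∈ Metric.ball x (ε n), y ∉ Ω := fun n => not_subset.1 (hcon (ε n) (hε n))
  choose y hy hyΩ using h1
  obtain ⟨γ, hγ, h0, hn⟩ := H x (fun n => y n - x) 0 (fun n => by
    rw [← dist_eq_norm]; exact (hy n).le) (fun n => by simpa using (hε n).le)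
  have h2 : Tendsto (fun n : ℕ => (1 / 2 : ℝ) ^ n) atTop (𝓝 0) :=
    tendsto_pow_atTop_nhds_zero_of_lt_one (by norm_num) (by norm_num)
  obtain ⟨n, hn'⟩ := (h2.eventually ((h γ hγ).mem_nhds (show γ 0 ∈ Ω by rwa [h0]))).exists
  have := (hn n).self_of_nhds
  simp only [Pi.zero_apply, smul_zero, add_zero, add_sub_cancel] at this
  exact hyΩ n (this ▸ hn')

end Boman

end Convenient

/-! ### Slopes, the `c^∞`-topology and maps from the plane -/

namespace Convenient

/-! ### Smoothness of difference quotients -/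

section Slope

/-- The slope is the mean of `f'` over the segment from `t` to `t + r`. The Riemann sums of this
mean have derivatives in `r` bounded uniformly by those of `f`, so the limit is smooth. -/
theorem contDiff_slope_of_hasCompactSupport {f : ℝ → ℝ} (hf : ContDiff ℝ ∞ f)
    (hs : HasCompactSupport f) (t : ℝ) :
    ContDiff ℝ ∞ fun r => if r = 0 then deriv f t else r⁻¹ * (f (t + r) - f t) := by
  have hb : ∀ k, ∃ C : ℝ, ∀ s, |iteratedDeriv k f s| ≤ C := fun k => by
    obtain ⟨K, -, hK⟩ := exists_bound_iteratedFDeriv hf hs k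
    refine ⟨K, fun s => ?_⟩
    rw [← Real.norm_eq_abs, ← norm_iteratedFDeriv_eq_norm_iteratedDeriv]
    exact hK s
  choose C hC using hb
  have hf' : ContDiff ℝ ∞ (deriv f) := (contDiff_infty_iff_deriv.1 hf).2
  have hC0 : 0 ≤ C 2 := (abs_nonneg _).trans (hC 2 0)
  have taylor : ∀ x h, |f (x + h) - f x - h * deriv f x| ≤ C 2 * |h| * |h| := by
    intro x h
    have hd : ∀ y, HasDerivAt f (deriv f y) y := fun y =>
      (hf.differentiable (by simp)).differentiableAt.hasDerivAt
    have hd' : ∀ y, HasDerivAt (deriv f) (iteratedDeriv 2 f y) y := fun y => by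
      rw [iteratedDeriv_succ, iteratedDeriv_one]
      exact (hf'.differentiable (by simp)).differentiableAt.hasDerivAt
    have h1 : ∀ y ∈ uIcc x (x + h), |deriv f y - deriv f x| ≤ C 2 * |h| := fun y hy => by
      have h2 := convex_univ.norm_image_sub_le_of_norm_hasDerivWithin_le
        (f := deriv f) (fun y _ => (hd' y).hasDerivWithinAt)
        (fun y _ => hC 2 y) (mem_univ x) (mem_univ y)
      have h3 : |y - x| ≤ |h| := by simpa using abs_sub_left_of_mem_uIcc hy
      exact h2.trans (mul_le_mul_of_nonneg_left h3 hC0)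
    have h4 := (convex_uIcc x (x + h)).norm_image_sub_le_of_norm_hasDerivWithin_le
      (f := fun y => f y - y * deriv f x)
      (fun y _ => ((hd y).fun_sub ((hasDerivAt_id' y).mul_const _)).hasDerivWithinAt)
      (fun y hy => by simpa using h1 y hy) left_mem_uIcc right_mem_uIcc
    rw [add_sub_cancel_left] at h4
    calc _ = _ := by congr 1; ring
      _ ≤ _ := h4
  let q : ℕ → ℝ → ℝ := fun m r => ((m : ℝ) + 1)⁻¹ *
    ∑ i ∈ Finset.range (m + 1), deriv f (t + (i / ((m : ℝ) + 1)) * r)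
  have hterm : ∀ m i : ℕ, ContDiff ℝ ∞ fun r => deriv f (t + (i / ((m : ℝ) + 1)) * r) :=
    fun m i => hf'.comp (by fun_prop)
  refine contDiff_of_tendsto_of_bounded (f := q)
    (fun m => contDiff_const.mul (ContDiff.sum fun i _ => hterm m i))
    (fun k => ⟨C (k + 1), fun m s => ?_⟩) fun r => ?_
  · have e1 := iteratedDeriv_const_mul_field (n := k) (x := s) ((m : ℝ) + 1)⁻¹
      (fun r => ∑ i ∈ Finset.range (m + 1), deriv f (t + (i / ((m : ℝ) + 1)) * r))
    have e2 := iteratedDeriv_fun_sum (n := k) (x := s) (I := Finset.range (m + 1))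
      (f := fun (i : ℕ) r => deriv f (t + (i / ((m : ℝ) + 1)) * r))
      (fun i _ => ((hterm m i).of_le (by exact_mod_cast le_top)).contDiffAt)
    have e3 : ∀ i : ℕ, iteratedDeriv k (fun r => deriv f (t + (i / ((m : ℝ) + 1)) * r)) s =
        (i / ((m : ℝ) + 1)) ^ k * iteratedDeriv (k + 1) f (t + (i / ((m : ℝ) + 1)) * s) := fun i => by
      have h1 := congrFun (iteratedDeriv_comp_const_mul (n := k)
        (f := fun x => deriv f (t + x)) ((hf'.comp (by fun_prop)).of_le (by exact_mod_cast le_top))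
        (i / ((m : ℝ) + 1))) s
      rw [h1, iteratedDeriv_comp_const_add, ← iteratedDeriv_succ']
    have hq : iteratedDeriv k (q m) s = ((m : ℝ) + 1)⁻¹ * ∑ i ∈ Finset.range (m + 1),
        (i / ((m : ℝ) + 1)) ^ k * iteratedDeriv (k + 1) f (t + (i / ((m : ℝ) + 1)) * s) := by
      rw [← Finset.sum_congr rfl fun i _ => e3 i, ← e2]
      exact e1
    have hm : (0 : ℝ) < m + 1 := by positivity
    rw [hq, abs_mul, abs_inv, abs_of_pos hm, inv_mul_le_iff₀ hm]
    refine (Finset.abs_sum_le_sum_abs _ _).trans ?_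
    have : ∀ i ∈ Finset.range (m + 1), |(i / ((m : ℝ) + 1)) ^ k *
        iteratedDeriv (k + 1) f (t + (i / ((m : ℝ) + 1)) * s)| ≤ C (k + 1) := fun i hi => by
      have hi' : (i : ℝ) ≤ m + 1 := by exact_mod_cast (Finset.mem_range.1 hi).le
      have h1 : |((i : ℝ) / ((m : ℝ) + 1)) ^ k| ≤ 1 := by
        rw [abs_of_nonneg (by positivity)]
        exact pow_le_one₀ (by positivity) (div_le_one_of_le₀ hi' hm.le)
      rw [abs_mul]
      calc _ ≤ 1 * C (k + 1) := mul_le_mul h1 (hC _ _) (abs_nonneg _) zero_le_one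
        _ = _ := one_mul _
    refine (Finset.sum_le_sum this).trans ?_
    rw [Finset.sum_const, Finset.card_range, nsmul_eq_mul]
    push_cast
    exact le_rfl
  · split_ifs with hr
    · refine tendsto_const_nhds.congr fun m => ?_
      have hm : (0 : ℝ) < m + 1 := by positivity
      simp only [q, hr, mul_zero, add_zero, Finset.sum_const, Finset.card_range, nsmul_eq_mul]
      push_cast
      field_simp
    · have key : ∀ m : ℕ, |q m r - r⁻¹ * (f (t + r) - f t)| ≤ C 2 * |r| * (1 / ((m : ℝ) + 1)) := by
        intro m
        have hm : (0 : ℝ) < m + 1 := by positivity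
        set δ : ℝ := r / (m + 1) with hδ
        have e1 := Finset.sum_range_sub (fun i : ℕ => f (t + i * δ)) (m + 1)
        have e2 : ((m : ℝ) + 1) * δ = r := by rw [hδ]; field_simp
        push_cast at e1
        rw [zero_mul, add_zero, e2] at e1
        have e3 : ∀ i : ℕ, (i / ((m : ℝ) + 1)) * r = i * δ := fun i => by rw [hδ]; ring
        -- The increment of `f` telescopes over `m + 1` steps of length `δ = r/(m+1)`. Each has
        -- Taylor error at most `C δ²`, and the total is `C r²/(m+1)`.
        have e4 : f (t + r) - f t - r * q m r = ∑ i ∈ Finset.range (m + 1),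
            (f ((t + i * δ) + δ) - f (t + i * δ) - δ * deriv f (t + i * δ)) := by
          have e4 : r * q m r = ∑ i ∈ Finset.range (m + 1), δ * deriv f (t + i * δ) := by
            simp only [q, e3]
            rw [← mul_assoc, ← div_eq_mul_inv, ← hδ, Finset.mul_sum]
          rw [← e1, e4, ← Finset.sum_sub_distrib]
          refine Finset.sum_congr rfl fun i _ => ?_
          rw [add_mul, one_mul, add_assoc]
        have e5 : |f (t + r) - f t - r * q m r| ≤ |r| * (C 2 * |r| * (1 / ((m : ℝ) + 1))) := by
          rw [e4]
          refine (Finset.abs_sum_le_sum_abs _ _).trans ?_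
          refine (Finset.sum_le_sum (g := fun _ => C 2 * |δ| * |δ|)
            fun (i : ℕ) _ => taylor (t + i * δ) δ).trans ?_
          rw [Finset.sum_const, Finset.card_range, nsmul_eq_mul, hδ, abs_div, abs_of_pos hm]
          push_cast
          apply le_of_eq
          field_simp
        have e6 : q m r - r⁻¹ * (f (t + r) - f t) = -(r⁻¹ * (f (t + r) - f t - r * q m r)) := by
          field_simp
          ring
        rw [e6, abs_neg, abs_mul, abs_inv, inv_mul_le_iff₀ (abs_pos.2 hr)]
        exact e5
      rw [← tendsto_sub_nhds_zero_iff]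
      refine squeeze_zero_norm key ?_
      simpa using (tendsto_one_div_add_atTop_nhds_zero_nat (𝕜 := ℝ)).const_mul (C 2 * |r|)

theorem contDiffAt_slope {f : ℝ → ℝ} (hf : ContDiff ℝ ∞ f) (t : ℝ) {r : ℝ} (hr : |r| < 1) :
    ContDiffAt ℝ ∞ (fun r => if r = 0 then deriv f t else r⁻¹ * (f (t + r) - f t)) r := by
  let φ : ContDiffBump t := ⟨1, 2, one_pos, one_lt_two⟩
  have h1 := contDiff_slope_of_hasCompactSupport (φ.contDiff.mul hf)
    (φ.hasCompactSupport.mul_right) t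
  refine h1.contDiffAt.congr_of_eventuallyEq ?_
  have h2 : ∀ᶠ s in 𝓝 r, |s| < 1 := continuous_abs.continuousAt.eventually_lt_const hr
  filter_upwards [h2] with s hs
  have e0 : deriv (fun x => φ x * f x) t = deriv f t := by
    refine Filter.EventuallyEq.deriv_eq ?_
    filter_upwards [φ.eventuallyEq_one] with x hx
    have hx : φ x = 1 := hx
    rw [hx, one_mul]
  have e1 : φ (t + s) = 1 := φ.one_of_mem_closedBall (by simpa [Real.dist_eq] using hs.le)
  have e2 : φ t = 1 := φ.one_of_mem_closedBall (by simp [φ])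
  rw [e0, e1, e2, one_mul, one_mul]

end Slope

variable {E : Type*} [AddCommGroup E] [Module ℝ E] [TopologicalSpace E] [ConvenientSpace E]
variable {F : Type*} [AddCommGroup F] [Module ℝ F] [TopologicalSpace F] [ConvenientSpace F]
variable {G : Type*} [AddCommGroup G] [Module ℝ G] [TopologicalSpace G] [ConvenientSpace G]

theorem eq_of_forall_dual {x y : E} (h : ∀ l : E →L[ℝ] ℝ, l x = l y) : x = y := by
  by_contra hxy
  obtain ⟨l, hl⟩ := geometric_hahn_banach_point_point hxy
  exact hl.ne (h l)

/-- The difference quotient of a smooth curve is a smooth curve. -/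
theorem SmoothCurveAt.exists_slope {c : ℝ → E} {t : ℝ} (h : SmoothCurveAt c t) :
    ∃ q : ℝ → E, SmoothCurveAt q 0 ∧ q 0 = _root_.deriv c t ∧
      ∀ᶠ r in 𝓝 (0 : ℝ), c (t + r) = c t + r • q r := by
  obtain ⟨c', hc', he⟩ := h.exists_global
  refine ⟨fun r => if r = 0 then _root_.deriv c' t else r⁻¹ • (c' (t + r) - c' t), ?_, ?_, ?_⟩
  · rw [smoothCurveAt_iff_scalar, Metric.eventually_nhds_iff]
    refine ⟨1, one_pos, fun r hr l => ?_⟩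
    rw [dist_zero_right] at hr
    have h1 : ContDiff ℝ ∞ fun s => l (c' s) :=
      contDiff_iff_contDiffAt.2 fun s => (hc' s).scalar l
    refine (contDiffAt_slope h1 t hr).congr_of_eventuallyEq (Eventually.of_forall fun s => ?_)
    simp only
    rw [(hc' t).clm_deriv l]
    split_ifs <;> simp
  · simp only [if_pos]
    exact deriv_eq_of_hasDerivAt (by
      have h1 := h.hasDerivAt
      rw [hasDerivAt_iff_tendsto] at h1 ⊢
      refine h1.congr' ?_
      have h0 : Tendsto (fun r : ℝ => t + r) (𝓝[≠] 0) (𝓝 t) := by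
        have := (continuous_const_add t).tendsto (0 : ℝ)
        rw [add_zero] at this
        exact this.mono_left nhdsWithin_le_nhds
      filter_upwards [h0.eventually he] with r hr
      rw [hr, he.self_of_nhds])
  · have h0 : Tendsto (fun r : ℝ => t + r) (𝓝 0) (𝓝 t) := by
      have := (continuous_const_add t).tendsto (0 : ℝ)
      rwa [add_zero] at this
    filter_upwards [h0.eventually he] with r hr
    rw [← hr, ← he.self_of_nhds]
    split_ifs with h0
    · simp [h0]
    · rw [smul_smul, mul_inv_cancel₀ h0, one_smul, add_sub_cancel]

/-! ### The `c^∞`-topology and bounded linear maps -/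

section CInfTopology

theorem isOpen_cInf_iff {U : Set E} : IsOpen (X := CInf E) U ↔
    ∀ c : ℝ → E, (∀ t, SmoothCurveAt c t) → IsOpen (c ⁻¹' U) :=
  (isOpen_iSup_iff (α := CInf E) (s := U)).trans
    ⟨fun h c hc => h ⟨c, hc⟩, fun h c => h c.1 c.2⟩

theorem SmoothCurveAt.continuousAt_cInf {c : ℝ → E} {t : ℝ} (h : SmoothCurveAt c t) :
    ContinuousAt (Y := CInf E) c t := by
  obtain ⟨c', hc', he⟩ := h.exists_global
  have h1 : Continuous (Y := CInf E) c' :=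
    continuous_def.2 fun U hU => (isOpen_cInf_iff (E := E) (U := U)).1 hU c' hc'
  exact h1.continuousAt.congr he

theorem SmoothCurveAt.eventually_mem {c : ℝ → E} {t : ℝ} (h : SmoothCurveAt c t) {U : Set E}
    (hU : IsOpen (X := CInf E) U) (ht : c t ∈ U) : ∀ᶠ s in 𝓝 t, c s ∈ U :=
  h.continuousAt_cInf.eventually (hU.mem_nhds ht)

theorem SmoothOn.isOpen_inter_preimage {f : E → F} {U : Set E} {V : Set F} (hf : SmoothOn f U)
    (hU : IsOpen (X := CInf E) U) (hV : IsOpen (X := CInf F) V) :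
    IsOpen (X := CInf E) (U ∩ f ⁻¹' V) := by
  refine (isOpen_cInf_iff (E := E) (U := U ∩ f ⁻¹' V)).2 fun c hc => ?_
  rw [isOpen_iff_mem_nhds]
  rintro t ⟨ht, ht'⟩
  filter_upwards [(hc t).eventually_mem hU ht, (hf c t (hc t) ht).eventually_mem hV ht']
    with s hs hs' using ⟨hs, hs'⟩

theorem smoothOn_linear {L : E →ₗ[ℝ] F} (hL : MapsBounded L) (U : Set E) : SmoothOn L U :=
  fun _ _ hc _ => (hc.linear_comp hL).1

theorem continuous_cInf_linear {L : E →ₗ[ℝ] F} (hL : MapsBounded L) :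
    Continuous (X := CInf E) (Y := CInf F) L :=
  continuous_def.2 fun V hV => by
    have h1 := (smoothOn_linear hL univ).isOpen_inter_preimage isOpen_univ hV
    exact (univ_inter (L ⁻¹' V : Set E)) ▸ h1

/-- A linear map that is smooth along smooth curves is bounded. -/
theorem mapsBounded_of_smoothCurves {L : E →ₗ[ℝ] F}
    (hL : ∀ c : ℝ → E, ∀ t, SmoothCurveAt c t → SmoothCurveAt (fun s => L (c s)) t) :
    MapsBounded L := by
  intro B hB
  refine isVonNBounded_of_forall_dual fun l => ?_
  obtain ⟨ε, hε, hε0, H⟩ := exists_contDiff_specialCurve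
  by_contra! hcon
  -- Unboundedness gives `v n` in `B` with `|l (L (v n))| > n / ε n`. The special curve through the
  -- points `ε n • v n` is smooth because `B` is bounded, yet `l ∘ L` exceeds `n` at time `2⁻ⁿ`.
  choose y hy hly using fun n : ℕ => hcon (n / ε n)
  have hy' : ∀ n, ∃ v ∈ B, L v = y n := hy
  choose v hv hvy using hy'
  have hc : ∀ t, SmoothCurveAt (specialCurve (fun n => ε n • v n) 0) t := fun t => by
    refine smoothCurveAt_iff_scalar.2 (Eventually.of_forall fun s k => ?_)
    have e : (fun r => k (specialCurve (fun n => ε n • v n) 0 r)) = _ :=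
      funext fun r => map_specialCurve k.toLinearMap (fun n => ε n • v n) 0 r
    rw [e]
    obtain ⟨C, hC⟩ := exists_abs_le_of_isVonNBounded hB k
    refine (H _ _ ⟨C, fun n => ?_⟩).contDiffAt
    have h1 := hC (v n) (hv n)
    have h2 : 0 ≤ C := (abs_nonneg _).trans h1
    constructor
    · simp only [ContinuousLinearMap.coe_coe, map_smul, smul_eq_mul, abs_mul, abs_of_pos (hε n)]
      rw [mul_comm]
      exact mul_le_mul_of_nonneg_right h1 (hε n).le
    · simpa using mul_nonneg h2 (hε n).le
  have h1 := (hL _ 0 (hc 0)).scalar l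
  have h2 : Tendsto (fun n : ℕ => |l (L (specialCurve (fun n => ε n • v n) 0 ((1 / 2) ^ n)))|) atTop
      (𝓝 |l (L (specialCurve (fun n => ε n • v n) 0 0))|) :=
    (h1.continuousAt.tendsto.comp (tendsto_pow_atTop_nhds_zero_of_lt_one (by norm_num)
      (by norm_num))).abs
  refine not_tendsto_nhds_of_tendsto_atTop (tendsto_atTop_mono (fun n => ?_)
    tendsto_natCast_atTop_atTop) _ h2
  rw [(specialCurve_eventuallyEq (fun n => ε n • v n) 0 n).self_of_nhds]
  have := hly n
  rw [div_lt_iff₀ (hε n)] at this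
  simp only [sub_self, zero_smul, add_zero, map_smul, smul_eq_mul, abs_mul, abs_of_pos (hε n), hvy]
  linarith

end CInfTopology

/-! ### Maps from the plane to a convenient space -/

section Plane

/-- Maps from the plane that are smooth along smooth curves near the point `p`. -/
def PlaneSmoothAt (K : ℝ × ℝ → F) (p : ℝ × ℝ) : Prop :=
  ∃ Ω : Set (ℝ × ℝ), IsOpen Ω ∧ p ∈ Ω ∧ ∀ γ : ℝ → ℝ × ℝ, ContDiff ℝ ∞ γ → ∀ t, γ t ∈ Ω →
    SmoothCurveAt (fun s => K (γ s)) t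

/-- Here Boman's theorem enters the vector-valued calculus: identities between derivatives of `K`
may be checked on the `C^∞` functions `l ∘ K`. -/
theorem PlaneSmoothAt.contDiffAt {K : ℝ × ℝ → F} {p : ℝ × ℝ} (h : PlaneSmoothAt K p)
    (l : F →L[ℝ] ℝ) : ContDiffAt ℝ ∞ (fun q => l (K q)) p := by
  obtain ⟨Ω, hΩ, hp, H⟩ := h
  exact contDiffAt_of_curves hΩ (fun γ hγ t ht => (H γ hγ t ht).scalar l) hp

theorem PlaneSmoothAt.eventually {K : ℝ × ℝ → F} {p : ℝ × ℝ} (h : PlaneSmoothAt K p) :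
    ∀ᶠ q in 𝓝 p, PlaneSmoothAt K q := by
  obtain ⟨Ω, hΩ, hp, H⟩ := h
  exact eventually_of_mem (hΩ.mem_nhds hp) fun q hq => ⟨Ω, hΩ, hq, H⟩

theorem PlaneSmoothAt.smoothCurveAt {K : ℝ × ℝ → F} {γ : ℝ → ℝ × ℝ} {t : ℝ}
    (h : PlaneSmoothAt K (γ t)) (hγ : ContDiff ℝ ∞ γ) : SmoothCurveAt (fun s => K (γ s)) t := by
  obtain ⟨Ω, hΩ, hp, H⟩ := h
  exact H γ hγ t hp

theorem PlaneSmoothAt.smoothCurveAt_fst {K : ℝ × ℝ → F} {p : ℝ × ℝ}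
    (h : PlaneSmoothAt K p) : SmoothCurveAt (fun s => K (s, p.2)) p.1 :=
  h.smoothCurveAt (γ := fun s => (s, p.2)) (by fun_prop)

theorem PlaneSmoothAt.smoothCurveAt_snd {K : ℝ × ℝ → F} {p : ℝ × ℝ}
    (h : PlaneSmoothAt K p) : SmoothCurveAt (fun s => K (p.1, s)) p.2 :=
  h.smoothCurveAt (γ := fun s => (p.1, s)) (by fun_prop)

theorem clm_deriv_fst {K : ℝ × ℝ → F} {p : ℝ × ℝ} (h : PlaneSmoothAt K p) (l : F →L[ℝ] ℝ) :
    l (deriv (fun s => K (s, p.2)) p.1) = fderiv ℝ (fun q => l (K q)) p (1, 0) := by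
  rw [← h.smoothCurveAt_fst.clm_deriv l]
  have h1 := ((h.contDiffAt l).differentiableAt (by simp)).hasFDerivAt
  have h2 : HasDerivAt (fun s : ℝ => (s, p.2)) (1, 0) p.1 :=
    (hasDerivAt_id' p.1).prodMk (hasDerivAt_const _ _)
  exact (h1.comp_hasDerivAt p.1 h2).deriv

theorem clm_deriv_snd {K : ℝ × ℝ → F} {p : ℝ × ℝ} (h : PlaneSmoothAt K p) (l : F →L[ℝ] ℝ) :
    l (deriv (fun s => K (p.1, s)) p.2) = fderiv ℝ (fun q => l (K q)) p (0, 1) := by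
  rw [← h.smoothCurveAt_snd.clm_deriv l]
  have h1 := ((h.contDiffAt l).differentiableAt (by simp)).hasFDerivAt
  have h2 : HasDerivAt (fun s : ℝ => (p.1, s)) (0, 1) p.2 :=
    (hasDerivAt_const _ _).prodMk (hasDerivAt_id' p.2)
  exact (h1.comp_hasDerivAt p.2 h2).deriv

theorem contDiffAt_fderiv_apply {h : ℝ × ℝ → ℝ} {p : ℝ × ℝ} (hh : ContDiffAt ℝ ∞ h p) (v : ℝ × ℝ) :
    ContDiffAt ℝ ∞ (fun q => fderiv ℝ h q v) p :=
  (hh.fderiv_right (m := ∞) (by simp)).clm_apply contDiffAt_const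

theorem PlaneSmoothAt.deriv_snd {K : ℝ × ℝ → F} {t r : ℝ} (h : PlaneSmoothAt K (t, r)) :
    SmoothCurveAt (fun s => deriv (fun r => K (s, r)) r) t := by
  rw [smoothCurveAt_iff_scalar]
  have hc : ContinuousAt (fun s : ℝ => (s, r)) t := by fun_prop
  have h1 := hc.eventually h.eventually
  filter_upwards [h1.eventually_nhds] with s hs l
  have e : (fun s => l (deriv (fun r => K (s, r)) r)) =ᶠ[𝓝 s]
      fun s => fderiv ℝ (fun q => l (K q)) (s, r) (0, 1) := by
    filter_upwards [hs] with x hx using clm_deriv_snd hx l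
  refine ContDiffAt.congr_of_eventuallyEq ?_ e
  exact ContDiffAt.comp (f := fun s => (s, r)) s
    (contDiffAt_fderiv_apply (hs.self_of_nhds.contDiffAt l) (0, 1)) (by fun_prop)

/-- Additivity of the differential, the chain rule and the product rule are all instances of this
identity for suitable `K`. -/
theorem PlaneSmoothAt.deriv_diag {K : ℝ × ℝ → F} (h : PlaneSmoothAt K (0, 0)) :
    HasDerivAt (fun t => K (t, t)) (deriv (fun s => K (s, 0)) 0 + deriv (fun s => K (0, s)) 0) 0 := by
  have h1 : SmoothCurveAt (fun t => K (t, t)) 0 :=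
    h.smoothCurveAt (γ := fun t => (t, t)) (t := 0) (by fun_prop)
  have e : deriv (fun t => K (t, t)) 0 =
      deriv (fun s => K (s, 0)) 0 + deriv (fun s => K (0, s)) 0 := by
    refine eq_of_forall_dual fun l => ?_
    rw [← h1.clm_deriv l, map_add, clm_deriv_fst h l, clm_deriv_snd h l, ← map_add]
    have h2 := ((h.contDiffAt l).differentiableAt (by simp)).hasFDerivAt
    have h3 : HasDerivAt (fun s : ℝ => (s, s)) (1, 1) 0 :=
      (hasDerivAt_id' 0).prodMk (hasDerivAt_id' 0)
    simpa [Function.comp_def] using (HasFDerivAt.comp_hasDerivAt (f := fun s : ℝ => (s, s)) (0 : ℝ) h2 h3).deriv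
  rw [← e]
  exact h1.hasDerivAt

theorem PlaneSmoothAt.swap {K : ℝ × ℝ → F} {p : ℝ × ℝ} (h : PlaneSmoothAt K p) :
    PlaneSmoothAt (fun q => K (q.2, q.1)) (p.2, p.1) := by
  obtain ⟨Ω, hΩ, hp, H⟩ := h
  refine ⟨Prod.swap ⁻¹' Ω, hΩ.preimage continuous_swap, hp, fun γ hγ t ht => ?_⟩
  exact H (fun s => ((γ s).2, (γ s).1)) (by fun_prop) t ht

theorem PlaneSmoothAt.deriv_comm {K : ℝ × ℝ → F} (h : PlaneSmoothAt K (0, 0)) :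
    deriv (fun s => deriv (fun r => K (s, r)) 0) 0 = deriv (fun r => deriv (fun s => K (s, r)) 0) 0 := by
  refine eq_of_forall_dual fun l => ?_
  have h1 := h.deriv_snd
  have h2 : SmoothCurveAt (fun r => deriv (fun s => K (s, r)) 0) 0 := h.swap.deriv_snd
  rw [← h1.clm_deriv l, ← h2.clm_deriv l]
  have hc1 : ContinuousAt (fun s : ℝ => (s, (0 : ℝ))) 0 := by fun_prop
  have hc2 : ContinuousAt (fun s : ℝ => ((0 : ℝ), s)) 0 := by fun_prop
  have e1 : (fun s => l (deriv (fun r => K (s, r)) 0)) =ᶠ[𝓝 0]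
      fun s => fderiv ℝ (fun q => l (K q)) (s, 0) (0, 1) := by
    filter_upwards [hc1.eventually h.eventually] with x hx using clm_deriv_snd hx l
  have e2 : (fun r => l (deriv (fun s => K (s, r)) 0)) =ᶠ[𝓝 0]
      fun s => fderiv ℝ (fun q => l (K q)) (0, s) (1, 0) := by
    filter_upwards [hc2.eventually h.eventually] with x hx using clm_deriv_fst hx l
  rw [e1.deriv_eq, e2.deriv_eq]
  have hK := h.contDiffAt l
  have hD := ((hK.fderiv_right (m := ∞) (by simp)).differentiableAt (by simp)).hasFDerivAt
  have d1 : HasDerivAt (fun s : ℝ => (s, (0 : ℝ))) (1, 0) 0 :=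
    (hasDerivAt_id' 0).prodMk (hasDerivAt_const _ _)
  have d2 : HasDerivAt (fun s : ℝ => ((0 : ℝ), s)) (0, 1) 0 :=
    (hasDerivAt_const _ _).prodMk (hasDerivAt_id' 0)
  have f1 := ((HasFDerivAt.comp_hasDerivAt (f := fun s : ℝ => (s, (0 : ℝ))) (0 : ℝ) hD d1).clm_apply (hasDerivAt_const (0 : ℝ) ((0, 1) : ℝ × ℝ))).deriv
  have f2 := ((HasFDerivAt.comp_hasDerivAt (f := fun s : ℝ => ((0 : ℝ), s)) (0 : ℝ) hD d2).clm_apply (hasDerivAt_const (0 : ℝ) ((1, 0) : ℝ × ℝ))).deriv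
  simp only [map_zero, add_zero, Function.comp_def] at f1 f2
  rw [f1, f2]
  exact second_derivative_symmetric_of_eventually (f := fun q => l (K q))
    (((hK.of_le (m := 1) (by simp)).eventually (by simp)).mono
      fun y hy => (hy.differentiableAt (by simp)).hasFDerivAt) hD _ _

theorem SmoothCurveAt.planeSmoothAt_fst {c : ℝ → F} {p : ℝ × ℝ} (h : SmoothCurveAt c p.1) :
    PlaneSmoothAt (fun q => c q.1) p := by
  obtain ⟨O, hO, hOo, hp⟩ := eventually_nhds_iff.1 h.eventually
  exact ⟨Prod.fst ⁻¹' O, hOo.preimage continuous_fst, hp, fun γ hγ t ht =>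
    SmoothCurveAt.comp_real (a := fun s => (γ s).1) (hO _ ht)
      (smoothCurveAt_of_contDiff (by fun_prop) t)⟩

theorem SmoothCurveAt.planeSmoothAt_snd {c : ℝ → F} {p : ℝ × ℝ} (h : SmoothCurveAt c p.2) :
    PlaneSmoothAt (fun q => c q.2) p :=
  (SmoothCurveAt.planeSmoothAt_fst (p := (p.2, p.1)) h).swap

theorem PlaneSmoothAt.add {K K' : ℝ × ℝ → F} {p : ℝ × ℝ} (h : PlaneSmoothAt K p)
    (h' : PlaneSmoothAt K' p) : PlaneSmoothAt (fun q => K q + K' q) p := by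
  obtain ⟨Ω, hΩ, hp, H⟩ := h
  obtain ⟨Ω', hΩ', hp', H'⟩ := h'
  exact ⟨Ω ∩ Ω', hΩ.inter hΩ', ⟨hp, hp'⟩, fun γ hγ t ht =>
    (H γ hγ t ht.1).add (H' γ hγ t ht.2)⟩

theorem PlaneSmoothAt.smul {a : ℝ × ℝ → ℝ} {K : ℝ × ℝ → F} {p : ℝ × ℝ} (h : PlaneSmoothAt a p)
    (h' : PlaneSmoothAt K p) : PlaneSmoothAt (fun q => a q • K q) p := by
  obtain ⟨Ω, hΩ, hp, H⟩ := h
  obtain ⟨Ω', hΩ', hp', H'⟩ := h'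
  exact ⟨Ω ∩ Ω', hΩ.inter hΩ', ⟨hp, hp'⟩, fun γ hγ t ht =>
    (H γ hγ t ht.1).smul (H' γ hγ t ht.2)⟩

theorem planeSmoothAt_const (x : F) (p : ℝ × ℝ) : PlaneSmoothAt (fun _ => x) p :=
  ⟨univ, isOpen_univ, mem_univ _, fun _ _ _ _ => smoothCurveAt_const _ _⟩

/-- Composition of a map of two variables with maps from the plane. -/
theorem PlaneSmoothAt.comp₂ {A : E → F → G} {U : Set E} (hU : IsOpen (X := CInf E) U)
    (hA : ∀ (c : ℝ → E) (v : ℝ → F) t, SmoothCurveAt c t → SmoothCurveAt v t → c t ∈ U →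
      SmoothCurveAt (fun s => A (c s) (v s)) t)
    {κ : ℝ × ℝ → E} {v : ℝ × ℝ → F} {p : ℝ × ℝ} (hκ : PlaneSmoothAt κ p)
    (hv : PlaneSmoothAt v p) (hp : κ p ∈ U) : PlaneSmoothAt (fun q => A (κ q) (v q)) p := by
  obtain ⟨Ω, hΩ, hpΩ, H⟩ := hκ
  obtain ⟨Ω', hΩ', hpΩ', H'⟩ := hv
  -- The preimage of `U` need not be open a priori, since `κ` is only known along smooth curves;
  -- openness is tested along these.
  refine ⟨Ω ∩ Ω' ∩ κ ⁻¹' U, isOpen_of_curves fun γ hγ => ?_, ⟨⟨hpΩ, hpΩ'⟩, hp⟩, fun γ hγ t ht =>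
    hA _ _ t (H γ hγ t ht.1.1) (H' γ hγ t ht.1.2) ht.2⟩
  rw [isOpen_iff_mem_nhds]
  intro t ht
  filter_upwards [hγ.continuous.continuousAt ((hΩ.inter hΩ').mem_nhds ht.1),
    (H γ hγ t ht.1.1).eventually_mem hU ht.2] with s hs hs' using ⟨hs, hs'⟩

theorem PlaneSmoothAt.comp {f : E → F} {U : Set E} (hU : IsOpen (X := CInf E) U)
    (hf : SmoothOn f U) {κ : ℝ × ℝ → E} {p : ℝ × ℝ} (hκ : PlaneSmoothAt κ p) (hp : κ p ∈ U) :
    PlaneSmoothAt (fun q => f (κ q)) p :=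
  PlaneSmoothAt.comp₂ (A := fun x (_ : E) => f x) hU (fun c _ t hc _ ht => hf c t hc ht) hκ hκ hp

end Plane

end Convenient

/-! ### Differential calculus -/

namespace Convenient

variable {E : Type*} [AddCommGroup E] [Module ℝ E] [TopologicalSpace E] [ConvenientSpace E]
variable {F : Type*} [AddCommGroup F] [Module ℝ F] [TopologicalSpace F] [ConvenientSpace F]
variable {G : Type*} [AddCommGroup G] [Module ℝ G] [TopologicalSpace G] [ConvenientSpace G]

theorem deriv_const' (x : F) (t : ℝ) : deriv (fun _ : ℝ => x) t = 0 := by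
  refine eq_of_forall_dual fun l => ?_
  rw [← (smoothCurveAt_const x t).clm_deriv l]
  simp

theorem deriv_congr {c c' : ℝ → F} {t : ℝ} (hc : SmoothCurveAt c t) (h : c' =ᶠ[𝓝 t] c) :
    deriv c' t = deriv c t := by
  refine eq_of_forall_dual fun l => ?_
  rw [← hc.clm_deriv l, ← (hc.congr h).clm_deriv l]
  exact EventuallyEq.deriv_eq (h.mono fun s hs => by simp [hs])

theorem deriv_comp_mul {c : ℝ → F} (hc : SmoothCurveAt c 0) (a : ℝ) :
    deriv (fun t => c (a * t)) 0 = a • deriv c 0 := by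
  have h1 : SmoothCurveAt (fun t => c (a * t)) 0 :=
    SmoothCurveAt.comp_real (a := fun t => a * t) (by simpa using hc)
      (smoothCurveAt_of_contDiff (by fun_prop) 0)
  refine eq_of_forall_dual fun l => ?_
  have h2 := deriv_comp_mul_left a (fun r => l (c r)) 0
  rw [mul_zero, hc.clm_deriv l] at h2
  rw [← h1.clm_deriv l, h2, map_smul]

/-! ### The differential of a smooth map -/

section Differential

theorem planeSmoothAt_line {c v : ℝ → E} {p : ℝ × ℝ} (hc : SmoothCurveAt c p.1)
    (hv : SmoothCurveAt v p.1) : PlaneSmoothAt (fun q => c q.1 + q.2 • v q.1) p :=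
  hc.planeSmoothAt_fst.add
    ((SmoothCurveAt.planeSmoothAt_snd (smoothCurveAt_id p.2)).smul hv.planeSmoothAt_fst)

theorem planeSmoothAt_affine (u v w : E) (p : ℝ × ℝ) :
    PlaneSmoothAt (fun q => u + q.1 • v + q.2 • w) p :=
  planeSmoothAt_line (smoothCurveAt_line u v p.1) (smoothCurveAt_const w p.1)

theorem SmoothOn.mono {f : E → F} {U V : Set E} (hf : SmoothOn f U) (h : V ⊆ U) : SmoothOn f V :=
  fun c t hc ht => hf c t hc (h ht)

theorem smoothOn_id (U : Set E) : SmoothOn (fun u : E => u) U := fun _ _ hc _ => hc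

variable {f : E → F} {U : Set E}

theorem SmoothOn.smoothCurveAt_line (hf : SmoothOn f U) {u : E} (hu : u ∈ U) (v : E) :
    SmoothCurveAt (fun t : ℝ => f (u + t • v)) 0 :=
  hf _ 0 (Convenient.smoothCurveAt_line u v 0) (by simpa using hu)

/-- The differential of a smooth map is smooth. -/
theorem SmoothOn.dirDeriv_curve (hf : SmoothOn f U) (hU : IsOpen (X := CInf E) U) {c v : ℝ → E}
    {t : ℝ} (hc : SmoothCurveAt c t) (hv : SmoothCurveAt v t) (ht : c t ∈ U) :
    SmoothCurveAt (fun s => dirDeriv f (c s) (v s)) t :=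
  PlaneSmoothAt.deriv_snd (K := fun q => f (c q.1 + q.2 • v q.1))
    (PlaneSmoothAt.comp hU hf (p := (t, 0)) (planeSmoothAt_line hc hv) (by simpa using ht))

theorem SmoothOn.dirDeriv (hf : SmoothOn f U) (hU : IsOpen (X := CInf E) U) (v : E) :
    SmoothOn (fun u => dirDeriv f u v) U := fun _ _ hc ht =>
  hf.dirDeriv_curve hU hc (smoothCurveAt_const v _) ht

/-- The chain rule along curves. -/
theorem SmoothOn.deriv_comp (hf : SmoothOn f U) (hU : IsOpen (X := CInf E) U) {c : ℝ → E}
    {t : ℝ} (hc : SmoothCurveAt c t) (ht : c t ∈ U) :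
    deriv (fun s => f (c s)) t = Convenient.dirDeriv f (c t) (deriv c t) := by
  -- Write `c (t + r) = c t + r q(r)` with `q` smooth, and take the diagonal derivative of `(p₁, p₂)
  -- ↦ f (c t + p₁ q(p₂))`. For `p₁ = 0` this map is constant in `p₂`, so only the derivative in the
  -- direction `q 0 = c'(t)` remains.
  obtain ⟨q, hq, hq0, he⟩ := hc.exists_slope
  have hK : PlaneSmoothAt (fun p : ℝ × ℝ => f (c t + p.1 • q p.2)) (0, 0) :=
    PlaneSmoothAt.comp hU hf ((planeSmoothAt_const _ _).add
      ((SmoothCurveAt.planeSmoothAt_fst (smoothCurveAt_id _)).smul hq.planeSmoothAt_snd))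
      (by simpa using ht)
  have h1 := deriv_eq_of_hasDerivAt hK.deriv_diag
  simp only [zero_smul, add_zero, deriv_const'] at h1
  rw [← hq0, Convenient.dirDeriv, ← h1]
  have h2 : SmoothCurveAt (fun s => f (c s)) t := hf c t hc ht
  have h3 : SmoothCurveAt (fun s => f (c (t + s))) 0 :=
    SmoothCurveAt.comp_real (c := fun s => f (c s)) (a := fun s => t + s) (by simpa using h2)
      (smoothCurveAt_of_contDiff (by fun_prop) 0)
  have h4 : deriv (fun r => f (c t + r • q r)) 0 = deriv (fun s => f (c (t + s))) 0 :=
    deriv_congr h3 (he.mono fun r hr => by simp only [hr])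
  rw [h4]
  refine eq_of_forall_dual fun l => ?_
  rw [← h2.clm_deriv l, ← h3.clm_deriv l, deriv_comp_const_add (fun s => l (f (c s))), add_zero]

theorem SmoothOn.dirDeriv_smul (hf : SmoothOn f U) {u : E} (hu : u ∈ U) (a : ℝ) (v : E) :
    Convenient.dirDeriv f u (a • v) = a • Convenient.dirDeriv f u v := by
  have h := deriv_comp_mul (hf.smoothCurveAt_line hu v) a
  rw [Convenient.dirDeriv, Convenient.dirDeriv, ← h]
  simp only [smul_smul, mul_comm]

theorem SmoothOn.dirDeriv_add (hf : SmoothOn f U) (hU : IsOpen (X := CInf E) U) {u : E} (hu : u ∈ U)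
    (v w : E) : Convenient.dirDeriv f u (v + w) =
      Convenient.dirDeriv f u v + Convenient.dirDeriv f u w := by
  have hK : PlaneSmoothAt (fun q : ℝ × ℝ => f (u + q.1 • v + q.2 • w)) (0, 0) :=
    PlaneSmoothAt.comp hU hf (planeSmoothAt_affine u v w _) (by simpa using hu)
  have h1 := deriv_eq_of_hasDerivAt hK.deriv_diag
  simp only [zero_smul, add_zero, add_assoc, ← smul_add] at h1
  exact h1

theorem SmoothOn.isLinearMap_dirDeriv (hf : SmoothOn f U) (hU : IsOpen (X := CInf E) U) {u : E}
    (hu : u ∈ U) : IsLinearMap ℝ (Convenient.dirDeriv f u) :=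
  ⟨hf.dirDeriv_add hU hu, hf.dirDeriv_smul hu⟩

theorem SmoothOn.mapsBounded_dirDeriv (hf : SmoothOn f U) (hU : IsOpen (X := CInf E) U) {u : E}
    (hu : u ∈ U) : MapsBounded (Convenient.dirDeriv f u) :=
  mapsBounded_of_smoothCurves (L := (hf.isLinearMap_dirDeriv hU hu).mk' _)
    fun _ t hc => hf.dirDeriv_curve hU (smoothCurveAt_const u t) hc hu

theorem dirDeriv_congr {g : E → F} (hU : IsOpen (X := CInf E) U) {u : E} (hu : u ∈ U)
    (hg : SmoothOn g U) (h : ∀ u ∈ U, f u = g u) (v : E) : dirDeriv f u v = dirDeriv g u v := by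
  refine deriv_congr (hg.smoothCurveAt_line hu v) ?_
  exact ((smoothCurveAt_line u v 0).eventually_mem hU (by simpa using hu)).mono fun _ hs => h _ hs

theorem dirDeriv_comp {g : F → G} {V : Set F} (hg : SmoothOn g V) (hV : IsOpen (X := CInf F) V)
    (hf : SmoothOn f U) {u : E} (hu : u ∈ U) (hfu : f u ∈ V) (v : E) :
    dirDeriv (fun u => g (f u)) u v = dirDeriv g (f u) (dirDeriv f u v) := by
  have h := hg.deriv_comp hV (hf.smoothCurveAt_line hu v) (by simpa using hfu)
  rwa [zero_smul, add_zero] at h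

theorem dirDeriv_linear {L : E →ₗ[ℝ] F} (hL : MapsBounded L) (u v : E) : dirDeriv L u v = L v := by
  have h := ((smoothCurveAt_line u v 0).linear_comp hL).2
  rw [deriv_line] at h
  exact deriv_eq_of_hasDerivAt h

theorem dirDeriv_id (u v : E) : dirDeriv (fun u : E => u) u v = v := deriv_line u v 0

/-- The product rule for the value `A(u) X(u)` of a smooth family of linear maps. -/
theorem dirDeriv_apply {A : E → F → G} (hU : IsOpen (X := CInf E) U)
    (hA : ∀ (c : ℝ → E) (v : ℝ → F) t, SmoothCurveAt c t → SmoothCurveAt v t → c t ∈ U →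
      SmoothCurveAt (fun s => A (c s) (v s)) t)
    (hlin : ∀ u ∈ U, IsLinearMap ℝ (A u)) {X : E → F} (hX : SmoothOn X U) {u : E} (hu : u ∈ U)
    (w : E) : dirDeriv (fun u => A u (X u)) u w =
      dirDeriv (fun u' => A u' (X u)) u w + A u (dirDeriv X u w) := by
  have h1 : PlaneSmoothAt (fun q : ℝ × ℝ => u + q.1 • w) (0, 0) :=
    SmoothCurveAt.planeSmoothAt_fst (p := (0, 0)) (smoothCurveAt_line u w 0)
  have h2 : PlaneSmoothAt (fun q : ℝ × ℝ => X (u + q.2 • w)) (0, 0) :=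
    SmoothCurveAt.planeSmoothAt_snd (p := (0, 0)) (hX.smoothCurveAt_line hu w)
  have h3 := deriv_eq_of_hasDerivAt
    (PlaneSmoothAt.comp₂ hU hA h1 h2 (by simpa using hu)).deriv_diag
  simp only [zero_smul, add_zero] at h3
  have h4 : MapsBounded (A u) := mapsBounded_of_smoothCurves (L := (hlin u hu).mk' _)
    fun _ t hc => hA _ _ t (smoothCurveAt_const u t) hc hu
  have h5 := deriv_eq_of_hasDerivAt
    ((hX.smoothCurveAt_line hu w).linear_comp (L := (hlin u hu).mk' _) h4).2
  refine h3.trans ?_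
  congr 1

theorem SmoothOn.dirDeriv_comm (hf : SmoothOn f U) (hU : IsOpen (X := CInf E) U) {u : E}
    (hu : u ∈ U) (v w : E) :
    Convenient.dirDeriv (fun u => Convenient.dirDeriv f u v) u w =
      Convenient.dirDeriv (fun u => Convenient.dirDeriv f u w) u v := by
  have hK : PlaneSmoothAt (fun q : ℝ × ℝ => f (u + q.1 • w + q.2 • v)) (0, 0) :=
    PlaneSmoothAt.comp hU hf (planeSmoothAt_affine u w v _) (by simpa using hu)
  have h1 := hK.deriv_comm
  simp only [add_right_comm u (_ • w)] at h1 ⊢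
  refine Eq.trans ?_ h1
  simp only [Convenient.dirDeriv, add_right_comm u (_ • w)]

/-- The derivative of `u ↦ df(u) X(u)`. -/
theorem SmoothOn.dirDeriv_dirDeriv_apply (hf : SmoothOn f U) (hU : IsOpen (X := CInf E) U)
    {X : E → E} (hX : SmoothOn X U) {u : E} (hu : u ∈ U) (w : E) :
    Convenient.dirDeriv (fun u => Convenient.dirDeriv f u (X u)) u w =
      Convenient.dirDeriv (fun u' => Convenient.dirDeriv f u' (X u)) u w +
        Convenient.dirDeriv f u (Convenient.dirDeriv X u w) :=
  dirDeriv_apply hU (fun _ _ _ hc hv ht => hf.dirDeriv_curve hU hc hv ht)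
    (fun _ hu => hf.isLinearMap_dirDeriv hU hu) hX hu w

end Differential

end Convenient

/-! ### Charts -/

namespace Convenient

section Charts

variable {E : Type*} [AddCommGroup E] [Module ℝ E] [TopologicalSpace E] [ConvenientSpace E]
variable {M : Type*} [TopologicalSpace M]

theorem transition_apply {e : OpenPartialHomeomorph M (CInf E)} {x : M} (hx : x ∈ e.source)
    (e' : OpenPartialHomeomorph M (CInf E)) : transition e e' (e x) = e' x :=
  congrArg e' (e.left_inv hx)

/-- `c^∞`-open sets. -/
abbrev COpen (U : Set E) : Prop := IsOpen (X := CInf E) U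

/-- The domain of the change of charts. -/
def transitionDom (e e' : OpenPartialHomeomorph M (CInf E)) : Set E := (e.symm.trans e').source

theorem isOpen_transitionDom (e e' : OpenPartialHomeomorph M (CInf E)) :
    COpen (transitionDom e e') := (e.symm.trans e').open_source

theorem mem_transitionDom_iff {e e' : OpenPartialHomeomorph M (CInf E)} {u : E} :
    u ∈ transitionDom e e' ↔ u ∈ e.target ∧ e.symm u ∈ e'.source := by
  rw [transitionDom, OpenPartialHomeomorph.trans_source, OpenPartialHomeomorph.symm_source]
  rfl

theorem mem_transitionDom {e e' : OpenPartialHomeomorph M (CInf E)} {x : M} (hx : x ∈ e.source)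
    (hx' : x ∈ e'.source) : (e x : E) ∈ transitionDom e e' := by
  exact (mem_transitionDom_iff (E := E)).2 ⟨e.map_source hx, (e.left_inv hx).symm ▸ hx'⟩

/-- The image of an open set in a chart. -/
def chartImage (e : OpenPartialHomeomorph M (CInf E)) (O : Set M) : Set E :=
  e.target ∩ e.symm ⁻¹' O

theorem isOpen_chartImage (e : OpenPartialHomeomorph M (CInf E)) {O : Set M} (hO : IsOpen O) :
    COpen (chartImage e O) := e.symm.isOpen_inter_preimage hO

theorem mem_chartImage {e : OpenPartialHomeomorph M (CInf E)} {O : Set M} {x : M}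
    (hx : x ∈ e.source) (hO : x ∈ O) : (e x : E) ∈ chartImage e O := by
  exact ⟨e.map_source hx, show e.symm (e x) ∈ O from (e.left_inv hx).symm ▸ hO⟩

variable [ChartedSpace (CInf E) M]

/-- The charts that are compatible with those of the atlas. -/
def IsSmoothChart (e : OpenPartialHomeomorph M (CInf E)) : Prop :=
  ∀ e₁ ∈ atlas (CInf E) M, CompatibleCharts e e₁

theorem isSmoothChart_chartAt [ConvenientManifold E M] (x : M) :
    IsSmoothChart (chartAt (CInf E) x) :=
  fun e₁ h => ConvenientManifold.compatible _ (chart_mem_atlas _ x) e₁ h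

variable {e e' : OpenPartialHomeomorph M (CInf E)}

/-- Both charts are only known to be compatible with the atlas, so near each point the change of
charts is factored through a chart of the atlas. -/
theorem IsSmoothChart.smoothOn_transition (he : IsSmoothChart e) (he' : IsSmoothChart e') :
    SmoothOn (transition e e') (transitionDom e e') := by
  intro c t hc ht
  obtain ⟨h1, h2⟩ := mem_transitionDom_iff.1 ht
  set a := chartAt (CInf E) (e.symm (c t)) with ha
  have hxa : e.symm (c t) ∈ a.source := mem_chart_source _ _
  have hat : c t ∈ transitionDom e a := mem_transitionDom_iff.2 ⟨h1, hxa⟩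
  have ha1 : SmoothOn (transition e a) (transitionDom e a) := (he a (chart_mem_atlas _ _)).1
  have ha2 : SmoothOn (transition a e') (transitionDom a e') := (he' a (chart_mem_atlas _ _)).2
  refine (ha2 _ t (ha1 c t hc hat) (mem_transitionDom hxa h2)).congr ?_
  filter_upwards [hc.eventually_mem (isOpen_transitionDom e a) hat] with s hs
  exact (transition_apply (mem_transitionDom_iff.1 hs).2 e').symm

theorem MSmoothCurveAt.smoothCurveAt {c : ℝ → M} {t : ℝ} [ConvenientManifold E M]
    (h : MSmoothCurveAt E c t) (he : IsSmoothChart e) (ht : c t ∈ e.source) :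
    SmoothCurveAt (E := E) (fun s => e (c s)) t := by
  have h1 := (isSmoothChart_chartAt (E := E) (c t)).smoothOn_transition he
  refine (h1 _ t h.2 (mem_transitionDom (mem_chart_source _ _) ht)).congr ?_
  filter_upwards [h.1.eventually ((chartAt (CInf E) (c t)).open_source.mem_nhds
    (mem_chart_source _ _))] with s hs
  exact (transition_apply hs e).symm

theorem mSmoothCurveAt_of_chart {c : ℝ → M} {t : ℝ} [ConvenientManifold E M] (hc : ContinuousAt c t)
    (he : IsSmoothChart e) (ht : c t ∈ e.source)
    (h : SmoothCurveAt (E := E) (fun s => e (c s)) t) : MSmoothCurveAt E c t := by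
  refine ⟨hc, ?_⟩
  have h1 := he.smoothOn_transition (isSmoothChart_chartAt (E := E) (c t))
  refine (h1 _ t h (mem_transitionDom ht (mem_chart_source _ _))).congr ?_
  filter_upwards [hc.eventually (e.open_source.mem_nhds ht)] with s hs
  exact (transition_apply hs _).symm

theorem MSmoothCurveAt.eventually_mem {c : ℝ → M} {t : ℝ} (h : MSmoothCurveAt E c t) {O : Set M}
    (hO : IsOpen O) (ht : c t ∈ O) : ∀ᶠ s in 𝓝 t, c s ∈ O := h.1.eventually (hO.mem_nhds ht)

theorem mSmoothCurveAt_const (x : M) (t : ℝ) : MSmoothCurveAt E (fun _ => x) t :=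
  ⟨continuousAt_const, smoothCurveAt_const (E := E) _ t⟩

theorem MSmoothCurveAt.congr [ConvenientManifold E M] {c c' : ℝ → M} {t : ℝ}
    (h : MSmoothCurveAt E c t) (hc : c' =ᶠ[𝓝 t] c) : MSmoothCurveAt E c' t := by
  refine mSmoothCurveAt_of_chart (h.1.congr hc.symm) (isSmoothChart_chartAt (E := E) (c t)) ?_
    (h.2.congr (hc.mono fun s hs =>
      congrArg (chartAt (CInf E) (c t)) hs))
  rw [hc.self_of_nhds]
  exact mem_chart_source _ _

theorem IsSmoothChart.mSmoothCurveAt_symm [ConvenientManifold E M] (he : IsSmoothChart e)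
    {u : ℝ → E} {t : ℝ} (hu : SmoothCurveAt u t) (ht : u t ∈ e.target) :
    MSmoothCurveAt E (fun s => e.symm (u s)) t := by
  have h1 : ContinuousAt (fun s => e.symm (u s)) t :=
    ContinuousAt.comp (Y := CInf E) (f := u) (e.continuousAt_symm ht) hu.continuousAt_cInf
  refine mSmoothCurveAt_of_chart h1 he (e.map_target ht) (hu.congr ?_)
  filter_upwards [hu.eventually_mem e.open_target ht] with s hs using e.right_inv hs

variable {x : M}

theorem dirDeriv_transition_comp {e₁ e₂ e₃ : OpenPartialHomeomorph M (CInf E)}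
    (h₁ : IsSmoothChart e₁) (h₂ : IsSmoothChart e₂) (h₃ : IsSmoothChart e₃) (hx₁ : x ∈ e₁.source)
    (hx₂ : x ∈ e₂.source) (hx₃ : x ∈ e₃.source) (v : E) :
    dirDeriv (transition e₂ e₃) (e₂ x) (dirDeriv (transition e₁ e₂) (e₁ x) v) =
      dirDeriv (transition e₁ e₃) (e₁ x) v := by
  have h := dirDeriv_comp (h₂.smoothOn_transition h₃) (isOpen_transitionDom e₂ e₃)
    (h₁.smoothOn_transition h₂) (u := e₁ x) (mem_transitionDom hx₁ hx₂)
    (by rw [transition_apply hx₁]; exact mem_transitionDom hx₂ hx₃) v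
  rw [transition_apply hx₁] at h
  rw [← h]
  refine dirDeriv_congr (isOpen_chartImage e₁ (e₂.open_source.inter e₃.open_source))
    (mem_chartImage hx₁ ⟨hx₂, hx₃⟩) ((h₁.smoothOn_transition h₃).mono fun u hu => ?_)
    (fun u hu => ?_) v
  · exact mem_transitionDom_iff.2 ⟨hu.1, hu.2.2⟩
  · exact transition_apply hu.2.1 e₃

omit [ChartedSpace (CInf E) M] in
theorem dirDeriv_transition_self (hx : x ∈ e.source) (v : E) :
    dirDeriv (transition e e) (e x) v = v :=
  (dirDeriv_congr (E := E) (F := E) (f := transition e e) (U := e.target) e.open_target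
    (e.map_source hx) (smoothOn_id _) (fun _ hu => e.right_inv hu) v).trans (dirDeriv_id (E := E) (e x) v)

variable [ConvenientManifold E M]

theorem isLinearMap_tcoord (he : IsSmoothChart e) (hx : x ∈ e.source) :
    IsLinearMap ℝ (tcoord e x) :=
  ((isSmoothChart_chartAt x).smoothOn_transition he).isLinearMap_dirDeriv
    (isOpen_transitionDom _ _) (mem_transitionDom (mem_chart_source _ x) hx)

theorem dirDeriv_transition_tcoord (he : IsSmoothChart e) (he' : IsSmoothChart e')
    (hx : x ∈ e.source) (hx' : x ∈ e'.source) (v : Tangent E x) :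
    dirDeriv (transition e e') (e x) (tcoord e x v) = tcoord e' x v :=
  @dirDeriv_transition_comp E _ _ _ _ M _ _ x _ _ _ (isSmoothChart_chartAt x) he he'
    (mem_chart_source _ x) hx hx' v

omit [ConvenientManifold E M] in
theorem tcoord_chartAt (x : M) (v : Tangent E x) : tcoord (chartAt (CInf E) x) x v = v :=
  dirDeriv_transition_self (E := E) (mem_chart_source _ x) v

theorem tvec_tcoord (he : IsSmoothChart e) (hx : x ∈ e.source) (v : Tangent E x) :
    tvec e x (tcoord e x v) = v :=
  (dirDeriv_transition_tcoord he (isSmoothChart_chartAt x) hx (mem_chart_source _ x) v).trans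
    (tcoord_chartAt x v)

theorem tcoord_tvec (he : IsSmoothChart e) (hx : x ∈ e.source) (v : E) :
    tcoord e x (tvec e x v) = v :=
  (dirDeriv_transition_comp he (isSmoothChart_chartAt x) he hx (mem_chart_source _ x) hx v).trans
    (dirDeriv_transition_self hx v)

theorem tcoord_injective (he : IsSmoothChart e) (hx : x ∈ e.source) :
    Function.Injective (tcoord e x) := fun v w h => by
  rw [← tvec_tcoord he hx v, h, tvec_tcoord he hx]

omit [ConvenientManifold E M] in
theorem tvec_chartAt (x : M) (v : E) : tvec (chartAt (CInf E) x) x v = v :=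
  dirDeriv_transition_self (mem_chart_source _ x) v

theorem TSmoothCurveAt.smoothCurveAt {c : ℝ → M} {v : ∀ s, Tangent E (c s)} {t : ℝ}
    (h : TSmoothCurveAt c v t) (he : IsSmoothChart e) (ht : c t ∈ e.source) :
    SmoothCurveAt (fun s => tcoord e (c s) (v s)) t := by
  have ha := isSmoothChart_chartAt (E := E) (c t)
  refine ((ha.smoothOn_transition he).dirDeriv_curve (isOpen_transitionDom _ _) h.1.2 h.2
    (mem_transitionDom (mem_chart_source _ _) ht)).congr ?_
  filter_upwards [h.1.eventually_mem (chartAt (CInf E) (c t)).open_source (mem_chart_source _ _),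
    h.1.eventually_mem e.open_source ht] with s hs hs'
  exact (dirDeriv_transition_tcoord ha he hs hs' (v s)).symm

theorem tSmoothCurveAt_of_chart {c : ℝ → M} {v : ∀ s, Tangent E (c s)} {t : ℝ}
    (hc : MSmoothCurveAt E c t) (he : IsSmoothChart e) (ht : c t ∈ e.source)
    (h : SmoothCurveAt (fun s => tcoord e (c s) (v s)) t) : TSmoothCurveAt c v t := by
  refine ⟨hc, ?_⟩
  have ha := isSmoothChart_chartAt (E := E) (c t)
  refine ((he.smoothOn_transition ha).dirDeriv_curve (isOpen_transitionDom _ _)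
    (hc.smoothCurveAt he ht) h (mem_transitionDom ht (mem_chart_source _ _))).congr ?_
  filter_upwards [hc.eventually_mem (chartAt (CInf E) (c t)).open_source (mem_chart_source _ _),
    hc.eventually_mem e.open_source ht] with s hs hs'
  exact (dirDeriv_transition_tcoord he ha hs' hs (v s)).symm

omit [ConvenientManifold E M] in
theorem TSmoothCurveAt.congr {c : ℝ → M} {v w : ∀ s, Tangent E (c s)} {t : ℝ}
    (h : TSmoothCurveAt c v t) (hw : ∀ᶠ s in 𝓝 t, w s = v s) : TSmoothCurveAt c w t :=
  ⟨h.1, h.2.congr (hw.mono fun s hs => by simp only [hs])⟩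

theorem tSmoothCurveAt_tvec {c : ℝ → M} {v : ℝ → E} {t : ℝ} (hc : MSmoothCurveAt E c t)
    (he : IsSmoothChart e) (ht : c t ∈ e.source) (hv : SmoothCurveAt v t) :
    TSmoothCurveAt c (fun s => tvec e (c s) (v s)) t := by
  refine tSmoothCurveAt_of_chart hc he ht (hv.congr ?_)
  filter_upwards [hc.eventually_mem e.open_source ht] with s hs using tcoord_tvec he hs (v s)

theorem isLinearMap_tvec (he : IsSmoothChart e) (hx : x ∈ e.source) :
    IsLinearMap ℝ (tvec e x) :=
  (he.smoothOn_transition (isSmoothChart_chartAt x)).isLinearMap_dirDeriv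
    (isOpen_transitionDom _ _) (mem_transitionDom hx (mem_chart_source _ x))

theorem mapsBounded_tvec (he : IsSmoothChart e) (hx : x ∈ e.source) :
    MapsBounded (E := E) (F := E) (tvec e x) :=
  (he.smoothOn_transition (isSmoothChart_chartAt x)).mapsBounded_dirDeriv
    (isOpen_transitionDom _ _) (mem_transitionDom hx (mem_chart_source _ x))

theorem mapsBounded_tcoord (he : IsSmoothChart e) (hx : x ∈ e.source) :
    MapsBounded (E := E) (F := E) (tcoord e x) :=
  ((isSmoothChart_chartAt x).smoothOn_transition he).mapsBounded_dirDeriv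
    (isOpen_transitionDom _ _) (mem_transitionDom (mem_chart_source _ x) hx)

theorem SmoothFieldOn.smoothOn_fieldRep {O : Set M} {X : VField E M} (hX : SmoothFieldOn O X)
    (he : IsSmoothChart e) : SmoothOn (fieldRep e X) (chartImage e O) := fun _ t hu ht =>
  (hX _ t (he.mSmoothCurveAt_symm hu ht.1) ht.2).smoothCurveAt he (e.map_target ht.1)

theorem SmoothFunOn.smoothOn_rep {O : Set M} {f : M → ℝ} (hf : SmoothFunOn E O f)
    (he : IsSmoothChart e) : SmoothOn (E := E) (fun u => f (e.symm u)) (chartImage e O) :=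
  fun _ t hu ht => hf _ t (he.mSmoothCurveAt_symm hu ht.1) ht.2

theorem SmoothFormOn.smoothCurveAt_rep {O : Set M} {α : PreForm E M} (hα : SmoothFormOn O α)
    (he : IsSmoothChart e) {u v : ℝ → E} {t : ℝ} (hu : SmoothCurveAt u t) (hv : SmoothCurveAt v t)
    (ht : u t ∈ chartImage e O) :
    SmoothCurveAt (fun s => α (e.symm (u s)) (tvec e (e.symm (u s)) (v s))) t :=
  hα.2 _ _ t (tSmoothCurveAt_tvec (he.mSmoothCurveAt_symm hu ht.1) he (e.map_target ht.1) hv) ht.2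

theorem SmoothFormOn.isLinearMap_rep {O : Set M} {α : PreForm E M} (hα : SmoothFormOn O α)
    (he : IsSmoothChart e) {u : E} (hu : u ∈ chartImage e O) :
    IsLinearMap ℝ fun v => α (e.symm u) (tvec e (e.symm u) v) := by
  have h1 := (hα.1 _ hu.2).1
  have h2 := isLinearMap_tvec he (e.map_target hu.1)
  exact ⟨fun v w => by rw [h2.map_add, h1.map_add], fun a v => by rw [h2.map_smul, h1.map_smul]⟩

theorem dFun_congr {O : Set M} (hO : IsOpen O) {f g : M → ℝ} (hg : SmoothFunOn E O g)
    (h : ∀ x ∈ O, f x = g x) {x : M} (hx : x ∈ O) : dFun E f x = dFun E g x :=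
  funext fun v => dirDeriv_congr (isOpen_chartImage (chartAt (CInf E) x) hO)
    (mem_chartImage (mem_chart_source _ x) hx) (hg.smoothOn_rep (isSmoothChart_chartAt x))
    (fun _ hu => h _ hu.2) v

end Charts

end Convenient

/-! ### Smooth maps and submersions -/

namespace Convenient

variable {E : Type*} [AddCommGroup E] [Module ℝ E] [TopologicalSpace E] [ConvenientSpace E]
variable {F : Type*} [AddCommGroup F] [Module ℝ F] [TopologicalSpace F] [ConvenientSpace F]
variable {M : Type*} [TopologicalSpace M] [ChartedSpace (CInf E) M] [ConvenientManifold E M]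
variable {Q : Type*} [TopologicalSpace Q] [ChartedSpace (CInf F) Q] [ConvenientManifold F Q]

omit [ConvenientSpace E] [ConvenientSpace F] in
theorem MapsBounded.comp {G : Type*} [AddCommGroup G] [Module ℝ G] [TopologicalSpace G]
    [ConvenientSpace G] {g : F → G} {f : E → F} (hg : MapsBounded g) (hf : MapsBounded f) :
    MapsBounded fun x => g (f x) := fun B hB => by
  have h := hg _ (hf B hB)
  rwa [image_image] at h

/-! ### Smooth maps and their tangent maps in charts -/

section SmoothMap

variable (E F) in
/-- Smooth maps between manifolds. -/
structure SmoothMap (j : M → Q) : Prop where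
  continuous : Continuous j
  curve : ∀ (c : ℝ → M) (t : ℝ), MSmoothCurveAt E c t → MSmoothCurveAt F (fun s => j (c s)) t

/-- The local representative of a map in charts. -/
def mapRep (e : OpenPartialHomeomorph M (CInf E)) (e' : OpenPartialHomeomorph Q (CInf F))
    (j : M → Q) : E → F := fun u => e' (j (e.symm u))

variable {e : OpenPartialHomeomorph M (CInf E)} {e' : OpenPartialHomeomorph Q (CInf F)}
  {j : M → Q}

theorem SmoothMap.smoothOn_mapRep (hj : SmoothMap E F j) (he : IsSmoothChart e)
    (he' : IsSmoothChart e') : SmoothOn (mapRep e e' j) (chartImage e (j ⁻¹' e'.source)) :=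
  fun _ t hc ht => (hj.curve _ t (he.mSmoothCurveAt_symm hc ht.1)).smoothCurveAt he' ht.2

omit [ChartedSpace (CInf E) M] [ConvenientManifold E M] [ChartedSpace (CInf F) Q]
  [ConvenientManifold F Q] in
theorem mapRep_apply {x : M} (hx : x ∈ e.source) : mapRep e e' j (e x) = e' (j x) :=
  congrArg (fun y => e' (j y)) (e.left_inv hx)

omit [ConvenientManifold E M] [ConvenientManifold F Q] in
theorem SmoothMap.isOpen_preimage_source (hj : SmoothMap E F j)
    (e' : OpenPartialHomeomorph Q (CInf F)) : IsOpen (j ⁻¹' e'.source) :=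
  e'.open_source.preimage hj.continuous

/-- The tangent map in charts. -/
theorem SmoothMap.tcoord_tMap (hj : SmoothMap E F j) (he : IsSmoothChart e)
    (he' : IsSmoothChart e') {x : M} (hx : x ∈ e.source) (hx' : j x ∈ e'.source)
    (v : Tangent E x) : tcoord e' (j x) (tMap E F j x v) =
      dirDeriv (mapRep e e' j) (e x) (tcoord e x v) := by
  have ha := isSmoothChart_chartAt (E := E) x
  have ha' := isSmoothChart_chartAt (E := F) (j x)
  set a := chartAt (CInf E) x with hadef
  set a' := chartAt (CInf F) (j x) with hadef'
  have hxa : x ∈ a.source := mem_chart_source _ x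
  have hxa' : j x ∈ a'.source := mem_chart_source _ (j x)
  have h1 := dirDeriv_comp (ha'.smoothOn_transition he') (isOpen_transitionDom a' e')
    (hj.smoothOn_mapRep ha ha') (u := a x) (mem_chartImage hxa hxa')
    (by rw [mapRep_apply hxa]; exact mem_transitionDom hxa' hx') v
  have h2 := dirDeriv_comp (hj.smoothOn_mapRep he he')
    (isOpen_chartImage e (hj.isOpen_preimage_source e')) (ha.smoothOn_transition he) (u := a x)
    (mem_transitionDom hxa hx) (by rw [transition_apply hxa]; exact mem_chartImage hx hx') v
  rw [mapRep_apply hxa] at h1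
  rw [transition_apply hxa] at h2
  refine Eq.trans h1.symm (Eq.trans ?_ h2)
  -- On a common domain both composites represent `j` from the chart `a` to the chart `e'`; the two
  -- applications of the chain rule therefore agree.
  have h3 : ∀ u ∈ chartImage a ((j ⁻¹' a'.source ∩ j ⁻¹' e'.source) ∩ e.source),
      transition a' e' (mapRep a a' j u) = mapRep a e' j u := fun u hu =>
    transition_apply hu.2.1.1 e'
  have h4 : ∀ u ∈ chartImage a ((j ⁻¹' a'.source ∩ j ⁻¹' e'.source) ∩ e.source),
      mapRep e e' j (transition a e u) = mapRep a e' j u := fun u hu => mapRep_apply hu.2.2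
  have h5 : SmoothOn (mapRep a e' j)
      (chartImage a ((j ⁻¹' a'.source ∩ j ⁻¹' e'.source) ∩ e.source)) :=
    (hj.smoothOn_mapRep ha he').mono fun u hu => ⟨hu.1, hu.2.1.2⟩
  have hO := isOpen_chartImage a (((hj.isOpen_preimage_source a').inter
    (hj.isOpen_preimage_source e')).inter e.open_source)
  have hm := mem_chartImage (E := E) hxa
    (show x ∈ (j ⁻¹' a'.source ∩ j ⁻¹' e'.source) ∩ e.source from ⟨⟨hxa', hx'⟩, hx⟩)
  exact (dirDeriv_congr hO hm h5 h3 v).trans (dirDeriv_congr hO hm h5 h4 v).symm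

theorem SmoothMap.tMap_tvec (hj : SmoothMap E F j) (he : IsSmoothChart e)
    (he' : IsSmoothChart e') {x : M} (hx : x ∈ e.source) (hx' : j x ∈ e'.source) (v : E) :
    tMap E F j x (tvec e x v) = tvec e' (j x) (dirDeriv (mapRep e e' j) (e x) v) := by
  apply tcoord_injective he' hx'
  rw [hj.tcoord_tMap he he' hx hx', tcoord_tvec he hx, tcoord_tvec he' hx']

theorem SmoothMap.isLinearMap_tMap (hj : SmoothMap E F j) (x : M) :
    IsLinearMap ℝ (tMap E F j x) :=
  (hj.smoothOn_mapRep (isSmoothChart_chartAt (E := E) x)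
    (isSmoothChart_chartAt (E := F) (j x))).isLinearMap_dirDeriv
    (isOpen_chartImage _ (hj.isOpen_preimage_source _))
    (mem_chartImage (mem_chart_source _ x) (mem_chart_source _ (j x)))

theorem SmoothMap.mapsBounded_tMap (hj : SmoothMap E F j) (x : M) :
    MapsBounded (E := E) (F := F) (tMap E F j x) :=
  (hj.smoothOn_mapRep (isSmoothChart_chartAt (E := E) x)
    (isSmoothChart_chartAt (E := F) (j x))).mapsBounded_dirDeriv
    (isOpen_chartImage _ (hj.isOpen_preimage_source _))
    (mem_chartImage (mem_chart_source _ x) (mem_chart_source _ (j x)))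

/-- The tangent map is smooth. -/
theorem SmoothMap.tSmoothCurveAt (hj : SmoothMap E F j) {c : ℝ → M} {v : ∀ s, Tangent E (c s)}
    {t : ℝ} (h : TSmoothCurveAt c v t) :
    TSmoothCurveAt (fun s => j (c s)) (fun s => tMap E F j (c s) (v s)) t := by
  have ha := isSmoothChart_chartAt (E := E) (c t)
  have ha' := isSmoothChart_chartAt (E := F) (j (c t))
  have hx : c t ∈ (chartAt (CInf E) (c t)).source := mem_chart_source _ _
  have hx' : j (c t) ∈ (chartAt (CInf F) (j (c t))).source := mem_chart_source _ _
  refine tSmoothCurveAt_of_chart (hj.curve c t h.1) ha' hx' ?_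
  refine ((hj.smoothOn_mapRep ha ha').dirDeriv_curve
    (isOpen_chartImage _ (hj.isOpen_preimage_source _)) h.1.2 h.2 (mem_chartImage hx hx')).congr ?_
  filter_upwards [h.1.eventually_mem (chartAt (CInf E) (c t)).open_source hx,
    h.1.eventually_mem (hj.isOpen_preimage_source (chartAt (CInf F) (j (c t)))) hx'] with s hs hs'
  exact hj.tcoord_tMap ha ha' hs hs' (v s)

omit [ConvenientManifold E M] [ConvenientManifold F Q] in
theorem SmoothMap.smoothFunOn_comp (hj : SmoothMap E F j) {V : Set Q} {f : Q → ℝ}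
    (hf : SmoothFunOn F V f) : SmoothFunOn E (j ⁻¹' V) (fun x => f (j x)) :=
  fun c t hc ht => hf _ t (hj.curve c t hc) ht

/-- The differential of a pulled back function. -/
theorem SmoothMap.dFun_comp (hj : SmoothMap E F j) {V : Set Q} (hV : IsOpen V) {f : Q → ℝ}
    (hf : SmoothFunOn F V f) {x : M} (hx : j x ∈ V) :
    dFun E (fun x => f (j x)) x = coMap E F j x (dFun F f (j x)) := by
  funext v
  have ha := isSmoothChart_chartAt (E := E) x
  have ha' := isSmoothChart_chartAt (E := F) (j x)
  set a := chartAt (CInf E) x with hadef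
  set a' := chartAt (CInf F) (j x) with hadef'
  have hxa : x ∈ a.source := mem_chart_source _ x
  have hxa' : j x ∈ a'.source := mem_chart_source _ (j x)
  have h1 := dirDeriv_comp (hf.smoothOn_rep ha') (isOpen_chartImage a' hV)
    (hj.smoothOn_mapRep ha ha') (u := a x) (mem_chartImage hxa hxa')
    (by rw [mapRep_apply hxa]; exact mem_chartImage hxa' hx) v
  rw [mapRep_apply hxa] at h1
  refine Eq.trans ?_ h1
  refine (dirDeriv_congr (isOpen_chartImage a ((hj.isOpen_preimage_source a').inter
    (hV.preimage hj.continuous))) (mem_chartImage hxa ⟨hxa', hx⟩)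
    (((hj.smoothFunOn_comp hf).smoothOn_rep ha).mono fun u hu => ⟨hu.1, hu.2.2⟩)
    (fun u hu => ?_) v).symm
  exact congrArg f (a'.left_inv hu.2.1)

end SmoothMap

/-! ### Lifting along submersions -/

section Lift

/-- The vector fields `X` and `X'` are `j`-related over `O`. -/
def RelatedOn (j : M → Q) (O : Set M) (X : VField E M) (X' : VField F Q) : Prop :=
  ∀ x ∈ O, tMap E F j x (X x) = X' (j x)

variable {j : M → Q}

/-- In adapted charts `j` is a bounded linear map, which is smooth, and continuous for the
`c^∞`-topologies. -/
theorem IsSubmersion.smoothMap (hj : IsSubmersion E F j) : SmoothMap E F j := by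
  have hcont : Continuous j := by
    refine continuous_iff_continuousAt.2 fun x => ?_
    obtain ⟨e, e', p, s, -, -, hp, -, -, hx, H⟩ := hj x
    have h1 : ContinuousAt (fun x' => e'.symm (p (e x' : E))) x := by
      refine ContinuousAt.comp (Y := CInf F) (f := fun x' => p (e x' : E))
        (g := e'.symm) ?_ ?_
      · refine e'.continuousAt_symm ?_
        rw [← (H x hx).2]
        exact e'.map_source (H x hx).1
      · exact ContinuousAt.comp (Y := CInf E) (f := e)
          (continuous_cInf_linear hp).continuousAt (e.continuousAt hx)
    refine h1.congr ?_
    filter_upwards [e.open_source.mem_nhds hx] with x' hx'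
    rw [← (H x' hx').2]
    exact e'.left_inv (H x' hx').1
  refine ⟨hcont, fun c t hc => ?_⟩
  obtain ⟨e, e', p, s, he, he', hp, -, -, hx, H⟩ := hj (c t)
  refine mSmoothCurveAt_of_chart (ContinuousAt.comp (f := c) hcont.continuousAt hc.1)
    (e := e') he' (H _ hx).1 ?_
  refine ((hc.smoothCurveAt he hx).linear_comp hp).1.congr ?_
  filter_upwards [hc.eventually_mem e.open_source hx] with s hs using (H _ hs).2

/-- Near every point there are bounded linear right inverses of the tangent maps of a submersion
that depend smoothly on the point. -/
theorem IsSubmersion.exists_lift (hj : IsSubmersion E F j) (x : M) :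
    ∃ (O : Set M) (r : ∀ x' : M, Tangent F (j x') → Tangent E x'), IsOpen O ∧ x ∈ O ∧
      (∀ x' ∈ O, IsLinearMap ℝ (r x') ∧ MapsBounded (E := F) (F := E) (r x') ∧
        ∀ w, tMap E F j x' (r x' w) = w) ∧
      ∀ (c : ℝ → M) (w : ∀ s, Tangent F (j (c s))) (t : ℝ), MSmoothCurveAt E c t → c t ∈ O →
        TSmoothCurveAt (fun s => j (c s)) w t → TSmoothCurveAt c (fun s => r (c s) (w s)) t := by
  have hs := hj.smoothMap
  obtain ⟨e, e', p, s, he, he', hp, hsb, hps, hx, H⟩ := hj x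
  -- In the adapted charts the lift is the constant right inverse `s` of the projection.
  refine ⟨e.source, fun x' w => tvec e x' (s (tcoord e' (j x') w)), e.open_source, hx,
    fun x' hx' => ⟨?_, ?_, fun w => ?_⟩, fun c w t hc ht hw => ?_⟩
  · have h1 := isLinearMap_tvec he hx'
    have h2 := isLinearMap_tcoord he' (H x' hx').1
    refine ⟨fun v w => ?_, fun a v => ?_⟩
    · change tvec e x' (s (tcoord e' (j x') (v + w))) = _
      rw [h2.map_add, s.map_add, h1.map_add]
    · change tvec e x' (s (tcoord e' (j x') (a • v))) = _
      rw [h2.map_smul, s.map_smul, h1.map_smul]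
  · exact (mapsBounded_tvec he hx').comp (hsb.comp (mapsBounded_tcoord he' (H x' hx').1))
  · apply tcoord_injective he' (H x' hx').1
    rw [hs.tcoord_tMap he he' hx' (H x' hx').1, tcoord_tvec he hx']
    refine (dirDeriv_congr (E := E) (F := F) (U := e.target) e.open_target (e.map_source hx')
      (smoothOn_linear hp _) (fun u hu => ?_) _).trans ((dirDeriv_linear hp _ _).trans (hps _))
    refine (H _ (e.map_target hu)).2.trans ?_
    exact congrArg p (e.right_inv hu)
  · exact tSmoothCurveAt_tvec hc he ht
      ((TSmoothCurveAt.smoothCurveAt hw he' (H _ ht).1).linear_comp hsb).1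

/-- Smooth curves can be lifted along a submersion. -/
theorem IsSubmersion.exists_curve_lift (hj : IsSubmersion E F j) (hsurj : Function.Surjective j)
    {c : ℝ → Q} {t : ℝ} (hc : MSmoothCurveAt F c t) :
    ∃ c' : ℝ → M, MSmoothCurveAt E c' t ∧ c = fun s => j (c' s) := by
  obtain ⟨x, hx⟩ := hsurj (c t)
  obtain ⟨e, e', p, s, he, he', hp, hsb, hps, hxe, H⟩ := hj x
  have hct : c t ∈ e'.source := hx ▸ (H x hxe).1
  let ψ : ℝ → F := fun r => e' (c r)
  let ex : E := e x
  have h1 : SmoothCurveAt ψ t := hc.smoothCurveAt he' hct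
  -- Start at the coordinates of `x` and add the `s`-lift of the increment of `c`. As `p ∘ s = id`,
  -- the projection is the curve `c` in the chart.
  let u : ℝ → E := fun r => ex + s (ψ r - ψ t)
  have hu : SmoothCurveAt u t := (smoothCurveAt_const ex t).add
    (((h1.sub (smoothCurveAt_const (ψ t) t)).linear_comp hsb).1)
  have hut : u t = ex := by simp [u]
  have hut' : u t ∈ e.target := by
    rw [hut]
    exact e.map_source hxe
  obtain ⟨σ, hσ⟩ := hsurj.hasRightInverse
  classical
  -- Away from `t` the local lift may fail, and the values of a set-theoretic section are used
  -- instead. Then `j ∘ c' = c` holds on the whole line, so that families over `c` can be regarded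
  -- as families over `j ∘ c'`.
  let c' : ℝ → M := fun r => if j (e.symm (u r)) = c r then e.symm (u r) else σ (c r)
  have hev : c' =ᶠ[𝓝 t] fun r => e.symm (u r) := by
    filter_upwards [hu.eventually_mem e.open_target hut', hc.eventually_mem e'.open_source hct]
      with r hr hr'
    have hr1 := e.map_target hr
    refine if_pos (e'.injOn (H _ hr1).1 hr' ?_)
    have h2 : (e (e.symm (u r)) : E) = u r := e.right_inv hr
    refine (H _ hr1).2.trans ?_
    rw [h2]
    simp only [u, map_add, hps]
    have h3 : p ex = ψ t := (H x hxe).2.symm.trans (congrArg e' hx)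
    rw [h3]
    exact add_sub_cancel (ψ t) (ψ r)
  refine ⟨c', (IsSmoothChart.mSmoothCurveAt_symm he hu hut').congr hev, funext fun r => ?_⟩
  simp only [c']
  split_ifs with h
  · exact h.symm
  · exact (hσ (c r)).symm

/-- Smooth vector fields can be lifted locally along a submersion. -/
theorem IsSubmersion.exists_field_lift (hj : IsSubmersion E F j) (x : M) {V : Set Q}
    (hV : IsOpen V) (hx : j x ∈ V) : ∃ O : Set M, IsOpen O ∧ x ∈ O ∧ O ⊆ j ⁻¹' V ∧
      ∀ X' : VField F Q, SmoothFieldOn V X' → ∃ X : VField E M, SmoothFieldOn O X ∧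
        RelatedOn j O X X' := by
  obtain ⟨O, r, hO, hxO, hr, hrs⟩ := hj.exists_lift x
  refine ⟨O ∩ j ⁻¹' V, hO.inter (hV.preimage hj.smoothMap.continuous), ⟨hxO, hx⟩,
    inter_subset_right, fun X' hX' => ⟨fun x' => r x' (X' (j x')), fun c t hc ht => ?_,
      fun x' hx' => (hr x' hx'.1).2.2 _⟩⟩
  exact hrs c (fun s => X' (j (c s))) t hc ht.1 (hX' _ t (hj.smoothMap.curve c t hc) ht.2)

/-- A bounded linear right inverse of `dj(x)` recovers `ξ` from its pull-back, so linearity and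
boundedness can be tested on either side. -/
theorem IsSubmersion.coMap_mem_cotangent_iff (hj : IsSubmersion E F j) (x : M)
    {ξ : Tangent F (j x) → ℝ} : coMap E F j x ξ ∈ cotangent E x ↔ ξ ∈ cotangent F (j x) := by
  have hl := hj.smoothMap.isLinearMap_tMap x
  constructor
  · rintro ⟨h1, h2⟩
    obtain ⟨O, r, hO, hxO, hr, -⟩ := hj.exists_lift x
    obtain ⟨r1, r2, r3⟩ := hr x hxO
    have e : ξ = fun w => coMap E F j x ξ (r x w) := funext fun w => (congrArg ξ (r3 w)).symm
    rw [e]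
    refine ⟨⟨fun v w => by rw [r1.map_add, h1.map_add], fun a v => by
      rw [r1.map_smul, h1.map_smul]⟩, MapsBounded.comp (E := F) (F := E) h2 r2⟩
  · rintro ⟨h1, h2⟩
    refine ⟨⟨fun v w => ?_, fun a v => ?_⟩,
      MapsBounded.comp (E := E) (F := F) h2 (hj.smoothMap.mapsBounded_tMap x)⟩
    · simp only [coMap]
      rw [hl.map_add, h1.map_add]
    · simp only [coMap]
      rw [hl.map_smul, h1.map_smul]
end Lift

end Convenient

/-! ### Naturality of brackets and Lie derivatives -/

namespace Convenient

variable {E : Type*} [AddCommGroup E] [Module ℝ E] [TopologicalSpace E] [ConvenientSpace E]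
variable {F : Type*} [AddCommGroup F] [Module ℝ F] [TopologicalSpace F] [ConvenientSpace F]

/-! ### Relatedness on open sets of the model spaces -/

section Local

variable {φ : E → F} {U : Set E} {V : Set F}

/-- Differentiate `Y'(φ u) = dφ(u) Y(u)` in the direction `v` and use the symmetry of `d²φ`. -/
theorem SmoothOn.dirDeriv_of_related (hφ : SmoothOn φ U) (hU : IsOpen (X := CInf E) U)
    (hV : IsOpen (X := CInf F) V) (hUV : ∀ u ∈ U, φ u ∈ V) {Y : E → E} {Y' : F → F}
    (hY : SmoothOn Y U) (hY' : SmoothOn Y' V) (h : ∀ u ∈ U, Y' (φ u) = Convenient.dirDeriv φ u (Y u))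
    {u : E} (hu : u ∈ U) (v : E) :
    Convenient.dirDeriv Y' (φ u) (Convenient.dirDeriv φ u v) =
      Convenient.dirDeriv (fun u => Convenient.dirDeriv φ u v) u (Y u) +
        Convenient.dirDeriv φ u (Convenient.dirDeriv Y u v) := by
  rw [hφ.dirDeriv_comm hU hu, ← hφ.dirDeriv_dirDeriv_apply hU hY hu,
    ← dirDeriv_comp hY' hV hφ hu (hUV u hu)]
  exact dirDeriv_congr (g := fun u => Convenient.dirDeriv φ u (Y u)) hU hu
    (fun c t hc ht => hφ.dirDeriv_curve hU hc (hY c t hc ht) ht) h v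

/-- The local formula for the bracket is natural. -/
theorem SmoothOn.bracket_related (hφ : SmoothOn φ U) (hU : IsOpen (X := CInf E) U)
    (hV : IsOpen (X := CInf F) V) (hUV : ∀ u ∈ U, φ u ∈ V) {X Y : E → E} {X' Y' : F → F}
    (hX : SmoothOn X U) (hX' : SmoothOn X' V) (hY : SmoothOn Y U) (hY' : SmoothOn Y' V)
    (h : ∀ u ∈ U, X' (φ u) = Convenient.dirDeriv φ u (X u))
    (h' : ∀ u ∈ U, Y' (φ u) = Convenient.dirDeriv φ u (Y u)) {u : E} (hu : u ∈ U) :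
    Convenient.dirDeriv φ u (Convenient.dirDeriv Y u (X u) - Convenient.dirDeriv X u (Y u)) =
      Convenient.dirDeriv Y' (φ u) (X' (φ u)) - Convenient.dirDeriv X' (φ u) (Y' (φ u)) := by
  -- The two terms in `d²φ(X, Y)` cancel by symmetry; this makes the coordinate formula invariant.
  rw [h u hu, h' u hu, hφ.dirDeriv_of_related hU hV hUV hY hY' h' hu,
    hφ.dirDeriv_of_related hU hV hUV hX hX' h hu, hφ.dirDeriv_comm hU hu,
    (hφ.isLinearMap_dirDeriv hU hu).map_sub]
  abel

/-- The local formula for the Lie derivative of a form is natural. -/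
theorem SmoothOn.lieDeriv_related (hφ : SmoothOn φ U) (hU : IsOpen (X := CInf E) U)
    (hV : IsOpen (X := CInf F) V) (hUV : ∀ u ∈ U, φ u ∈ V) {A : F → F → ℝ}
    (hA : ∀ (c v : ℝ → F) t, SmoothCurveAt c t → SmoothCurveAt v t → c t ∈ V →
      SmoothCurveAt (fun s => A (c s) (v s)) t)
    (hlin : ∀ y ∈ V, IsLinearMap ℝ (A y)) {X : E → E} {X' : F → F}
    (hX : SmoothOn X U) (hX' : SmoothOn X' V)
    (h : ∀ u ∈ U, X' (φ u) = Convenient.dirDeriv φ u (X u)) {u : E} (hu : u ∈ U) (v : E) :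
    Convenient.dirDeriv (fun u => A (φ u) (Convenient.dirDeriv φ u v)) u (X u) +
        A (φ u) (Convenient.dirDeriv φ u (Convenient.dirDeriv X u v)) =
      Convenient.dirDeriv (fun y => A y (Convenient.dirDeriv φ u v)) (φ u) (X' (φ u)) +
        A (φ u) (Convenient.dirDeriv X' (φ u) (Convenient.dirDeriv φ u v)) := by
  -- The derivative of `u ↦ A(φ u)(dφ(u) v)` contains `A(d²φ(X, v))`, which is exactly the
  -- second-order term in `dX'(dφ v)`.
  have h1 := dirDeriv_apply (A := fun u => A (φ u)) hU
    (fun c v t hc hv ht => hA _ _ t (hφ c t hc ht) hv (hUV _ ht)) (fun u hu => hlin _ (hUV u hu))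
    (hφ.dirDeriv hU v) hu (X u)
  have h2 := dirDeriv_comp (g := fun y => A y (Convenient.dirDeriv φ u v))
    (fun c t hc ht => hA _ _ t hc (smoothCurveAt_const _ t) ht) hV hφ hu (hUV u hu) (X u)
  rw [h1, h2, hφ.dirDeriv_of_related hU hV hUV hX hX' h hu, (hlin _ (hUV u hu)).map_add, h u hu,
    add_assoc]

end Local

variable {M : Type*} [TopologicalSpace M] [ChartedSpace (CInf E) M] [ConvenientManifold E M]
variable {Q : Type*} [TopologicalSpace Q] [ChartedSpace (CInf F) Q] [ConvenientManifold F Q]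
variable {j : M → Q} {O : Set M} {V : Set Q}

omit [ConvenientManifold E M] in
theorem fieldRep_apply {e : OpenPartialHomeomorph M (CInf E)} {x : M} (hx : x ∈ e.source)
    (X : VField E M) : fieldRep e X (e x) = tcoord e x (X x) :=
  congrArg (fun y => (tcoord e y (X y) : E)) (e.left_inv hx)

theorem SmoothMap.fieldRep_related (hj : SmoothMap E F j)
    {e : OpenPartialHomeomorph M (CInf E)} {e' : OpenPartialHomeomorph Q (CInf F)}
    (he : IsSmoothChart e) (he' : IsSmoothChart e') {X : VField E M} {X' : VField F Q}
    (h : RelatedOn j O X X') {u : E} (hu : u ∈ chartImage e (O ∩ j ⁻¹' e'.source)) :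
    fieldRep e' X' (mapRep e e' j u) = dirDeriv (mapRep e e' j) u (fieldRep e X u) := by
  refine (fieldRep_apply hu.2.2 X').trans ?_
  rw [← h _ hu.2.1, hj.tcoord_tMap he he' (e.map_target hu.1) hu.2.2]
  exact congrArg (fun w => dirDeriv (mapRep e e' j) w (fieldRep e X u)) (e.right_inv hu.1)

/-- The brackets of related vector fields are related. -/
theorem SmoothMap.relatedOn_lieBracket (hj : SmoothMap E F j) (hO : IsOpen O) (hV : IsOpen V)
    (hOV : O ⊆ j ⁻¹' V) {X Y : VField E M} {X' Y' : VField F Q} (hX : SmoothFieldOn O X)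
    (hY : SmoothFieldOn O Y) (hX' : SmoothFieldOn V X') (hY' : SmoothFieldOn V Y')
    (h : RelatedOn j O X X') (h' : RelatedOn j O Y Y') :
    RelatedOn j O (lieBracket X Y) (lieBracket X' Y') := by
  intro x hx
  have ha := isSmoothChart_chartAt (E := E) x
  have ha' := isSmoothChart_chartAt (E := F) (j x)
  have hxa : x ∈ (chartAt (CInf E) x).source := mem_chart_source _ x
  have hxa' : j x ∈ (chartAt (CInf F) (j x)).source := mem_chart_source _ (j x)
  set a := chartAt (CInf E) x with hadef
  set a' := chartAt (CInf F) (j x) with hadef'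
  have key := SmoothOn.bracket_related (φ := mapRep a a' j)
    (U := chartImage a (O ∩ j ⁻¹' a'.source)) (V := chartImage a' V)
    ((hj.smoothOn_mapRep ha ha').mono fun u hu => ⟨hu.1, hu.2.2⟩)
    (isOpen_chartImage a (hO.inter (hj.isOpen_preimage_source a'))) (isOpen_chartImage a' hV)
    (fun u hu => mem_chartImage hu.2.2 (hOV hu.2.1))
    ((hX.smoothOn_fieldRep ha).mono fun u hu => ⟨hu.1, hu.2.1⟩) (hX'.smoothOn_fieldRep ha')
    ((hY.smoothOn_fieldRep ha).mono fun u hu => ⟨hu.1, hu.2.1⟩) (hY'.smoothOn_fieldRep ha')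
    (fun u hu => hj.fieldRep_related ha ha' h hu) (fun u hu => hj.fieldRep_related ha ha' h' hu)
    (u := a x) (mem_chartImage hxa ⟨hx, hxa'⟩)
  rw [mapRep_apply hxa] at key
  exact key

/-- The Lie derivative of a form is natural. -/
theorem SmoothMap.lieDerivForm_coMap (hj : SmoothMap E F j) (hO : IsOpen O) (hV : IsOpen V)
    (hOV : O ⊆ j ⁻¹' V) {X : VField E M} {X' : VField F Q} (hX : SmoothFieldOn O X)
    (hX' : SmoothFieldOn V X') (h : RelatedOn j O X X') {α : PreForm E M} {α' : PreForm F Q}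
    (hα' : SmoothFormOn V α') (hα : ∀ x ∈ O, α x = coMap E F j x (α' (j x))) {x : M}
    (hx : x ∈ O) : lieDerivForm X α x = coMap E F j x (lieDerivForm X' α' (j x)) := by
  refine funext fun (v : E) => ?_
  have ha := isSmoothChart_chartAt (E := E) x
  have ha' := isSmoothChart_chartAt (E := F) (j x)
  have hxa : x ∈ (chartAt (CInf E) x).source := mem_chart_source _ x
  have hxa' : j x ∈ (chartAt (CInf F) (j x)).source := mem_chart_source _ (j x)
  have htv : ∀ w : F, tvec (chartAt (CInf F) (j x)) (j x) w = w := tvec_chartAt (j x)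
  set a := chartAt (CInf E) x with hadef
  set a' := chartAt (CInf F) (j x) with hadef'
  let A : F → F → ℝ := fun y w => α' (a'.symm y) (tvec a' (a'.symm y) w)
  have hφ : SmoothOn (mapRep a a' j) (chartImage a (O ∩ j ⁻¹' a'.source)) :=
    (hj.smoothOn_mapRep ha ha').mono fun u hu => ⟨hu.1, hu.2.2⟩
  have hU := isOpen_chartImage a (hO.inter (hj.isOpen_preimage_source a'))
  have hUV : ∀ u ∈ chartImage a (O ∩ j ⁻¹' a'.source), mapRep a a' j u ∈ chartImage a' V :=
    fun u hu => mem_chartImage hu.2.2 (hOV hu.2.1)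
  have hu : (a x : E) ∈ chartImage a (O ∩ j ⁻¹' a'.source) := mem_chartImage hxa ⟨hx, hxa'⟩
  have hA : ∀ (c v : ℝ → F) t, SmoothCurveAt c t → SmoothCurveAt v t → c t ∈ chartImage a' V →
      SmoothCurveAt (fun s => A (c s) (v s)) t :=
    fun c v t hc hv ht => hα'.smoothCurveAt_rep ha' hc hv ht
  have key := SmoothOn.lieDeriv_related hφ hU (isOpen_chartImage a' hV) hUV hA
    (fun y hy => hα'.isLinearMap_rep ha' hy)
    ((hX.smoothOn_fieldRep ha).mono fun u hu => ⟨hu.1, hu.2.1⟩) (hX'.smoothOn_fieldRep ha')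
    (fun u hu => hj.fieldRep_related ha ha' h hu) hu v
  rw [mapRep_apply hxa] at key
  have hA0 : ∀ w : F, A (a' (j x)) w = α' (j x) w := fun w => by
    have h1 : A (a' (j x)) w = α' (j x) (tvec a' (j x) w) :=
      congrArg (fun y => α' y (tvec a' y w)) (a'.left_inv hxa')
    rw [h1, htv]
  have hA1 : ∀ x' ∈ a.source, x' ∈ O → j x' ∈ a'.source →
      α x' (tvec a x' v) = A (a' (j x')) (dirDeriv (mapRep a a' j) (a x') v) :=
    fun x' hx' hO' hja => by
    rw [hα x' hO', coMap, hj.tMap_tvec ha ha' hx' hja]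
    exact congrArg (fun y => α' y (tvec a' y (dirDeriv (mapRep a a' j) (a x') v)))
      (a'.left_inv hja).symm
  rw [hA0, hA0] at key
  refine Eq.trans ?_ key
  refine congrArg₂ (· + ·) ?_ ?_
  · refine dirDeriv_congr hU hu
      (fun c t hc ht => hA _ _ t (hφ c t hc ht)
        (hφ.dirDeriv_curve hU hc (smoothCurveAt_const v t) ht) (hUV _ ht)) (fun u hu => ?_) _
    refine (hA1 _ (a.map_target hu.1) hu.2.1 hu.2.2).trans ?_
    exact congrArg (fun w => A (mapRep a a' j u) (dirDeriv (mapRep a a' j) w v)) (a.right_inv hu.1)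
  · exact congrFun (hα x hx) _

end Convenient

/-! ### Weak subbundles -/

namespace Convenient

variable {E : Type*} [AddCommGroup E] [Module ℝ E] [TopologicalSpace E] [ConvenientSpace E]
variable {B : Type*} [AddCommGroup B] [Module ℝ B] [TopologicalSpace B] [ConvenientSpace B]
variable {M : Type*} [TopologicalSpace M] [ChartedSpace (CInf E) M]

namespace WeakSubbundle

variable {W : WeakSubbundle E B M} {c : ℝ → M} {ξ : ∀ s, Tangent E (c s) → ℝ} {t : ℝ}

theorem SmoothCurveAt.congr {η : ∀ s, Tangent E (c s) → ℝ} (h : W.SmoothCurveAt c ξ t)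
    (hη : ∀ᶠ s in 𝓝 t, η s = ξ s) : W.SmoothCurveAt c η t := by
  obtain ⟨hc, b, hb, hξ⟩ := h
  refine ⟨hc, b, hb, ?_⟩
  filter_upwards [hξ, hη] with s hs hs'
  rw [hs, hs']

theorem SmoothCurveAt.eventually_mem (h : W.SmoothCurveAt c ξ t) :
    ∀ᶠ s in 𝓝 t, ξ s ∈ W.fib (c s) := by
  obtain ⟨hc, b, hb, hξ⟩ := h
  filter_upwards [hξ, hc.eventually_mem (W.isOpen_dom (c t)) (W.mem_dom (c t))] with s hs hs'
  rw [← W.range_frame (c t) (c s) hs', ← hs]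
  exact LinearMap.mem_range_self _ _

theorem SmoothCurveAt.apply (h : W.SmoothCurveAt c ξ t) {v : ∀ s, Tangent E (c s)}
    (hv : TSmoothCurveAt c v t) : Convenient.SmoothCurveAt (fun s => ξ s (v s)) t := by
  obtain ⟨hc, b, hb, hξ⟩ := h
  refine (W.smooth_inclusion (c t) c v b t hv (W.mem_dom _) hb).congr ?_
  filter_upwards [hξ] with s hs
  rw [hs]

/-- Smoothness of a curve of covectors can be checked in any trivialisation. -/
theorem smoothCurveAt_frame (hc : MSmoothCurveAt E c t) {x₀ : M} (ht : c t ∈ W.dom x₀) {b : ℝ → B}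
    (hb : Convenient.SmoothCurveAt b t) :
    W.SmoothCurveAt c (fun s => W.frame x₀ (c s) (b s)) t := by
  -- Coordinates in the trivialisation at `c t` are chosen pointwise; the axiom on changes of
  -- trivialisation then makes the choice smooth near `t`.
  have h1 : ∀ s, ∃ b' : B, c s ∈ W.dom x₀ → c s ∈ W.dom (c t) →
      W.frame (c t) (c s) b' = W.frame x₀ (c s) (b s) := fun s => by
    by_cases h : c s ∈ W.dom x₀ ∧ c s ∈ W.dom (c t)
    · have h2 : W.frame x₀ (c s) (b s) ∈ LinearMap.range (W.frame (c t) (c s)) := by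
        rw [W.range_frame _ _ h.2, ← W.range_frame _ _ h.1]
        exact LinearMap.mem_range_self _ _
      obtain ⟨b', hb'⟩ := h2
      exact ⟨b', fun _ _ => hb'⟩
    · exact ⟨0, fun h2 h3 => absurd ⟨h2, h3⟩ h⟩
  choose b' hb' using h1
  have h2 : ∀ᶠ s in 𝓝 t, W.frame (c t) (c s) (b' s) = W.frame x₀ (c s) (b s) := by
    filter_upwards [hc.eventually_mem (W.isOpen_dom x₀) ht,
      hc.eventually_mem (W.isOpen_dom (c t)) (W.mem_dom (c t))] with s hs hs' using hb' s hs hs'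
  exact ⟨hc, b', W.smooth_transition x₀ (c t) c b b' t hc ht (W.mem_dom _) hb h2, h2⟩

theorem SectionOn.mem_fib {U : Set M} {α : PreForm E M} (h : W.SectionOn U α) {x : M}
    (hx : x ∈ U) : α x ∈ W.fib x :=
  (h (fun _ => x) 0 (mSmoothCurveAt_const x 0) hx).eventually_mem.self_of_nhds

theorem SectionOn.smoothFormOn {U : Set M} {α : PreForm E M} (h : W.SectionOn U α) :
    SmoothFormOn U α :=
  ⟨fun x hx => W.fib_le x (h.mem_fib hx), fun c _ t hv ht => (h c t hv.1 ht).apply hv⟩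

theorem sectionOn_frame (W : WeakSubbundle E B M) (x₀ : M) (b : B) :
    W.SectionOn (W.dom x₀) fun x => W.frame x₀ x b :=
  fun _ t hc ht => smoothCurveAt_frame hc ht (smoothCurveAt_const b t)

theorem SectionOn.congr {U : Set M} (hU : IsOpen U) {α β : PreForm E M} (h : W.SectionOn U α)
    (hβ : ∀ x ∈ U, β x = α x) : W.SectionOn U β := fun c t hc ht =>
  (h c t hc ht).congr ((hc.eventually_mem hU ht).mono fun _ hs => hβ _ hs)

theorem Anchor.onForm_of_mem (P : W.Anchor) {α : PreForm E M} {x : M} (h : α x ∈ W.fib x) :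
    P.onForm α x = P x ⟨α x, h⟩ := dif_pos h

theorem Anchor.Smooth.smoothFieldOn {P : W.Anchor} (hP : P.Smooth) {U : Set M}
    {α : PreForm E M} (h : W.SectionOn U α) : SmoothFieldOn U (P.onForm α) := by
  classical
  intro c t hc ht
  have h1 := h c t hc ht
  -- Smoothness of `P` is stated for curves in the fibres at all times; the value `0` fills the
  -- times at which the section may leave them, which does not affect the germ at `t`.
  let ξ : ∀ s, W.fib (c s) := fun s => if hs : α (c s) ∈ W.fib (c s) then ⟨α (c s), hs⟩ else 0
  have h2 : W.SmoothCurveAt c (fun s => (ξ s : Tangent E (c s) → ℝ)) t := by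
    refine h1.congr ?_
    filter_upwards [h1.eventually_mem] with s hs
    simp only [ξ, dif_pos hs]
  refine (hP c ξ t h2).congr ?_
  filter_upwards [h1.eventually_mem] with s hs
  rw [P.onForm_of_mem hs]
  simp only [ξ, dif_pos hs]

end WeakSubbundle

end Convenient

/-! ### Projection of partial PN structures -/

namespace Convenient

variable {E : Type*} [AddCommGroup E] [Module ℝ E] [TopologicalSpace E] [ConvenientSpace E]
variable {F : Type*} [AddCommGroup F] [Module ℝ F] [TopologicalSpace F] [ConvenientSpace F]
variable {B : Type*} [AddCommGroup B] [Module ℝ B] [TopologicalSpace B] [ConvenientSpace B]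
variable {C : Type*} [AddCommGroup C] [Module ℝ C] [TopologicalSpace C] [ConvenientSpace C]
variable {M : Type*} [TopologicalSpace M] [ChartedSpace (CInf E) M] [ConvenientManifold E M]
variable {Q : Type*} [TopologicalSpace Q] [ChartedSpace (CInf F) Q] [ConvenientManifold F Q]
variable {j : M → Q} {W : WeakSubbundle E B M} {W' : WeakSubbundle F C Q}

omit [ConvenientManifold E M] in
theorem TEnd.Smooth.onField {N : TEnd E M} (hN : N.Smooth) {O : Set M} {X : VField E M}
    (hX : SmoothFieldOn O X) : SmoothFieldOn O (N.onField X) :=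
  fun c t hc ht => hN c _ t (hX c t hc ht)

variable (E) in
/-- The pull-back of a form. -/
noncomputable def pullback (j : M → Q) (α' : PreForm F Q) : PreForm E M := fun x => coMap E F j x (α' (j x))

/-! ### Sections and admissible functions of the induced subbundle -/

section Induced

omit [ConvenientManifold E M] [ConvenientManifold F Q] in
theorem IsInducedSubbundle.coMap_mem (hW : IsInducedSubbundle j W W') {x : M}
    {ξ : Tangent F (j x) → ℝ} (h : ξ ∈ W'.fib (j x)) : coMap E F j x ξ ∈ W.fib x :=
  ((hW.mem_fib (j x) fun _ => (ξ : F → ℝ)).1 h).2 x rfl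

theorem IsInducedSubbundle.mem_fib_of_pullback (hW : IsInducedSubbundle j W W')
    (hj : IsSubmersion E F j) {α' : PreForm F Q} (x : M)
    (h : ∀ x', j x' = j x → pullback E j α' x' ∈ W.fib x') : α' (j x) ∈ W'.fib (j x) :=
  (hW.mem_fib (j x) α').2 ⟨(hj.coMap_mem_cotangent_iff x).1 (W.fib_le x (h x rfl)), h⟩

/-- The sections of the induced bundle are the forms whose pull-backs are sections. -/
theorem IsInducedSubbundle.sectionOn_iff (hW : IsInducedSubbundle j W W')
    (hj : IsSubmersion E F j) (hsurj : Function.Surjective j) {V : Set Q} (hV : IsOpen V)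
    {α' : PreForm F Q} :
    W'.SectionOn V α' ↔ W.SectionOn (j ⁻¹' V) (pullback E j α') := by
  constructor
  · intro h c t hc ht
    have h1 := h _ t (hj.smoothMap.curve c t hc) ht
    exact (hW.smooth_iff c _ t hc h1.eventually_mem).1 h1
  · intro h c t hc ht
    obtain ⟨c', hc', rfl⟩ := hj.exists_curve_lift hsurj hc
    refine (hW.smooth_iff c' _ t hc' ?_).2 (h c' t hc' ht)
    filter_upwards [hc.eventually_mem hV ht] with s hs
    exact hW.mem_fib_of_pullback hj (c' s) fun x' hx' => h.mem_fib (by rw [mem_preimage, hx']; exact hs)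

theorem IsSubmersion.smoothFunOn_iff (hj : IsSubmersion E F j) (hsurj : Function.Surjective j)
    {V : Set Q} {f : Q → ℝ} :
    SmoothFunOn F V f ↔ SmoothFunOn E (j ⁻¹' V) fun x => f (j x) := by
  refine ⟨hj.smoothMap.smoothFunOn_comp, fun h c t hc ht => ?_⟩
  obtain ⟨c', hc', rfl⟩ := hj.exists_curve_lift hsurj hc
  exact h c' t hc' ht

/-- Smoothness of `f` and of `f ∘ j` are equivalent by lifting curves, and `d(f ∘ j)` is the
pull-back of `df`, so the criterion for sections applies. -/
theorem IsInducedSubbundle.admissible_iff (hW : IsInducedSubbundle j W W')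
    (hj : IsSubmersion E F j) (hsurj : Function.Surjective j) {V : Set Q} (hV : IsOpen V)
    {f : Q → ℝ} : f ∈ W'.Admissible V ↔ (fun x => f (j x)) ∈ W.Admissible (j ⁻¹' V) := by
  have hVj := hV.preimage hj.smoothMap.continuous
  constructor
  · rintro ⟨h1, h2⟩
    exact ⟨(hj.smoothFunOn_iff hsurj).1 h1, ((hW.sectionOn_iff hj hsurj hV).1 h2).congr hVj
      fun x hx => hj.smoothMap.dFun_comp hV h1 hx⟩
  · rintro ⟨h1, h2⟩
    have h3 := (hj.smoothFunOn_iff hsurj).2 h1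
    exact ⟨h3, (hW.sectionOn_iff hj hsurj hV).2 (h2.congr hVj
      fun x hx => (hj.smoothMap.dFun_comp hV h3 hx).symm)⟩

end Induced

/-! ### Descent of the axioms to related structures -/

section Structure

/-- The tensors `N` and `N'` are related by `j`. -/
def RelatedEnd (j : M → Q) (N : TEnd E M) (N' : TEnd F Q) : Prop :=
  ∀ x v, N' (j x) (tMap E F j x v) = tMap E F j x (N x v)

/-- The anchors `P` and `P'` are related by `j`. -/
def RelatedAnchor (j : M → Q) (P : W.Anchor) (P' : W'.Anchor) : Prop :=
  ∀ (x : M) (ξ : W'.fib (j x)) (h : coMap E F j x ξ.1 ∈ W.fib x),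
    P' (j x) ξ = tMap E F j x (P x ⟨coMap E F j x ξ.1, h⟩)

variable {P : W.Anchor} {P' : W'.Anchor} {N : TEnd E M} {N' : TEnd F Q}

omit [ConvenientManifold E M] [ConvenientManifold F Q] in
theorem RelatedEnd.coMap_comp (hN : RelatedEnd j N N') (x : M) (ξ : Tangent F (j x) → ℝ) :
    coMap E F j x (ξ ∘ N' (j x)) = coMap E F j x ξ ∘ N x :=
  funext fun v => congrArg ξ (hN x v)

omit [ConvenientManifold E M] [ConvenientManifold F Q] in
theorem RelatedEnd.pullback_transpose (hN : RelatedEnd j N N') (α' : PreForm F Q) :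
    pullback E j (N'.transpose α') = N.transpose (pullback E j α') :=
  funext fun x => hN.coMap_comp x (α' (j x))

omit [ConvenientManifold E M] [ConvenientManifold F Q] in
theorem RelatedEnd.onField (hN : RelatedEnd j N N') {O : Set M} {X : VField E M}
    {X' : VField F Q} (h : RelatedOn j O X X') :
    RelatedOn j O (N.onField X) (N'.onField X') := fun x hx => by
  rw [TEnd.onField, TEnd.onField, ← h x hx, hN]

/-- A smooth curve in `TQ` is lifted to `TM` with the smooth right inverses of `dj`, mapped by `N`
and projected. -/
theorem RelatedEnd.smooth (hj : IsSubmersion E F j) (hsurj : Function.Surjective j)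
    (hN : RelatedEnd j N N') (hNs : N.Smooth) : N'.Smooth := by
  intro c w t hw
  obtain ⟨c', hc', rfl⟩ := hj.exists_curve_lift hsurj hw.1
  obtain ⟨O, r, hO, hxO, hr, hrs⟩ := hj.exists_lift (c' t)
  refine (hj.smoothMap.tSmoothCurveAt (hNs c' _ t (hrs c' w t hc' hxO hw))).congr ?_
  filter_upwards [hc'.eventually_mem hO hxO] with s hs
  rw [← hN, (hr _ hs).2.2]

omit [ConvenientManifold E M] [ConvenientManifold F Q] in
theorem RelatedAnchor.onForm (hW : IsInducedSubbundle j W W') (hP : RelatedAnchor j P P')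
    {α' : PreForm F Q} {x : M} (hx : α' (j x) ∈ W'.fib (j x)) :
    tMap E F j x (P.onForm (pullback E j α') x) = P'.onForm α' (j x) := by
  rw [P'.onForm_of_mem hx, P.onForm_of_mem (hW.coMap_mem hx)]
  exact (hP x ⟨_, hx⟩ _).symm

theorem RelatedAnchor.smooth (hj : IsSubmersion E F j) (hsurj : Function.Surjective j)
    (hW : IsInducedSubbundle j W W') (hP : RelatedAnchor j P P') (hPs : P.Smooth) :
    P'.Smooth := by
  intro c ξ t hξ
  obtain ⟨c', hc', rfl⟩ := hj.exists_curve_lift hsurj hξ.1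
  have h1 := (hW.smooth_iff c' _ t hc' hξ.eventually_mem).1 hξ
  have h2 := hj.smoothMap.tSmoothCurveAt
    (hPs c' (fun s => ⟨_, hW.coMap_mem (ξ s).2⟩) t h1)
  exact h2.congr (Eventually.of_forall fun s => hP (c' s) (ξ s) _)

omit [ConvenientManifold E M] in
theorem WeakSubbundle.Anchor.onForm_congr (P : W.Anchor) {α β : PreForm E M} {x : M}
    (h : α x = β x) : P.onForm α x = P.onForm β x := by
  classical
  exact congrArg (fun ξ => if h : ξ ∈ W.fib x then P x ⟨ξ, h⟩ else 0) h

omit [ConvenientManifold E M] in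
theorem WeakSubbundle.Anchor.bracket_congr (P : W.Anchor) {f g f' g' : M → ℝ} {x : M}
    (hf : dFun E f x = dFun E f' x) (hg : dFun E g x = dFun E g' x) :
    P.bracket f g x = P.bracket f' g' x := by
  simp only [WeakSubbundle.Anchor.bracket]
  rw [hf, P.onForm_congr hg]

theorem RelatedAnchor.bracket (hj : IsSubmersion E F j) (hW : IsInducedSubbundle j W W')
    (hP : RelatedAnchor j P P') {V : Set Q} (hV : IsOpen V) {f g : Q → ℝ}
    (hf : f ∈ W'.Admissible V) (hg : g ∈ W'.Admissible V) {x : M} (hx : j x ∈ V) :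
    P.bracket (fun x => f (j x)) (fun x => g (j x)) x = P'.bracket f g (j x) := by
  have h1 := hP.onForm hW (hg.2.mem_fib hx)
  have h2 := hj.smoothMap.dFun_comp hV hg.1 hx
  simp only [WeakSubbundle.Anchor.bracket]
  rw [← h1, hj.smoothMap.dFun_comp hV hf.1 hx, P.onForm_congr (β := pullback E j (dFun F g)) h2]
  rfl

/-- Pull-back intertwines the brackets and detects admissible functions, so every identity at `y` is
the corresponding one on `M` at any point over `y`. -/
theorem RelatedAnchor.isPartialPoisson (hj : IsSubmersion E F j)
    (hsurj : Function.Surjective j) (hW : IsInducedSubbundle j W W')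
    (hP : RelatedAnchor j P P') (h : IsPartialPoisson P) : IsPartialPoisson P' := by
  have hmem : ∀ V : Set Q, IsOpen V → ∀ f ∈ W'.Admissible V, ∀ g ∈ W'.Admissible V,
      P'.bracket f g ∈ W'.Admissible V := by
    intro V hV f hf g hg
    have hVj := hV.preimage hj.smoothMap.continuous
    have h1 := h.bracket_mem _ hVj _ ((hW.admissible_iff hj hsurj hV).1 hf) _
      ((hW.admissible_iff hj hsurj hV).1 hg)
    have h2 : ∀ x ∈ j ⁻¹' V, P'.bracket f g (j x) =
        P.bracket (fun x => f (j x)) (fun x => g (j x)) x :=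
      fun x hx => (hP.bracket hj hW hV hf hg hx).symm
    refine (hW.admissible_iff hj hsurj hV).2 ⟨fun c t hc ht => ?_, ?_⟩
    · refine (h1.1 c t hc ht).congr ?_
      filter_upwards [hc.eventually_mem hVj ht] with s hs using h2 _ hs
    · exact h1.2.congr hVj fun x hx => dFun_congr hVj h1.1 h2 hx
  refine ⟨hP.smooth hj hsurj hW h.smooth, fun y ξ η => ?_, hmem, fun V hV f hf g hg k hk y hy => ?_⟩
  · obtain ⟨x, rfl⟩ := hsurj y
    rw [hP x ξ (hW.coMap_mem ξ.2), hP x η (hW.coMap_mem η.2)]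
    exact h.skew x ⟨_, hW.coMap_mem ξ.2⟩ ⟨_, hW.coMap_mem η.2⟩
  · obtain ⟨x, rfl⟩ := hsurj y
    have hVj := hV.preimage hj.smoothMap.continuous
    have key : ∀ f ∈ W'.Admissible V, ∀ g ∈ W'.Admissible V, ∀ k ∈ W'.Admissible V,
        P'.bracket f (P'.bracket g k) (j x) = P.bracket (fun x => f (j x))
          (P.bracket (fun x => g (j x)) (fun x => k (j x))) x := by
      intro f hf g hg k hk
      rw [← hP.bracket hj hW hV hf (hmem V hV g hg k hk) hy]
      -- The outer bracket depends only on the differential at `x` of the inner function, which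
      -- agrees with the pulled-back inner bracket on all of `j⁻¹(V)`.
      refine P.bracket_congr rfl (dFun_congr hVj (h.bracket_mem _ hVj _
        ((hW.admissible_iff hj hsurj hV).1 hg) _ ((hW.admissible_iff hj hsurj hV).1 hk)).1
        (fun x' hx' => (hP.bracket hj hW hV hg hk hx').symm) hy)
    rw [key f hf g hg k hk, key g hg k hk f hf, key k hk f hf g hg]
    exact h.jacobi _ hVj _ ((hW.admissible_iff hj hsurj hV).1 hf) _
      ((hW.admissible_iff hj hsurj hV).1 hg) _ ((hW.admissible_iff hj hsurj hV).1 hk) x hy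

/-- Local lifts of `X'` and `Y'` are related to them, hence so are all four brackets in the torsion.
Applying `dj` to the vanishing torsion of the lifts gives that of `X'` and `Y'`. -/
theorem RelatedEnd.isNijenhuis (hj : IsSubmersion E F j) (hsurj : Function.Surjective j)
    (hN : RelatedEnd j N N') (h : IsNijenhuis N) : IsNijenhuis N' := by
  have hs' := hN.smooth hj hsurj h.smooth
  refine ⟨hs', fun V hV X' Y' hX' hY' y hy => ?_⟩
  obtain ⟨x, rfl⟩ := hsurj y
  obtain ⟨O, hO, hxO, hOV, hlift⟩ := hj.exists_field_lift x hV hy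
  obtain ⟨X, hX, hXX'⟩ := hlift X' hX'
  obtain ⟨Y, hY, hYY'⟩ := hlift Y' hY'
  have hNX := h.smooth.onField hX
  have hNY := h.smooth.onField hY
  have hNX' := hs'.onField hX'
  have hNY' := hs'.onField hY'
  have b1 := hj.smoothMap.relatedOn_lieBracket hO hV hOV hNX hNY hNX' hNY'
    (hN.onField hXX') (hN.onField hYY') x hxO
  have b2 := hj.smoothMap.relatedOn_lieBracket hO hV hOV hNX hY hNX' hY'
    (hN.onField hXX') hYY' x hxO
  have b3 := hj.smoothMap.relatedOn_lieBracket hO hV hOV hX hNY hX' hNY'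
    hXX' (hN.onField hYY') x hxO
  have b4 := hj.smoothMap.relatedOn_lieBracket hO hV hOV hX hY hX' hY' hXX' hYY' x hxO
  have hl := hj.smoothMap.isLinearMap_tMap x
  have h0 := congrArg (tMap E F j x) (h.torsion_eq_zero O hO X Y hX hY x hxO)
  simp only [TEnd.torsion, TEnd.onField, Pi.sub_apply, Pi.add_apply] at h0 b1 b2 b3 b4 ⊢
  rw [hl.map_zero, hl.map_sub, ← hN, hl.map_sub, hl.map_add, ← hN] at h0
  unfold TEnd.onField at *
  rw [b1, b2, b3, b4] at h0
  exact h0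

/-- A partial PN structure descends along a submersion. -/
theorem IsPartialPN.of_related (hj : IsSubmersion E F j) (hsurj : Function.Surjective j)
    (hW : IsInducedSubbundle j W W') (hP : RelatedAnchor j P P') (hN : RelatedEnd j N N')
    (h : IsPartialPN P N) : IsPartialPN P' N' := by
  have hPs := hP.smooth hj hsurj hW h.poisson.smooth
  have hNs := hN.smooth hj hsurj h.nijenhuis.smooth
  have hmem : ∀ (y : Q), ∀ ξ ∈ W'.fib y, ξ ∘ N' y ∈ W'.fib y := by
    intro y ξ hξ
    obtain ⟨x, rfl⟩ := hsurj y
    let ξ₀ : PreForm F Q := fun _ => (ξ : F → ℝ)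
    have h1 := ((hW.mem_fib (j x) ξ₀).1 hξ).2
    refine hW.mem_fib_of_pullback hj (α' := N'.transpose ξ₀) x fun x' hx' => ?_
    rw [hN.pullback_transpose]
    exact h.transpose_mem x' _ (h1 x' hx')
  -- `P'(σ)` is related to `P` of the pull-back of `σ`, and `N'P'(σ)` to `N` of that field. Both Lie
  -- derivatives are thus natural, although only their difference need be a section.
  have hform : ∀ V : Set Q, IsOpen V → ∀ α σ : PreForm F Q, W'.SectionOn V α → W'.SectionOn V σ →
      ∀ x ∈ j ⁻¹' V, pullback E j (concomitantForm N' α (P'.onForm σ)) x =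
        concomitantForm N (pullback E j α) (P.onForm (pullback E j σ)) x := by
    intro V hV α σ hα hσ x hx
    have hVj := hV.preimage hj.smoothMap.continuous
    have hσ1 := (hW.sectionOn_iff hj hsurj hV).1 hσ
    have hX := h.poisson.smooth.smoothFieldOn hσ1
    have hX' := hPs.smoothFieldOn hσ
    have hXX' : RelatedOn j (j ⁻¹' V) (P.onForm (pullback E j σ)) (P'.onForm σ) :=
      fun x hx => hP.onForm hW (hσ.mem_fib hx)
    have hNα : SmoothFormOn V (N'.transpose α) :=
      ⟨fun y hy => W'.fib_le _ (hmem y _ (hα.mem_fib hy)),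
        fun c v t hv ht => hα.smoothFormOn.2 c _ t (hNs c v t hv) ht⟩
    have e1 := hj.smoothMap.lieDerivForm_coMap hVj hV subset_rfl hX hX' hXX' hNα
      (α := N.transpose (pullback E j α)) (fun x _ => by rw [← hN.pullback_transpose]; rfl) hx
    have e2 := hj.smoothMap.lieDerivForm_coMap hVj hV subset_rfl (h.nijenhuis.smooth.onField hX)
      (hNs.onField hX') (hN.onField hXX') hα.smoothFormOn (α := pullback E j α)
      (fun x _ => rfl) hx
    simp only [concomitantForm, Pi.sub_apply, e1, e2]
    rfl
  have hsec : ∀ V : Set Q, IsOpen V → ∀ α σ : PreForm F Q, W'.SectionOn V α → W'.SectionOn V σ →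
      W'.SectionOn V (concomitantForm N' α (P'.onForm σ)) := by
    intro V hV α σ hα hσ
    have hVj := hV.preimage hj.smoothMap.continuous
    exact (hW.sectionOn_iff hj hsurj hV).2 ((h.concomitant_form _ hVj _ _
      ((hW.sectionOn_iff hj hsurj hV).1 hα) ((hW.sectionOn_iff hj hsurj hV).1 hσ)).congr hVj
      (hform V hV α σ hα hσ))
  refine ⟨hP.isPartialPoisson hj hsurj hW h.poisson, hN.isNijenhuis hj hsurj h.nijenhuis, hmem,
    ?_, ?_, ?_, ?_⟩
  · intro c ξ t hξ
    obtain ⟨c', hc', rfl⟩ := hj.exists_curve_lift hsurj hξ.1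
    refine (hW.smooth_iff c' _ t hc' ?_).2 ?_
    · filter_upwards [hξ.eventually_mem] with s hs using hmem _ _ hs
    · have h1 := h.transpose_smooth c' _ t ((hW.smooth_iff c' _ t hc' hξ.eventually_mem).1 hξ)
      exact h1.congr (Eventually.of_forall fun s => hN.coMap_comp _ _)
  · intro y ξ
    obtain ⟨x, rfl⟩ := hsurj y
    rw [hP x ξ (hW.coMap_mem ξ.2), hN, h.comm,
      hP x ⟨_, hmem _ _ ξ.2⟩ (hW.coMap_mem (hmem _ _ ξ.2))]
    congr 3
    exact (hN.coMap_comp x ξ.1).symm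
  · exact hsec
  · intro V hV α σ hα hσ y hy
    obtain ⟨x, rfl⟩ := hsurj y
    have hVj := hV.preimage hj.smoothMap.continuous
    have hα1 := (hW.sectionOn_iff hj hsurj hV).1 hα
    have hσ1 := (hW.sectionOn_iff hj hsurj hV).1 hσ
    have hZ := h.poisson.smooth.smoothFieldOn hα1
    have hZ' := hPs.smoothFieldOn hα
    have hZZ' : RelatedOn j (j ⁻¹' V) (P.onForm (pullback E j α)) (P'.onForm α) :=
      fun x hx => hP.onForm hW (hα.mem_fib hx)
    have hX := h.poisson.smooth.smoothFieldOn hσ1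
    have hX' := hPs.smoothFieldOn hσ
    have hXX' : RelatedOn j (j ⁻¹' V) (P.onForm (pullback E j σ)) (P'.onForm σ) :=
      fun x hx => hP.onForm hW (hσ.mem_fib hx)
    -- No local lifts are needed here: the fields `P` of the pulled-back sections are themselves
    -- related to `P'(α)` and `P'(σ)` over the whole of `j⁻¹(V)`.
    have b1 := hj.smoothMap.relatedOn_lieBracket hVj hV subset_rfl hZ
      (h.nijenhuis.smooth.onField hX) hZ' (hNs.onField hX') hZZ' (hN.onField hXX') x hy
    have b2 := hj.smoothMap.relatedOn_lieBracket hVj hV subset_rfl hZ hX hZ' hX' hZZ' hXX' x hy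
    have b3 := hP.onForm hW ((hsec V hV α σ hα hσ).mem_fib hy)
    rw [P.onForm_congr (hform V hV α σ hα hσ x hy)] at b3
    have hl := hj.smoothMap.isLinearMap_tMap x
    have h0 := congrArg (tMap E F j x) (h.concomitant_eq_zero _ hVj _ _ hα1 hσ1 x hy)
    simp only [concomitant, TEnd.lieDeriv, Pi.sub_apply] at h0 ⊢
    rw [hl.map_zero, hl.map_sub, hl.map_sub, b1, b3] at h0
    unfold TEnd.onField at h0 ⊢
    rw [← hN, b2] at h0
    exact h0

end Structure

end Convenient

/-! ### Existence of the projections -/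

namespace Convenient

variable {E : Type*} [AddCommGroup E] [Module ℝ E] [TopologicalSpace E] [ConvenientSpace E]
variable {F : Type*} [AddCommGroup F] [Module ℝ F] [TopologicalSpace F] [ConvenientSpace F]
variable {B : Type*} [AddCommGroup B] [Module ℝ B] [TopologicalSpace B] [ConvenientSpace B]
variable {C : Type*} [AddCommGroup C] [Module ℝ C] [TopologicalSpace C] [ConvenientSpace C]
variable {M : Type*} [TopologicalSpace M] [ChartedSpace (CInf E) M] [ConvenientManifold E M]
variable {Q : Type*} [TopologicalSpace Q] [ChartedSpace (CInf F) Q] [ConvenientManifold F Q]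
variable {j : M → Q}

/-- The form that is constant in a chart. -/
theorem IsSmoothChart.smoothFormOn_clm {e' : OpenPartialHomeomorph Q (CInf F)}
    (he' : IsSmoothChart e') (l : F →L[ℝ] ℝ) :
    SmoothFormOn (E := F) e'.source fun y w => l (tcoord e' y w) := by
  refine ⟨fun y hy => ⟨?_, ?_⟩, fun c v t hv ht => ?_⟩
  · have h := isLinearMap_tcoord he' hy
    refine ⟨fun v w => ?_, fun a v => ?_⟩
    · exact (congrArg l (h.map_add v w)).trans (map_add l _ _)
    · exact (congrArg l (h.map_smul a v)).trans (map_smul l _ _)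
  · exact MapsBounded.comp (E := F) (F := F) (g := l) (fun B hB => hB.image l)
      (mapsBounded_tcoord he' hy)
  · exact ((hv.smoothCurveAt he' ht).linear_comp (L := l.toLinearMap) fun B hB => hB.image l).1

/-- The projection of a tensor whose transpose preserves projectable forms. -/
theorem exists_relatedEnd (hj : IsSubmersion E F j) (hsurj : Function.Surjective j) (N : TEnd E M)
    (PpN : ∀ V : Set Q, IsOpen V → ∀ α ∈ projectableForms E F j V,
      N.transpose α ∈ projectableForms E F j V) : ∃ N' : TEnd F Q, RelatedEnd j N N' := by
  have hinv : ∀ (x₁ x₂ : M) (v₁ : Tangent E x₁) (v₂ : Tangent E x₂), j x₁ = j x₂ →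
      (tMap E F j x₁ v₁ : F) = (tMap E F j x₂ v₂ : F) →
        (tMap E F j x₁ (N x₁ v₁) : F) = (tMap E F j x₂ (N x₂ v₂) : F) := by
    intro x₁ x₂ v₁ v₂ hx hv
    -- Test against a functional `l`, extended to the form with constant coordinates near `j x₁`. By
    -- (PpN), `N^*` of its pull-back is the pull-back of some `β`, so `l (dj N v) = β (dj v)`
    -- depends on `dj v` only.
    refine eq_of_forall_dual (E := F) fun l => ?_
    have ha := isSmoothChart_chartAt (E := F) (j x₁)
    obtain ⟨β, -, hβ⟩ := PpN _ (chartAt (CInf F) (j x₁)).open_source _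
      ⟨_, ha.smoothFormOn_clm l, fun _ _ => rfl⟩
    have key : ∀ x, j x = j x₁ → ∀ v : Tangent E x, l (tMap E F j x (N x v)) =
        (β (j x₁) : F → ℝ) (tMap E F j x v) := by
      intro x hx v
      have hxs : x ∈ j ⁻¹' (chartAt (CInf F) (j x₁)).source := by
        rw [mem_preimage, hx]
        exact mem_chart_source _ _
      have h1 := congrFun (hβ x hxs) v
      have h2 : (tcoord (chartAt (CInf F) (j x₁)) (j x) (tMap E F j x (N x v)) : F) =
          tMap E F j x (N x v) := by
        have h3 : ∀ y, y = j x₁ → ∀ w : F,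
            (tcoord (chartAt (CInf F) (j x₁)) y (w : F) : F) = w := by
          rintro _ rfl w
          exact tcoord_chartAt (j x₁) w
        exact h3 _ hx _
      have h4 : (β (j x₁) : F → ℝ) = (β (j x) : F → ℝ) :=
        @congrArg Q (F → ℝ) _ _ β hx.symm
      rw [h4]
      refine Eq.trans ?_ h1
      exact congrArg l h2.symm
    rw [key x₁ rfl, key x₂ hx.symm]
    exact congrArg (β (j x₁) : F → ℝ) hv
  obtain ⟨σ, hσ⟩ := hsurj.hasRightInverse
  have hr : ∀ x : M, ∃ r : F → E, IsLinearMap ℝ r ∧ ∀ w : F, (tMap E F j x (r w) : F) = w :=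
    fun x => by
      obtain ⟨O, r, hO, hx, hr, -⟩ := hj.exists_lift x
      exact ⟨r x, (hr x hx).1, (hr x hx).2.2⟩
  choose r hr1 hr2 using hr
  have hl := fun x => hj.smoothMap.isLinearMap_tMap x
  let T : ∀ x, E →ₗ[ℝ] F := fun x => (hl x).mk' _
  let N₀ : ∀ x, E →ₗ[ℝ] E := fun x => N x
  -- Lift linearly at a chosen point over `y`, apply `N` and project; by `hinv` the choices are
  -- immaterial.
  let N' : TEnd F Q := fun y => (T (σ y) ∘ₗ N₀ (σ y) ∘ₗ (hr1 (σ y)).mk' _ : F →ₗ[ℝ] F)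
  exact ⟨N', fun x v => hinv (σ (j x)) x (r (σ (j x)) (tMap E F j x v)) v (hσ (j x)) (hr2 _ _)⟩

variable {W : WeakSubbundle E B M} {W' : WeakSubbundle F C Q}

/-- The projection of an anchor that maps projectable forms to projectable vector fields. -/
theorem exists_relatedAnchor (hj : IsSubmersion E F j) (hsurj : Function.Surjective j)
    (hW : IsInducedSubbundle j W W') (P : W.Anchor)
    (PpP : ∀ V : Set Q, IsOpen V → ∀ α ∈ projectableForms E F j V,
      W.SectionOn (j ⁻¹' V) α → P.onForm α ∈ projectableFields E F j V) :
    ∃ P' : W'.Anchor, RelatedAnchor j P P' := by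
  have hmem : ∀ (y : Q) (ξ : F → ℝ), ξ ∈ W'.fib y → ∀ x, j x = y →
      coMap E F j x ξ ∈ W.fib x := fun y ξ hξ x hx => ((hW.mem_fib y fun _ => ξ).1 hξ).2 x hx
  have hinv : ∀ (x₁ x₂ : M) (ξ : F → ℝ) (h₁ : coMap E F j x₁ ξ ∈ W.fib x₁)
      (h₂ : coMap E F j x₂ ξ ∈ W.fib x₂), j x₁ = j x₂ → ξ ∈ W'.fib (j x₁) →
        (tMap E F j x₁ (P x₁ ⟨_, h₁⟩) : F) = (tMap E F j x₂ (P x₂ ⟨_, h₂⟩) : F) := by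
    intro x₁ x₂ ξ h₁ h₂ hx hξ
    -- The covector is `frame b` at its base point. Keeping `b` fixed extends it to a smooth local
    -- section, whose pull-back is a projectable section of `T^♭M` to which (PpP) applies.
    rw [← W'.range_frame (j x₁) (j x₁) (W'.mem_dom _)] at hξ
    obtain ⟨b, rfl⟩ := hξ
    let α' : PreForm F Q := fun y => W'.frame (j x₁) y b
    have hs : W'.SectionOn (W'.dom (j x₁)) α' := W'.sectionOn_frame (j x₁) b
    have hV := W'.isOpen_dom (j x₁)
    obtain ⟨-, hP⟩ := PpP _ hV (pullback E j α') ⟨α', hs.smoothFormOn, fun _ _ => rfl⟩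
      ((hW.sectionOn_iff hj hsurj hV).1 hs)
    have hm₁ : x₁ ∈ j ⁻¹' W'.dom (j x₁) := W'.mem_dom _
    have hm₂ : x₂ ∈ j ⁻¹' W'.dom (j x₁) := by
      rw [mem_preimage, ← hx]
      exact W'.mem_dom _
    have h3 := congrArg (fun p : Σ y : Q, Tangent F y => (p.2 : F)) (hP x₁ hm₁ x₂ hm₂ hx)
    have key : ∀ x (h : coMap E F j x (α' (j x₁) : F → ℝ) ∈ W.fib x), j x = j x₁ →
        P.onForm (pullback E j α') x = P x ⟨_, h⟩ := by
      intro x h hx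
      have e : pullback E j α' x = coMap E F j x (α' (j x₁) : F → ℝ) :=
        congrArg (fun y => coMap E F j x (α' y : F → ℝ)) hx
      rw [P.onForm_congr (β := fun x => coMap E F j x (α' (j x₁) : F → ℝ)) e]
      exact P.onForm_of_mem h
    simp only [key x₁ h₁ rfl, key x₂ h₂ hx.symm] at h3
    exact h3
  obtain ⟨σ, hσ⟩ := hsurj.hasRightInverse
  have hl := fun x => hj.smoothMap.isLinearMap_tMap x
  let T : ∀ x, E →ₗ[ℝ] F := fun x => (hl x).mk' _
  let P₀ : ∀ x, W.fib x →ₗ[ℝ] E := fun x => P x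
  let D : ∀ y, W'.fib y →ₗ[ℝ] W.fib (σ y) := fun y =>
    { toFun := fun ξ => ⟨coMap E F j (σ y) (ξ.1 : F → ℝ), hmem y ξ.1 ξ.2 _ (hσ y)⟩
      map_add' := fun _ _ => rfl
      map_smul' := fun _ _ => rfl }
  -- The composite `dj ∘ P ∘ δj` at a chosen point over `y`.
  let P' : W'.Anchor := fun y => (T (σ y) ∘ₗ P₀ (σ y) ∘ₗ D y : W'.fib y →ₗ[ℝ] F)
  refine ⟨P', fun x ξ h => hinv (σ (j x)) x ξ.1 _ h (hσ (j x)) ?_⟩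
  have h1 := ξ.2
  have h2 : ∀ y, y = j x → (ξ.1 : F → ℝ) ∈ W'.fib y := by
    rintro _ rfl
    exact h1
  exact h2 _ (hσ (j x))

end Convenient

open Convenient
theorem mainTheorem9
    {E : Type*} [AddCommGroup E] [Module ℝ E] [TopologicalSpace E] [ConvenientSpace E]
    {F : Type*} [AddCommGroup F] [Module ℝ F] [TopologicalSpace F] [ConvenientSpace F]
    {B : Type*} [AddCommGroup B] [Module ℝ B] [TopologicalSpace B] [ConvenientSpace B]
    {C : Type*} [AddCommGroup C] [Module ℝ C] [TopologicalSpace C] [ConvenientSpace C]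
    {M : Type*} [TopologicalSpace M] [ChartedSpace (CInf E) M] [ConvenientManifold E M]
    {Q : Type*} [TopologicalSpace Q] [ChartedSpace (CInf F) Q] [ConvenientManifold F Q]
    (W : WeakSubbundle E B M) (P : W.Anchor) (N : TEnd E M) (hPN : IsPartialPN P N)
    (𝒟 : ∀ x : M, Submodule ℝ (Tangent E x)) (j : M → Q) (hj : IsLeafSpace E F 𝒟 j)
    (W' : WeakSubbundle F C Q) (hW' : IsInducedSubbundle j W W')
    (PpP : ∀ V : Set Q, IsOpen V → ∀ α ∈ projectableForms E F j V,
      W.SectionOn (j ⁻¹' V) α → P.onForm α ∈ projectableFields E F j V)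
    (PpN : ∀ V : Set Q, IsOpen V → ∀ α ∈ projectableForms E F j V,
      N.transpose α ∈ projectableForms E F j V) :
    ∃ (P' : W'.Anchor) (N' : TEnd F Q), IsPartialPN P' N' ∧
      (∀ (x : M) (ξ : W'.fib (j x)), ∃ h : coMap E F j x ξ.1 ∈ W.fib x,
        P' (j x) ξ = tMap E F j x (P x ⟨coMap E F j x ξ.1, h⟩)) ∧
      (∀ (x : M), ∀ ξ ∈ cotangent F (j x),
        coMap E F j x (ξ ∘ N' (j x)) = coMap E F j x ξ ∘ N x) := by
  obtain ⟨P', hP'⟩ := exists_relatedAnchor hj.submersion hj.surjective hW' P PpP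
  obtain ⟨N', hN'⟩ := exists_relatedEnd hj.submersion hj.surjective N PpN
  exact ⟨P', N', hPN.of_related hj.submersion hj.surjective hW' hP' hN',
    fun x ξ => ⟨hW'.coMap_mem ξ.2, hP' x ξ _⟩, fun x ξ _ => hN'.coMap_comp x ξ⟩
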